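/- **Definitions.** For a finite simple graph $G=(V,E)$ let $\mathrm{STAB}(G)\subseteq\mathbb R^V$ be the convex hull of the incidence vectors of the stable sets of $G$. A face of a polytope is the set of its points that maximize some linear functional. The extension complexity $\mathrm{xc}(P)$ of a polytope $P$ is the minimum number of facets of a polytope $Q$ of which $P$ is the image under a linear map. A *drawing* of $G$ places the vertices at distinct points of the plane and represents each edge by a simple arc joining its ends and passing through no other vertex, such that there are finitely many crossings (points, other than vertices, lying on two different edges), no three edges pass through the same crossing, and at every crossing the two edges cross properly (in suitable local coordinates they are the two coordinate axes). A graph is *planar* if it has a drawing without crossings. A *crossover gadget* is a graph $H$ on 22 vertices with four distinguished vertices (terminals) $v_1,v_1',v_2,v_2'$ such that * $H$ can be drawn without crossings in a square with $v_1,v_2,v_1',v_2'$ at the midpoints of the left, upper, right and lower side and everything else in the interior; * for every set $A$ of terminals with $|A\cap\{v_1,v_1'\}|=i$ and $|A\cap\{v_2,v_2'\}|=j$, the maximum size of a stable set of $H$ whose set of terminals is exactly $A$ is $s_{ij}$, where $s_{22}=9$, $s_{21}=8$, $s_{20}=7$, $s_{12}=9$, $s_{11}=9$, $s_{10}=8$,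 $s_{02}=8$, $s_{01}=8$, $s_{00}=7$ (these are the values for the gadget of Garey, Johnson and Stockmeyer). Given a drawing of $G$, *replacing every crossing with $H$* gives the graph $G'$ with vertex set $V$ together with a copy of $V(H)$ for every crossing. At each crossing one of the two edges (an arbitrary one) is assigned to the pair $v_1,v_1'$, and the other one to $v_2,v_2'$. The edges of $G'$ are those of the copies of $H$ and, for each edge $uw$ of $G$, traversed from $u$ to $w$ (the direction being chosen arbitrarily), the edges linking consecutive members of the sequence consisting of $u$, the crossings on $uw$ in the order in which they are met, and $w$; at a crossing one arrives at $v_1$ and leaves from $v_1'$ (respectively, arrives at $v_2$ and leaves from $v_2'$). In particular an edge without crossings is kept. **Theorem.** 1. Crossover gadgets exist. Explicitly, the graph on $\{0,\dots,21\}$ with $v_1=0$, $v_1'=1$, $v_2=2$, $v_2'=3$ and the 35 edges $0\,9$, $0\,11$, $0\,17$, $0\,19$, $1\,8$, $1\,10$, $1\,16$, $1\,18$, $2\,16$, $2\,17$, $3\,18$, $3\,19$, $4\,8$, $5\,9$, $6\,10$, $7\,11$, $4\,12$, $5\,13$, $6\,14$, $7\,15$, $4\,16$, $5\,17$, $6\,18$,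 $7\,19$, $8\,16$, $9\,17$, $10\,18$, $11\,19$, $8\,20$, $9\,20$, $10\,21$, $11\,21$, $12\,13$, $14\,15$, $20\,21$ is one. 2. Let $G$ be a finite graph and let $G'$ be obtained from any drawing of $G$ by replacing every crossing with a crossover gadget $H$. Then $G'$ is planar, and $\mathrm{STAB}(G)$ is the projection of a face of $\mathrm{STAB}(G')$ onto the coordinates indexed by $V(G)$. 3. There are constants $C$ and $c>0$ such that for every $n\ge 1$ there is a planar graph $G$ with at most $Cn^2$ vertices and at most $Cn^2$ edges such that $\mathrm{xc}(\mathrm{STAB}(G))\ge 2^{c\sqrt n}$. -/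

import Mathlib

/-! ## Stable set polytopes, faces, extension complexity -/

/-- The stable set polytope of `G`: the convex hull in `ℝ^V` of the incidence vectors of the
stable (independent) sets of `G`. -/
def stab {V : Type*} (G : SimpleGraph V) : Set (V → ℝ) :=
  convexHull ℝ {x | ∃ S : Set V, G.IsIndepSet S ∧ x = S.indicator 1}

/-- A polytope in `ℝ^d`: the convex hull of a finite set of points. -/
def IsPolytope {d : ℕ} (Q : Set (Fin d → ℝ)) : Prop :=
  ∃ s : Set (Fin d → ℝ), s.Finite ∧ Q = convexHull ℝ s

/-- A facet of `Q`: a nonempty face (the set of maximizers over `Q` of a linear functional) whose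
dimension is one less than the dimension of `Q`. -/
def IsFacet {d : ℕ} (Q F : Set (Fin d → ℝ)) : Prop :=
  IsExposed ℝ Q F ∧ F.Nonempty ∧
    Module.finrank ℝ (vectorSpan ℝ F) + 1 = Module.finrank ℝ (vectorSpan ℝ Q)

/-- The extension complexity of `P`: the minimum number of facets of an extension of `P`, that is,
of a polytope `Q` (in some `ℝ^d`) of which `P` is the image under a linear map. -/
noncomputable def xc {E : Type*} [AddCommGroup E] [Module ℝ E] (P : Set E) : ℕ :=
  sInf {k : ℕ | ∃ (d : ℕ) (Q : Set (Fin d → ℝ)) (f : (Fin d → ℝ) →ₗ[ℝ] E),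
    IsPolytope Q ∧ f '' Q = P ∧ {F | IsFacet Q F}.ncard = k}

/-! ## Drawings in the plane -/

/-- Vertices of `G` placed at distinct points of the plane, and for each edge a simple arc joining
its two ends (traversed from `tail e` to `head e`) and passing through no other vertex.
Different arcs may still meet each other. -/
structure PlaneLayout {V : Type*} (G : SimpleGraph V) where
  pos : V → ℝ × ℝ
  pos_injective : Function.Injective pos
  tail : G.edgeSet → V
  head : G.edgeSet → V
  ends : ∀ e : G.edgeSet, s(tail e, head e) = (e : Sym2 V)
  arc : ∀ e : G.edgeSet, Path (pos (tail e)) (pos (head e))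
  arc_injective : ∀ e, Function.Injective (arc e)
  arc_vertex : ∀ e t v, arc e t = pos v → t = 0 ∨ t = 1

/-- The crossings: the points, other than vertices, that lie on two different edges. -/
def PlaneLayout.crossings {V : Type*} {G : SimpleGraph V} (L : PlaneLayout G) : Set (ℝ × ℝ) :=
  {p | p ∉ Set.range L.pos ∧
    ∃ e f, e ≠ f ∧ p ∈ Set.range (L.arc e) ∧ p ∈ Set.range (L.arc f)}

/-- A drawing of `G` in the plane, edges being allowed to cross: there are finitely many crossings,
no three edges cross at the same point, and at each crossing the two edges cross properly, i.e.
in suitable local coordinates of the plane they are the two coordinate axes. -/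
structure Drawing {V : Type*} (G : SimpleGraph V) extends PlaneLayout G where
  finite_crossings : toPlaneLayout.crossings.Finite
  no_triple : ∀ p ∈ toPlaneLayout.crossings, ∀ e f g : G.edgeSet,
    p ∈ Set.range (arc e) → p ∈ Set.range (arc f) → p ∈ Set.range (arc g) →
      e = f ∨ e = g ∨ f = g
  proper : ∀ p ∈ toPlaneLayout.crossings, ∀ e f : G.edgeSet, e ≠ f →
    p ∈ Set.range (arc e) → p ∈ Set.range (arc f) →
      ∃ φ : OpenPartialHomeomorph (ℝ × ℝ) (ℝ × ℝ), p ∈ φ.source ∧ φ p = (0, 0) ∧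
        ∀ q ∈ φ.source, (q ∈ Set.range (arc e) ↔ (φ q).2 = 0) ∧
          (q ∈ Set.range (arc f) ↔ (φ q).1 = 0)

/-- A graph is planar if it can be laid out in the plane without crossings. -/
def IsPlanar {V : Type*} (G : SimpleGraph V) : Prop :=
  ∃ L : PlaneLayout G, L.crossings = ∅

/-! ## Crossover gadgets

A gadget is a graph on the 22 vertices `Fin 22` with terminals
`v₁ = 0`, `v₁' = 1`, `v₂ = 2`, `v₂' = 3`. -/

/-- The table of the numbers `s i j`: the maximum size of a stable set of the gadget containing
exactly `i` of the vertices `v₁, v₁'` and exactly `j` of the vertices `v₂, v₂'`. -/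
def crossoverTable : Fin 3 → Fin 3 → ℕ :=
  ![![7, 8, 8],
    ![8, 9, 9],
    ![7, 8, 9]]

/-- `H` is a crossover gadget: the maximum size of a stable set of `H` meeting the terminals in a
given set `A` is as in the table, and `H` has a crossing-free layout in a square with the terminals
`v₁, v₂, v₁', v₂'` at the midpoints of the left, upper, right and lower side
and everything else in the interior of the square. -/
structure IsCrossoverGadget (H : SimpleGraph (Fin 22)) : Prop where
  table : ∀ (A : Finset (Fin 22)) (i j : Fin 3), A ⊆ {0, 1, 2, 3} →
    (A ∩ {0, 1}).card = i → (A ∩ {2, 3}).card = j →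
      IsGreatest {k : ℕ | ∃ S : Finset (Fin 22), H.IsIndepSet (S : Set (Fin 22)) ∧
        S ∩ {0, 1, 2, 3} = A ∧ S.card = k} (crossoverTable i j)
  layout : ∃ L : PlaneLayout H, L.crossings = ∅ ∧
    L.pos 0 = (-1, 0) ∧ L.pos 1 = (1, 0) ∧ L.pos 2 = (0, 1) ∧ L.pos 3 = (0, -1) ∧
    (∀ v, 4 ≤ v → L.pos v ∈ Set.Ioo (-1 : ℝ) 1 ×ˢ Set.Ioo (-1 : ℝ) 1) ∧
    ∀ e t, t ≠ 0 → t ≠ 1 → L.arc e t ∈ Set.Ioo (-1 : ℝ) 1 ×ˢ Set.Ioo (-1 : ℝ) 1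

/-- An explicit 22-vertex gadget. -/
def crossoverGadget : SimpleGraph (Fin 22) :=
  SimpleGraph.fromEdgeSet
    {s(0, 9), s(0, 11), s(0, 17), s(0, 19), s(1, 8), s(1, 10), s(1, 16), s(1, 18),
     s(2, 16), s(2, 17), s(3, 18), s(3, 19),
     s(4, 8), s(5, 9), s(6, 10), s(7, 11), s(4, 12), s(5, 13), s(6, 14), s(7, 15),
     s(4, 16), s(5, 17), s(6, 18), s(7, 19), s(8, 16), s(9, 17), s(10, 18), s(11, 19),
     s(8, 20), s(9, 20), s(10, 21), s(11, 21), s(12, 13), s(14, 15), s(20, 21)}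

/-! ## Replacing the crossings of a drawing by copies of a gadget -/

section Replace

variable {V : Type*} {G : SimpleGraph V}

open Classical in
/-- The vertex at which one leaves the point with parameter `s` of the edge `e` when going along
`e` from tail to head: the tail of `e` itself at the beginning of `e`, and at a crossing `c` the
terminal `v₁'` or `v₂'` of the gadget at `c`. The function `first` says which of the two edges
through a crossing is joined to `v₁, v₁'`; the other one is joined to `v₂, v₂'`. -/
def PlaneLayout.Leaves (L : PlaneLayout G) (first : L.crossings → G.edgeSet) (e : G.edgeSet)
    (s : unitInterval) (x : V ⊕ L.crossings × Fin 22) : Prop :=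
  (s = 0 ∧ x = Sum.inl (L.tail e)) ∨
    ∃ c : L.crossings, L.arc e s = c ∧ x = Sum.inr (c, if first c = e then 1 else 3)

open Classical in
/-- The vertex at which one arrives at the point with parameter `t` of the edge `e` when going along
`e` from tail to head: the head of `e` at the end of `e`, and at a crossing `c` the
terminal `v₁` or `v₂` of the gadget at `c`. -/
def PlaneLayout.Arrives (L : PlaneLayout G) (first : L.crossings → G.edgeSet) (e : G.edgeSet)
    (t : unitInterval) (y : V ⊕ L.crossings × Fin 22) : Prop :=
  (t = 1 ∧ y = Sum.inl (L.head e)) ∨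
    ∃ c : L.crossings, L.arc e t = c ∧ y = Sum.inr (c, if first c = e then 0 else 2)

/-- The graph obtained from a drawing of `G` by replacing each crossing with a copy of the
gadget `H`. Its vertices are those of `G` and 22 vertices for each crossing. Its edges are the edges
of the copies of `H` and, for each edge `e` of `G`, the edges linking any two consecutive
ones among the tail of `e`, the gadgets at the crossings on `e`, and the head of `e`. -/
def PlaneLayout.replaceCrossings (L : PlaneLayout G) (first : L.crossings → G.edgeSet)
    (H : SimpleGraph (Fin 22)) : SimpleGraph (V ⊕ L.crossings × Fin 22) :=
  SimpleGraph.fromRel fun x y =>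
    (∃ c i j, H.Adj i j ∧ x = Sum.inr (c, i) ∧ y = Sum.inr (c, j)) ∨
    ∃ e s t, s < t ∧ (∀ r, s < r → r < t → L.arc e r ∉ L.crossings) ∧
      L.Leaves first e s x ∧ L.Arrives first e t y

end Replace

/-! The lower bound starts from a graph whose stable set polytope is already hard to represent, and
transfers the hardness to a planar graph by means of the crossover gadget.

Extension complexity. If `P` is the image of `Q`, a face of `P` pulls back to a face of `Q`, and a
nonempty face of a polytope, together with a point outside it, is separated by a facet
(`exists_isFacet_superset`). Suppose a face of `P` has valid inequalities indexed by sets `a` and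
points indexed by sets `b`, with equality exactly when `a` and `b` share one element. Then every
pair of disjoint sets with `a` nonempty is separated by a facet of `Q`. The pairs separated by one
facet form a rectangle without pairs meeting in exactly one element, and such a rectangle contains
at most `2 ^ m` of the `3 ^ m` disjoint pairs (`card_disjoint_pairs_le`). Hence `three_pow_le_xc`:
about `(3 / 2) ^ m` facets are needed. The twice subdivided complete graph on `m` branch vertices
has such inequalities and points (`pairFunctional_le`, `pairFunctional_pairStableSet`), the slack
being at least `(s - 1) ^ 2` where `s` counts the branch vertices of `a` in the stable set.

Planarity. Near a crossing the two edges are the axes of a chart. The gadget is drawn in a small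
square of that chart and the edges are trimmed at the square, which gives a crossing-free layout
(`isPlanar_replaceCrossings`).

The face. No stable set has more than nine vertices in a gadget, and one with nine meets both pairs
of terminals. On the face where all gadgets have nine vertices, an edge of the graph therefore still
excludes that both its ends are chosen (`Drawing.isIndepSet_of_terminals`). Conversely every stable
set extends, each gadget recording for both edges whether the tail is chosen
(`Drawing.exists_extension`).

Counting. The subdivided graph has `O(m ^ 2)` edges, and a straight-line drawing in general position
has at most one crossing per pair of edges, so `O(m ^ 4)` gadgets suffice. Taking `m` close to `√n`
gives the last claim. The table and the layout of the explicit gadget are checked by finite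
computations. -/

section Polytopes

/-! ### Faces and facets of polytopes given by generators. -/

variable {E : Type*} [AddCommGroup E] [Module ℝ E] [TopologicalSpace E] [IsTopologicalAddGroup E]
  [ContinuousSMul ℝ E] [T2Space E] [FiniteDimensional ℝ E]

theorem isExposed_sep_eq {Q : Set E} (l : E →ₗ[ℝ] ℝ) (β : ℝ) (h : ∀ x ∈ Q, l x ≤ β) :
    IsExposed ℝ Q {x ∈ Q | l x = β} := by
  rintro ⟨x, hx, hxβ⟩
  refine ⟨LinearMap.toContinuousLinearMap l, ?_⟩
  ext y
  simp only [Set.mem_ofPred_eq, LinearMap.coe_toContinuousLinearMap']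
  constructor
  · rintro ⟨hy, hyβ⟩
    exact ⟨hy, fun z hz => hyβ ▸ h z hz⟩
  · rintro ⟨hy, hmax⟩
    exact ⟨hy, le_antisymm (h y hy) (hxβ ▸ hmax x hx)⟩

theorem IsExposed.exists_eq_sep {E : Type*} [AddCommGroup E] [Module ℝ E] [TopologicalSpace E]
    {Q F : Set E} (hF : IsExposed ℝ Q F) (hne : F.Nonempty) :
    ∃ (l : E →ₗ[ℝ] ℝ) (β : ℝ), (∀ x ∈ Q, l x ≤ β) ∧ F = {x ∈ Q | l x = β} := by
  obtain ⟨l, hl⟩ := hF hne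
  obtain ⟨x, hx⟩ := hne
  rw [hl] at hx
  refine ⟨l.toLinearMap, l x, fun y hy => hx.2 y hy, ?_⟩
  rw [hl]
  ext y
  exact ⟨fun hy => ⟨hy.1, le_antisymm (hx.2 y hy.1) (hy.2 x hx.1)⟩,
    fun hy => ⟨hy.1, fun z hz => (hx.2 z hz).trans_eq hy.2.symm⟩⟩

end Polytopes

theorem le_of_mem_convexHull {E : Type*} [AddCommGroup E] [Module ℝ E] {s : Set E}
    (l : E →ₗ[ℝ] ℝ) {β : ℝ} (h : ∀ x ∈ s, l x ≤ β) {x : E} (hx : x ∈ convexHull ℝ s) :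
    l x ≤ β :=
  convexHull_min (t := {x | l x ≤ β}) h (convex_halfSpace_le l.isLinear β) hx

/-- The points of a polytope that maximize a linear functional are in the convex hull of the
generators that do. -/
theorem mem_convexHull_sep_of_eq {E : Type*} [AddCommGroup E] [Module ℝ E] {s : Set E}
    (l : E →ₗ[ℝ] ℝ) {β : ℝ} (h : ∀ x ∈ s, l x ≤ β) {x : E} (hx : x ∈ convexHull ℝ s)
    (hxβ : l x = β) : x ∈ convexHull ℝ {y ∈ s | l y = β} := by
  classical
  rw [mem_convexHull_iff_exists_fintype] at hx
  obtain ⟨ι, _, w, z, hw, hw1, hz, rfl⟩ := hx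
  -- The nonnegative slacks have weighted average zero, so generators of positive weight have slack
  -- zero.
  have hsum : ∑ i, w i * (β - l (z i)) = 0 := by
    simp only [mul_sub, Finset.sum_sub_distrib, ← Finset.sum_mul, hw1, one_mul]
    rw [← hxβ, map_sum]
    simp
  have hzero : ∀ i, w i * (β - l (z i)) = 0 := fun i =>
    (Finset.sum_eq_zero_iff_of_nonneg fun i _ =>
      mul_nonneg (hw i) (sub_nonneg.2 (h _ (hz i)))).1 hsum i (Finset.mem_univ i)
  have hsupp : ∑ i, w i • z i = ∑ i ∈ Finset.univ.filter (fun i => w i ≠ 0), w i • z i := by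
    rw [Finset.sum_filter_of_ne]
    intro i _ hi h0
    simp [h0] at hi
  rw [hsupp]
  refine (convex_convexHull ℝ _).sum_mem (fun i _ => hw i) ?_ ?_
  · rw [Finset.sum_filter_ne_zero, hw1]
  · intro i hi
    refine subset_convexHull ℝ _ ⟨hz i, ?_⟩
    have := (mul_eq_zero.1 (hzero i)).resolve_left (by simpa using hi)
    linarith

theorem sep_convexHull_eq {E : Type*} [AddCommGroup E] [Module ℝ E] {s : Set E}
    (l : E →ₗ[ℝ] ℝ) {β : ℝ} (h : ∀ x ∈ s, l x ≤ β) :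
    {x ∈ convexHull ℝ s | l x = β} = convexHull ℝ {y ∈ s | l y = β} := by
  apply Set.Subset.antisymm
  · rintro x ⟨hx, hxβ⟩
    exact mem_convexHull_sep_of_eq l h hx hxβ
  · refine convexHull_min ?_ ?_
    · rintro y ⟨hy, hyβ⟩
      exact ⟨subset_convexHull ℝ s hy, hyβ⟩
    · exact (convex_convexHull ℝ s).inter (convex_hyperplane l.isLinear β)

section Faces

variable {E : Type*} [AddCommGroup E] [Module ℝ E] [TopologicalSpace E] [IsTopologicalAddGroup E]
  [ContinuousSMul ℝ E] [T2Space E] [FiniteDimensional ℝ E]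

/-- A nonempty face is the hull of the generators lying on it, so it is determined by a subset of
`s`. -/
theorem finite_setOf_isExposed {E : Type*} [AddCommGroup E] [Module ℝ E] [TopologicalSpace E]
    {s : Set E} (hs : s.Finite) :
    {F | IsExposed ℝ (convexHull ℝ s) F}.Finite := by
  refine (((hs.finite_subsets.image (convexHull ℝ)).union (Set.finite_singleton ∅))).subset ?_
  intro F hF
  rcases F.eq_empty_or_nonempty with rfl | hne
  · right; rfl
  · obtain ⟨l, β, hle, rfl⟩ := IsExposed.exists_eq_sep hF hne
    left
    exact ⟨_, Set.sep_subset s _,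
      (sep_convexHull_eq l fun x hx => hle x (subset_convexHull ℝ s hx)).symm⟩

/-- In a polytope, a face of a face is a face. -/
theorem isExposed_sep_sep {s : Set E} (hs : s.Finite) (l g : E →ₗ[ℝ] ℝ) (β γ : ℝ)
    (hl : ∀ x ∈ convexHull ℝ s, l x ≤ β)
    (hg : ∀ x ∈ convexHull ℝ s, l x = β → g x ≤ γ) :
    IsExposed ℝ (convexHull ℝ s) {x ∈ convexHull ℝ s | l x = β ∧ g x = γ} := by
  -- With weight `M` on `l`, whatever a generator off the face `l = β` gains in `g` is outweighed by
  -- its loss in `l`. Only finitely many generators have to be considered.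
  obtain ⟨M, hM⟩ : ∃ M : ℝ, ∀ y ∈ s, l y < β → (g y - γ) / (β - l y) < M := by
    obtain ⟨M, hM⟩ := (hs.image fun y => (g y - γ) / (β - l y)).bddAbove
    exact ⟨M + 1, fun y hy _ => (hM (Set.mem_image_of_mem _ hy)).trans_lt (lt_add_one M)⟩
  have key : ∀ y ∈ s, (g + M • l) y ≤ γ + M * β ∧ ((g + M • l) y = γ + M * β → l y = β) := by
    intro y hy
    have hy' := subset_convexHull ℝ s hy
    simp only [LinearMap.add_apply, LinearMap.smul_apply, smul_eq_mul]
    rcases (hl y hy').lt_or_eq with h | h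
    · have h1 := hM y hy h
      rw [div_lt_iff₀ (sub_pos.2 h)] at h1
      exact ⟨by linarith, fun h' => by linarith⟩
    · have := hg y hy' h
      rw [h]
      exact ⟨by linarith, fun _ => rfl⟩
  have hmain : {x ∈ convexHull ℝ s | l x = β ∧ g x = γ} =
      {x ∈ convexHull ℝ s | (g + M • l) x = γ + M * β} := by
    ext x
    constructor
    · rintro ⟨hx, h1, h2⟩
      exact ⟨hx, by simp [h1, h2]⟩
    · rintro ⟨hx, h⟩
      have h1 := mem_convexHull_sep_of_eq _ (fun y hy => (key y hy).1) hx h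
      have h2 : x ∈ {x | l x = β} :=
        convexHull_min (t := {x | l x = β}) (fun y hy => (key y hy.1).2 hy.2)
          (convex_hyperplane l.isLinear β) h1
      have h3 : l x = β := h2
      refine ⟨hx, h3, ?_⟩
      simpa [h3] using h
  rw [hmain]
  exact isExposed_sep_eq _ _ fun x hx => le_of_mem_convexHull _ (fun y hy => (key y hy).1) hx

/-- A face that is not a facet can be enlarged to a face that still avoids a given point. -/
theorem exists_larger_face {s : Set E} (hs : s.Finite) {F : Set E}
    (hF : IsExposed ℝ (convexHull ℝ s) F) (hne : F.Nonempty) {x : E} (hx : x ∈ convexHull ℝ s)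
    (hxF : x ∉ F)
    (hdim : Module.finrank ℝ (vectorSpan ℝ F) + 1 ≠
      Module.finrank ℝ (vectorSpan ℝ (convexHull ℝ s))) :
    ∃ F' : Set E, IsExposed ℝ (convexHull ℝ s) F' ∧ F ⊆ F' ∧ x ∉ F' ∧
      Module.finrank ℝ (vectorSpan ℝ F) < Module.finrank ℝ (vectorSpan ℝ F') := by
  classical
  -- The supporting hyperplane `l = β` is rotated around `F`, in two opposite directions, until it
  -- hits a further generator. Both rotations enlarge `F`, and at least one of the resulting faces
  -- avoids `x`.
  obtain ⟨l, β, hle, hFeq⟩ := hF.exists_eq_sep hne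
  set Q := convexHull ℝ s with hQ
  obtain ⟨o, ho⟩ := hne
  have hlF : ∀ y ∈ F, l y = β := fun y hy => by rw [hFeq] at hy; exact hy.2
  have hFQ : F ⊆ Q := fun y hy => by rw [hFeq] at hy; exact hy.1
  have hlx : l x < β := lt_of_le_of_ne (hle x hx) fun h => hxF (by rw [hFeq]; exact ⟨hx, h⟩)
  have hFker : vectorSpan ℝ F ≤ LinearMap.ker l := by
    rw [vectorSpan_def, Submodule.span_le]
    rintro _ ⟨y, hy, z, hz, rfl⟩
    simp [hlF y hy, hlF z hz]
  have hFV : vectorSpan ℝ F ≤ vectorSpan ℝ Q := vectorSpan_mono ℝ hFQ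
  have hxo : x - o ∈ vectorSpan ℝ Q := vsub_mem_vectorSpan ℝ hx (hFQ ho)
  have hlxo : l (x - o) ≠ 0 := by
    rw [map_sub, hlF o ho]
    exact (sub_neg.2 hlx).ne
  -- the codimension of the kernel of `l` in the span of the polytope is one
  set K : Submodule ℝ E := vectorSpan ℝ Q ⊓ LinearMap.ker l with hK
  have hKdim : Module.finrank ℝ K + 1 = Module.finrank ℝ (vectorSpan ℝ Q) := by
    set l' := l.domRestrict (vectorSpan ℝ Q) with hl'
    have h1 := LinearMap.finrank_range_add_finrank_ker l'
    have h2 : LinearMap.range l' = ⊤ := by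
      refine LinearMap.range_eq_top.2 (LinearMap.surjective ?_)
      intro h0
      exact hlxo (by simpa [hl'] using LinearMap.congr_fun h0 ⟨x - o, hxo⟩)
    have h3 : Module.finrank ℝ (LinearMap.ker l') = Module.finrank ℝ K := by
      rw [hK, ← Submodule.map_comap_subtype, Submodule.finrank_map_subtype_eq]
      rfl
    rw [h2, finrank_top, Module.finrank_self, h3] at h1
    omega
  have hFK : vectorSpan ℝ F < K := by
    refine lt_of_le_of_ne (le_inf hFV hFker) fun h => hdim ?_
    rw [h, hKdim]
  -- The axis of rotation: `g` is constant on `F` but not along `v`, a direction of the polytope on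
  -- which `l` vanishes.
  obtain ⟨v, hvK, hvF⟩ := SetLike.exists_of_lt hFK
  obtain ⟨g, hgv, hgF⟩ : ∃ g : E →ₗ[ℝ] ℝ, g v ≠ 0 ∧ vectorSpan ℝ F ≤ LinearMap.ker g :=
    Submodule.exists_le_ker_of_notMem hvF
  have hgo : ∀ y ∈ F, g y = g o := fun y hy => by
    have := hgF (vsub_mem_vectorSpan ℝ hy ho)
    rw [LinearMap.mem_ker, vsub_eq_sub, map_sub] at this
    linarith
  -- the generators outside `F`
  set T := hs.toFinset.filter (fun y => l y < β) with hT
  have hTne : T.Nonempty := by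
    by_contra hemp
    rw [Finset.not_nonempty_iff_eq_empty, hT, Finset.filter_eq_empty_iff] at hemp
    have hall : ∀ y ∈ s, (-l) y ≤ -β := fun y hy => by
      have := hemp (hs.mem_toFinset.2 hy)
      simp only [LinearMap.neg_apply]
      linarith
    have := le_of_mem_convexHull (-l) hall hx
    simp only [LinearMap.neg_apply] at this
    linarith
  -- enlarging by a slope
  have step : ∀ ρ σ : ℝ, (∀ y ∈ T, σ * (g y - g o) ≤ ρ * (β - l y)) →
      (∃ y ∈ T, σ * (g y - g o) = ρ * (β - l y)) → σ * (g x - g o) ≠ ρ * (β - l x) →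
      ∃ F' : Set E, IsExposed ℝ Q F' ∧ F ⊆ F' ∧ x ∉ F' ∧
        Module.finrank ℝ (vectorSpan ℝ F) < Module.finrank ℝ (vectorSpan ℝ F') := by
    rintro ρ σ hmax ⟨y, hyT, hy⟩ hxne
    have hs' : ∀ z ∈ s, (σ • g + ρ • l) z ≤ σ * g o + ρ * β := by
      intro z hz
      simp only [LinearMap.add_apply, LinearMap.smul_apply, smul_eq_mul]
      rcases (hle z (subset_convexHull ℝ s hz)).lt_or_eq with h | h
      · have := hmax z (by simp [hT, hz, h])
        linarith
      · have := hgo z (by rw [hFeq]; exact ⟨subset_convexHull ℝ s hz, h⟩)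
        rw [this, h]
    rw [hT, Finset.mem_filter, hs.mem_toFinset] at hyT
    have hyQ : y ∈ Q := subset_convexHull ℝ s hyT.1
    have hyF' : y ∈ {z ∈ Q | (σ • g + ρ • l) z = σ * g o + ρ * β} := by
      refine ⟨hyQ, ?_⟩
      simp only [LinearMap.add_apply, LinearMap.smul_apply, smul_eq_mul]
      linarith
    have hsub : F ⊆ {z ∈ Q | (σ • g + ρ • l) z = σ * g o + ρ * β} := by
      intro z hz
      refine ⟨hFQ hz, ?_⟩
      simp only [LinearMap.add_apply, LinearMap.smul_apply, smul_eq_mul, hgo z hz, hlF z hz]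
    refine ⟨{z ∈ Q | (σ • g + ρ • l) z = σ * g o + ρ * β},
      isExposed_sep_eq _ _ fun z hz => le_of_mem_convexHull _ hs' hz, hsub, ?_, ?_⟩
    · rintro ⟨-, h⟩
      simp only [LinearMap.add_apply, LinearMap.smul_apply, smul_eq_mul] at h
      exact hxne (by linarith)
    · refine Submodule.finrank_lt_finrank_of_lt (lt_of_le_of_ne (vectorSpan_mono ℝ hsub) ?_)
      intro heq
      have h1 := vsub_mem_vectorSpan ℝ hyF' (hsub ho)
      rw [← heq] at h1
      have h2 := hFker h1
      rw [LinearMap.mem_ker, vsub_eq_sub, map_sub, hlF o ho] at h2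
      linarith [hyT.2]
  have hpos : ∀ y ∈ T, 0 < β - l y := fun y hy => by
    rw [hT, Finset.mem_filter] at hy
    linarith [hy.2]
  obtain ⟨y₁, hy₁, hmax⟩ := T.exists_max_image (fun y => (g y - g o) / (β - l y)) hTne
  obtain ⟨y₂, hy₂, hmin⟩ := T.exists_min_image (fun y => (g y - g o) / (β - l y)) hTne
  set ρ₁ := (g y₁ - g o) / (β - l y₁) with hρ₁
  set ρ₂ := (g y₂ - g o) / (β - l y₂) with hρ₂
  by_cases h1 : 1 * (g x - g o) = ρ₁ * (β - l x)
  · by_cases h2 : (-1) * (g x - g o) = -ρ₂ * (β - l x)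
    -- If both rotated hyperplanes contain `x`, the largest and the smallest slope agree. Then `g +
    -- ρ₁ • l` is constant on the polytope and vanishes on `v`; since `l v = 0`, so does `g`.
    · exfalso
      have hρ : ρ₁ = ρ₂ := by
        have h3 : (ρ₁ - ρ₂) * (β - l x) = 0 := by linarith
        rcases mul_eq_zero.1 h3 with h | h <;> linarith
      have hall : ∀ y ∈ s, (g + ρ₁ • l) y = g o + ρ₁ * β := by
        intro y hy
        simp only [LinearMap.add_apply, LinearMap.smul_apply, smul_eq_mul]
        rcases (hle y (subset_convexHull ℝ s hy)).lt_or_eq with h | h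
        · have hyT : y ∈ T := by simp [hT, hy, h]
          have h4 := le_antisymm (hmax y hyT) (hρ ▸ hmin y hyT)
          rw [div_eq_iff (hpos y hyT).ne'] at h4
          linarith
        · have := hgo y (by rw [hFeq]; exact ⟨subset_convexHull ℝ s hy, h⟩)
          rw [this, h]
      have hallQ : ∀ y ∈ Q, (g + ρ₁ • l) y = g o + ρ₁ * β := fun y hy =>
        convexHull_min (t := {y | (g + ρ₁ • l) y = g o + ρ₁ * β}) hall
          (convex_hyperplane (g + ρ₁ • l).isLinear _) hy
      have hspan : vectorSpan ℝ Q ≤ LinearMap.ker (g + ρ₁ • l) := by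
        rw [vectorSpan_def, Submodule.span_le]
        rintro _ ⟨y, hy, z, hz, rfl⟩
        change (g + ρ₁ • l) (y - z) = 0
        rw [map_sub, hallQ y hy, hallQ z hz, sub_self]
      have h5 := hspan hvK.1
      have h6 : l v = 0 := hvK.2
      rw [LinearMap.mem_ker, LinearMap.add_apply, LinearMap.smul_apply, h6, smul_zero,
        add_zero] at h5
      exact hgv h5
    · refine step (-ρ₂) (-1) (fun y hy => ?_) ⟨y₂, hy₂, ?_⟩ h2
      · have := hmin y hy
        rw [le_div_iff₀ (hpos y hy)] at this
        linarith
      · rw [hρ₂]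
        have := (hpos y₂ hy₂).ne'
        field_simp
  · refine step ρ₁ 1 (fun y hy => ?_) ⟨y₁, hy₁, ?_⟩ h1
    · have := hmax y hy
      rw [div_le_iff₀ (hpos y hy)] at this
      linarith
    · rw [hρ₁]
      have := (hpos y₁ hy₁).ne'
      field_simp

end Faces

/-- Every point outside a nonempty face of a polytope is avoided by a facet containing the face. -/
theorem exists_isFacet_superset {d : ℕ} {Q F : Set (Fin d → ℝ)} (hQ : IsPolytope Q)
    (hF : IsExposed ℝ Q F) (hne : F.Nonempty) {x : Fin d → ℝ} (hx : x ∈ Q) (hxF : x ∉ F) :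
    ∃ F', IsFacet Q F' ∧ F ⊆ F' ∧ x ∉ F' := by
  obtain ⟨s, hs, rfl⟩ := hQ
  -- Each enlargement raises the dimension of the face, which is at most `d`.
  induction hn : d - Module.finrank ℝ (vectorSpan ℝ F) using Nat.strong_induction_on
    generalizing F with
  | _ n ih =>
    by_cases hdim : Module.finrank ℝ (vectorSpan ℝ F) + 1 =
      Module.finrank ℝ (vectorSpan ℝ (convexHull ℝ s))
    · exact ⟨F, ⟨hF, hne, hdim⟩, subset_rfl, hxF⟩
    · obtain ⟨F₁, hF₁, hsub, hx₁, hlt⟩ := exists_larger_face hs hF hne hx hxF hdim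
      have hle : Module.finrank ℝ (vectorSpan ℝ F₁) ≤ d := by
        simpa using Submodule.finrank_le (vectorSpan ℝ F₁)
      obtain ⟨F₂, h₁, h₂, h₃⟩ := ih (d - Module.finrank ℝ (vectorSpan ℝ F₁)) (by omega)
        (hne.mono hsub) hx₁ hF₁ rfl
      exact ⟨F₂, h₁, hsub.trans h₂, h₃⟩

theorem finite_setOf_isFacet {d : ℕ} {Q : Set (Fin d → ℝ)} (hQ : IsPolytope Q) :
    {F | IsFacet Q F}.Finite := by
  obtain ⟨s, hs, rfl⟩ := hQ
  exact (finite_setOf_isExposed hs).subset fun F hF => hF.1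

/-! ### Rectangles of set pairs that never meet in exactly one element. -/

section Rectangles

variable {ι : Type*} [DecidableEq ι]

/-- A rectangle without a pair of sets meeting in exactly one element contains at most `2 ^ n`
pairs of disjoint sets (Kaibel and Weltge). -/
theorem card_disjoint_pairs_le (T : Finset ι) (A B : Finset (Finset ι))
    (hA : ∀ a ∈ A, a ⊆ T) (hB : ∀ b ∈ B, b ⊆ T) (hAB : ∀ a ∈ A, ∀ b ∈ B, (a ∩ b).card ≠ 1) :
    ((A ×ˢ B).filter fun p => Disjoint p.1 p.2).card ≤ 2 ^ T.card := by
  induction T using Finset.induction_on generalizing A B with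
  | empty =>
    refine (Finset.card_le_card (t := {(∅, ∅)}) ?_).trans (by simp)
    rintro ⟨a, b⟩ h
    simp only [Finset.mem_filter, Finset.mem_product] at h
    simp [Finset.subset_empty.1 (hA a h.1.1), Finset.subset_empty.1 (hB b h.1.2)]
  | insert x T hx ih =>
    set A₀ := A.filter (x ∉ ·)
    set B₀ := B.filter (x ∉ ·)
    set A₁ := A.image (·.erase x)
    set B₁ := B.image (·.erase x)
    have hsub : ∀ a : Finset ι, a ⊆ insert x T → a.erase x ⊆ T := fun a ha =>
      Finset.subset_insert_iff.1 ha
    -- Deleting `x` from the sets on one side does not change intersections if the sets on the other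
    -- side avoid `x`, so both smaller rectangles inherit the hypothesis.
    have h₁ := ih A₀ B₁
      (fun a ha => by
        rw [Finset.mem_filter] at ha
        exact (Finset.subset_insert_iff_of_notMem ha.2).1 (hA a ha.1))
      (fun b hb => by
        obtain ⟨b', hb', rfl⟩ := Finset.mem_image.1 hb
        exact hsub _ (hB b' hb'))
      (fun a ha b hb => by
        rw [Finset.mem_filter] at ha
        obtain ⟨b', hb', rfl⟩ := Finset.mem_image.1 hb
        rw [Finset.inter_erase, Finset.erase_eq_of_notMem fun h => ha.2 (Finset.mem_inter.1 h).1]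
        exact hAB a ha.1 b' hb')
    have h₂ := ih A₁ B₀
      (fun a ha => by
        obtain ⟨a', ha', rfl⟩ := Finset.mem_image.1 ha
        exact hsub _ (hA a' ha'))
      (fun b hb => by
        rw [Finset.mem_filter] at hb
        exact (Finset.subset_insert_iff_of_notMem hb.2).1 (hB b hb.1))
      (fun a ha b hb => by
        rw [Finset.mem_filter] at hb
        obtain ⟨a', ha', rfl⟩ := Finset.mem_image.1 ha
        rw [Finset.erase_inter, Finset.erase_eq_of_notMem fun h => hb.2 (Finset.mem_inter.1 h).2]
        exact hAB a' ha' b hb.1)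
    set D := (A ×ˢ B).filter fun p => Disjoint p.1 p.2
    set D₁ := (A₀ ×ˢ B₁).filter fun p => Disjoint p.1 p.2
    set D₂ := (A₁ ×ˢ B₀).filter fun p => Disjoint p.1 p.2
    suffices D.card ≤ (D₁.disjSum D₂).card by
      rw [Finset.card_disjSum] at this
      rw [Finset.card_insert_of_notMem hx, pow_succ]
      omega
    -- a pair avoiding `x` goes to the left unless its second set can be extended by `x`
    let φ : Finset ι × Finset ι → (Finset ι × Finset ι) ⊕ (Finset ι × Finset ι) := fun p =>
      if x ∈ p.1 ∨ (x ∉ p.2 ∧ insert x p.2 ∈ B) then Sum.inr (p.1.erase x, p.2)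
      else Sum.inl (p.1, p.2.erase x)
    refine Finset.card_le_card_of_injOn φ ?_ ?_
    · rintro ⟨a, b⟩ hp
      have hp' : (a, b) ∈ D := hp
      simp only [D, Finset.mem_filter, Finset.mem_product] at hp'
      obtain ⟨⟨ha, hb⟩, hdis⟩ := hp'
      by_cases h : x ∈ a ∨ (x ∉ b ∧ insert x b ∈ B)
      · have hxb : x ∉ b := h.elim (fun h => Finset.disjoint_left.1 hdis h) fun h => h.1
        simp only [φ, h, if_true, Finset.mem_coe, Finset.inr_mem_disjSum, D₂, Finset.mem_filter,
          Finset.mem_product, A₁, B₀, Finset.mem_image]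
        exact ⟨⟨⟨a, ha, rfl⟩, hb, hxb⟩, Finset.disjoint_of_subset_left (Finset.erase_subset _ _) hdis⟩
      · have hxa : x ∉ a := fun h' => h (Or.inl h')
        simp only [φ, h, if_false, Finset.mem_coe, Finset.inl_mem_disjSum, D₁, Finset.mem_filter,
          Finset.mem_product, A₀, B₁, Finset.mem_image]
        exact ⟨⟨⟨ha, hxa⟩, b, hb, rfl⟩,
          Finset.disjoint_of_subset_right (Finset.erase_subset _ _) hdis⟩
    · rintro ⟨a, b⟩ hp ⟨a', b'⟩ hp' heq
      have hp : (a, b) ∈ D := hp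
      have hp' : (a', b') ∈ D := hp'
      simp only [D, Finset.mem_filter, Finset.mem_product] at hp hp'
      obtain ⟨⟨ha, hb⟩, hdis⟩ := hp
      obtain ⟨⟨ha', hb'⟩, hdis'⟩ := hp'
      -- the two extensions by `x` cannot both be in the rectangle
      have hconf : ∀ a₁ ∈ A, ∀ b₁, x ∈ a₁ → insert x b₁ ∈ B → Disjoint (a₁.erase x) b₁ → False := by
        intro a₁ ha₁ b₁ hxa hxb hd
        refine hAB a₁ ha₁ _ hxb (Finset.card_eq_one.2 ⟨x, ?_⟩)
        ext y
        have this : y ∈ a₁.erase x → y ∉ b₁ := fun h => Finset.disjoint_left.1 hd h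
        simp only [Finset.mem_erase] at this
        simp only [Finset.mem_inter, Finset.mem_insert, Finset.mem_singleton]
        constructor
        · rintro ⟨h1, h2 | h2⟩
          · exact h2
          · by_contra h3
            exact this ⟨h3, h1⟩ h2
        · rintro rfl
          exact ⟨hxa, Or.inl rfl⟩
      by_cases h : x ∈ a ∨ (x ∉ b ∧ insert x b ∈ B) <;>
        by_cases h' : x ∈ a' ∨ (x ∉ b' ∧ insert x b' ∈ B)
      · simp only [φ, h, h', if_true, Sum.inr.injEq, Prod.mk.injEq] at heq
        obtain ⟨h1, rfl⟩ := heq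
        -- A collision on the right pairs a set containing `x` with one that does not. The latter
        -- went right only because the common second set extends by `x` inside `B`, which `hconf`
        -- forbids.
        by_cases hxa : x ∈ a <;> by_cases hxa' : x ∈ a'
        · rw [← Finset.insert_erase hxa, ← Finset.insert_erase hxa', h1]
        · exfalso
          have := (h'.resolve_left hxa').2
          refine hconf a ha b hxa this ?_
          exact Finset.disjoint_of_subset_left (Finset.erase_subset _ _) hdis
        · exfalso
          have := (h.resolve_left hxa).2
          refine hconf a' ha' b hxa' this ?_
          exact Finset.disjoint_of_subset_left (Finset.erase_subset _ _) hdis'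
        · rw [Finset.erase_eq_of_notMem hxa, Finset.erase_eq_of_notMem hxa'] at h1
          rw [h1]
      · simp [φ, h, h'] at heq
      · simp [φ, h, h'] at heq
      · simp only [φ, h, h', if_false, Sum.inl.injEq, Prod.mk.injEq] at heq
        obtain ⟨rfl, h1⟩ := heq
        push Not at h h'
        -- A collision on the left would involve a set of `B` containing `x` and the same set
        -- without `x`; the smaller one extends by `x` inside `B`, so its pair went right.
        by_cases hxb : x ∈ b <;> by_cases hxb' : x ∈ b'
        · rw [← Finset.insert_erase hxb, ← Finset.insert_erase hxb', h1]
        · exfalso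
          refine h'.2 hxb' ?_
          rw [← Finset.erase_eq_of_notMem hxb', ← h1, Finset.insert_erase hxb]
          exact hb
        · exfalso
          refine h.2 hxb ?_
          rw [← Finset.erase_eq_of_notMem hxb, h1, Finset.insert_erase hxb']
          exact hb'
        · rw [Finset.erase_eq_of_notMem hxb, Finset.erase_eq_of_notMem hxb'] at h1
          rw [h1]

/-- Each element lies in the first set, in the second or in neither. The count sums `2 ^ (n -
b.card)` over `b` by the binomial theorem. -/
theorem card_disjoint_pairs [Fintype ι] :
    (Finset.univ.filter fun p : Finset ι × Finset ι => Disjoint p.1 p.2).card =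
      3 ^ Fintype.card ι := by
  have h : ∀ b : Finset ι, (Finset.univ.filter fun a : Finset ι => Disjoint a b).card =
      2 ^ (Fintype.card ι - b.card) := by
    intro b
    rw [← Finset.card_compl, ← Finset.card_powerset]
    congr 1
    ext a
    simp [Finset.subset_compl_iff_disjoint_right]
  rw [Finset.card_filter, Fintype.sum_prod_type_right]
  simp only [← Finset.card_filter, h]
  have := Finset.sum_pow_mul_eq_add_pow (1 : ℕ) 2 (Finset.univ : Finset ι)
  simpa using this

end Rectangles

/-! ### The lower bound on extension complexity. -/

theorem IsPolytope.xc_spec {d : ℕ} {P : Set (Fin d → ℝ)} (hP : IsPolytope P) :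
    ∃ (d' : ℕ) (Q : Set (Fin d' → ℝ)) (f : (Fin d' → ℝ) →ₗ[ℝ] (Fin d → ℝ)),
      IsPolytope Q ∧ f '' Q = P ∧ {F | IsFacet Q F}.ncard = xc P :=
  Nat.sInf_mem (s := {k : ℕ | ∃ (d' : ℕ) (Q : Set (Fin d' → ℝ))
    (f : (Fin d' → ℝ) →ₗ[ℝ] (Fin d → ℝ)),
      IsPolytope Q ∧ f '' Q = P ∧ {F | IsFacet Q F}.ncard = k})
    -- A polytope is an extension of itself, so the infimum ranges over a nonempty set and is
    -- attained.
    ⟨_, d, P, LinearMap.id, hP, by simp, rfl⟩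

/-- A lower bound on the extension complexity of a polytope with a face that has, for all sets `a`,
a valid inequality and, for all sets `b`, a point, such that the point `b` satisfies the inequality
`a` with equality if and only if `a` and `b` have exactly one common element. -/
theorem three_pow_le_xc {N m : ℕ} {P F : Set (Fin N → ℝ)} (hP : IsPolytope P)
    (hF : IsExposed ℝ P F) (l : Finset (Fin m) → (Fin N → ℝ) →ₗ[ℝ] ℝ) (β : Finset (Fin m) → ℝ)
    (hl : ∀ a, ∀ y ∈ F, l a y ≤ β a) (pt : Finset (Fin m) → Fin N → ℝ) (hpt : ∀ b, pt b ∈ F)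
    (heq : ∀ a b, l a (pt b) = β a ↔ (a ∩ b).card = 1) :
    3 ^ m ≤ (xc P + 1) * 2 ^ m := by
  classical
  obtain ⟨d, Q, f, hQ, hfQ, hk⟩ := hP.xc_spec
  rw [← hk]
  obtain ⟨l₀, β₀, hl₀, hF₀⟩ := hF.exists_eq_sep ⟨_, hpt ∅⟩
  have hFP : F ⊆ P := fun y hy => by rw [hF₀] at hy; exact hy.1
  have hq : ∀ b, ∃ q ∈ Q, f q = pt b := fun b => by
    have := hFP (hpt b)
    rwa [← hfQ] at this
  choose q hqQ hfq using hq
  have hfP : ∀ x ∈ Q, f x ∈ P := fun x hx => hfQ ▸ Set.mem_image_of_mem f hx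
  -- The part of the extension lying over the face of `F` cut out by inequality `a`: a face of a
  -- face of `Q`.
  let face : Finset (Fin m) → Set (Fin d → ℝ) := fun a =>
    {x ∈ Q | (l₀ ∘ₗ f) x = β₀ ∧ (l a ∘ₗ f) x = β a}
  have hface : ∀ a, IsExposed ℝ Q (face a) := by
    intro a
    obtain ⟨s, hs, hQs⟩ := id hQ
    simp only [face, hQs]
    rw [hQs] at hfP
    exact isExposed_sep_sep hs _ _ _ _ (fun x hx => hl₀ _ (hfP x hx)) fun x hx h =>
      hl a _ (by rw [hF₀]; exact ⟨hfP x hx, h⟩)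
  have hqface : ∀ a b, q b ∈ face a ↔ (a ∩ b).card = 1 := by
    intro a b
    have h0 : l₀ (pt b) = β₀ := by
      have := hpt b
      rw [hF₀] at this
      exact this.2
    simp [face, hqQ, hfq, h0, heq]
  have hfin := finite_setOf_isFacet hQ
  rw [Set.ncard_eq_toFinset_card _ hfin]
  -- The disjoint pairs separated by `Φ`. If `a` and `b` share exactly one element then `q b ∈ face
  -- a`, so no such pair lies in the rectangle of `Φ`.
  let R : Set (Fin d → ℝ) → Finset (Finset (Fin m) × Finset (Fin m)) := fun Φ =>
    ((Finset.univ.filter fun a => face a ⊆ Φ) ×ˢ (Finset.univ.filter fun b => q b ∉ Φ)).filter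
      fun p => Disjoint p.1 p.2
  have hR : ∀ Φ, (R Φ).card ≤ 2 ^ m := by
    intro Φ
    have := card_disjoint_pairs_le (Finset.univ : Finset (Fin m))
      (Finset.univ.filter fun a => face a ⊆ Φ) (Finset.univ.filter fun b => q b ∉ Φ)
      (fun _ _ => Finset.subset_univ _) (fun _ _ => Finset.subset_univ _) (by
        intro a ha b hb h
        rw [Finset.mem_filter] at ha hb
        exact hb.2 (ha.2 ((hqface a b).2 h)))
    simpa using this
  -- The facet argument needs `face a` to be nonempty, which is only guaranteed for nonempty `a`.
  -- The `2 ^ m` pairs with `a = ∅` are counted apart, whence the `+ 1` in the bound.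
  have hcover : (Finset.univ.filter fun p : Finset (Fin m) × Finset (Fin m) => Disjoint p.1 p.2) ⊆
      hfin.toFinset.biUnion R ∪ (Finset.univ.image fun b => (∅, b)) := by
    rintro ⟨a, b⟩ hab
    simp only [Finset.mem_filter, Finset.mem_univ, true_and] at hab
    rcases a.eq_empty_or_nonempty with rfl | ⟨i, hi⟩
    · exact Finset.mem_union_right _ (Finset.mem_image_of_mem _ (Finset.mem_univ b))
    · refine Finset.mem_union_left _ ?_
      have hne : (face a).Nonempty := ⟨q {i}, (hqface a {i}).2 (by
        rw [Finset.inter_singleton_of_mem hi, Finset.card_singleton])⟩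
      obtain ⟨Φ, hΦ, hsub, hqΦ⟩ := exists_isFacet_superset hQ (hface a) hne (hqQ b) (by
        rw [hqface, Finset.disjoint_iff_inter_eq_empty.1 hab]
        simp)
      rw [Finset.mem_biUnion]
      refine ⟨Φ, hfin.mem_toFinset.2 hΦ, ?_⟩
      simp [R, hsub, hqΦ, hab]
  have h3 : 3 ^ m = (Finset.univ.filter fun p : Finset (Fin m) × Finset (Fin m) =>
      Disjoint p.1 p.2).card := by
    rw [card_disjoint_pairs, Fintype.card_fin]
  rw [h3]
  refine (Finset.card_le_card hcover).trans ((Finset.card_union_le _ _).trans ?_)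
  rw [add_mul, one_mul]
  refine add_le_add (Finset.card_biUnion_le_card_mul _ _ _ fun Φ _ => hR Φ)
    (Finset.card_image_le.trans ?_)
  simp

/-! ### The stable set table of the explicit gadget. -/

/-- Whether no stable set among the listed vertices avoiding the forbidden ones is larger than `k`.
A vertex is given by its bit together with the mask of its neighbours. -/
def stableLe (l : List (ℕ × ℕ)) : ℕ → ℕ → Bool :=
  l.foldr (fun p r F k => r F k &&
    (!(Nat.beq (F &&& p.1) 0) || (Nat.ble 1 k && r (F ||| p.2) (k - 1)))) fun _ _ => true

def nbMask (adj : Fin 22 → Fin 22 → Bool) (v : Fin 22) : ℕ :=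
  (List.finRange 22).foldl (fun F u => if adj v u then F ||| 2 ^ u.val else F) 0

theorem testBit_foldl_mask (p : Fin 22 → Bool) (l : List (Fin 22)) (F : ℕ) (u : Fin 22) :
    (l.foldl (fun F u => if p u then F ||| 2 ^ u.val else F) F).testBit u =
      (F.testBit u || (p u && decide (u ∈ l))) := by
  induction l generalizing F with
  | nil => simp
  | cons a l ih =>
    rw [List.foldl_cons, ih]
    by_cases ha : p a = true
    · by_cases hu : u = a
      · subst hu; simp [ha]
      · have : (a : ℕ) ≠ u := fun h => hu (Fin.ext h.symm)
        simp [ha, hu, Nat.testBit_or, this]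
    · by_cases hu : u = a
      · subst hu; simp [ha]
      · simp [ha, hu]

theorem testBit_nbMask (adj : Fin 22 → Fin 22 → Bool) (v u : Fin 22) :
    (nbMask adj v).testBit u = adj v u := by
  simp [nbMask, testBit_foldl_mask]

theorem land_two_pow_eq_zero_iff (F n : ℕ) : F &&& 2 ^ n = 0 ↔ F.testBit n = false := by
  rw [Nat.and_two_pow]
  cases F.testBit n <;> simp

/-- Soundness of the branching: the first listed vertex is either left out, or it was not forbidden,
uses one unit of the budget `k` and adds its neighbours to the forbidden mask `F`. -/
theorem card_le_of_stableLe (adj : Fin 22 → Fin 22 → Bool) (vs : List (Fin 22))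
    (S : Finset (Fin 22)) (hS : ∀ u ∈ S, ∀ v ∈ S, adj u v = false) (hsub : ∀ v ∈ S, v ∈ vs)
    (F k : ℕ) (hF : ∀ v ∈ S, F.testBit v = false)
    (h : stableLe (vs.map fun v => (2 ^ v.val, nbMask adj v)) F k = true) : S.card ≤ k := by
  induction vs generalizing S F k with
  | nil => simp [Finset.eq_empty_of_forall_notMem fun v hv => by simpa using hsub v hv]
  | cons a l ih =>
    simp only [List.map_cons, stableLe, List.foldr_cons, Bool.and_eq_true, Bool.or_eq_true, Bool.not_eq_true',
      Nat.ble_eq] at h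
    by_cases ha : a ∈ S
    · obtain ⟨hk, h2⟩ := h.2.resolve_left fun h0 => by
        rw [(land_two_pow_eq_zero_iff _ _).2 (hF a ha)] at h0
        exact Bool.false_ne_true h0.symm
      rw [← Finset.card_erase_add_one ha]
      suffices (S.erase a).card ≤ k - 1 by omega
      refine ih _ ?_ ?_ _ _ ?_ h2
      · exact fun u hu v hv => hS u (Finset.mem_of_mem_erase hu) v (Finset.mem_of_mem_erase hv)
      · intro v hv
        rw [Finset.mem_erase] at hv
        exact (List.mem_cons.1 (hsub v hv.2)).resolve_left hv.1
      · intro v hv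
        have hv' := Finset.mem_of_mem_erase hv
        rw [Nat.testBit_or, hF v hv', testBit_nbMask, hS a ha v hv', Bool.or_false]
    · exact ih S hS (fun v hv => (List.mem_cons.1 (hsub v hv)).resolve_left
        (by rintro rfl; exact ha hv)) F k hF h.1

def gadgetEdges : List (Fin 22 × Fin 22) :=
  [(0, 9), (0, 11), (0, 17), (0, 19), (1, 8), (1, 10), (1, 16), (1, 18),
   (2, 16), (2, 17), (3, 18), (3, 19),
   (4, 8), (5, 9), (6, 10), (7, 11), (4, 12), (5, 13), (6, 14), (7, 15),
   (4, 16), (5, 17), (6, 18), (7, 19), (8, 16), (9, 17), (10, 18), (11, 19),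
   (8, 20), (9, 20), (10, 21), (11, 21), (12, 13), (14, 15), (20, 21)]

def gadgetAdj (u v : Fin 22) : Bool :=
  gadgetEdges.contains (u, v) || gadgetEdges.contains (v, u)

theorem crossoverGadget_adj (u v : Fin 22) :
    crossoverGadget.Adj u v ↔ gadgetAdj u v = true := by
  have h : crossoverGadget.Adj u v ↔ (∃ p ∈ gadgetEdges, s(u, v) = s(p.1, p.2)) ∧ u ≠ v := by
    simp [crossoverGadget, gadgetEdges]
  have hloop : ∀ u, gadgetAdj u u = false := by decide +kernel
  rw [h]
  constructor
  · rintro ⟨⟨p, hp, hpe⟩, -⟩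
    rcases Sym2.eq_iff.1 hpe with ⟨rfl, rfl⟩ | ⟨rfl, rfl⟩ <;> simp [gadgetAdj, hp]
  · intro h
    refine ⟨?_, by rintro rfl; simp [hloop] at h⟩
    simp only [gadgetAdj, Bool.or_eq_true, List.contains_iff_mem] at h
    rcases h with h | h
    · exact ⟨_, h, rfl⟩
    · exact ⟨_, h, Sym2.eq_swap⟩

def innerVertices : List (Fin 22) := (List.finRange 22).filter (4 ≤ ·)

/-- The neighbours of the terminals for which the given Boolean is true. -/
def terminalMask (b₀ b₁ b₂ b₃ : Bool) : ℕ :=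
  (bif b₀ then nbMask gadgetAdj 0 else 0) ||| (bif b₁ then nbMask gadgetAdj 1 else 0) |||
    (bif b₂ then nbMask gadgetAdj 2 else 0) ||| (bif b₃ then nbMask gadgetAdj 3 else 0)

def terminalSet (b₀ b₁ b₂ b₃ : Bool) : Finset (Fin 22) :=
  (bif b₀ then {0} else ∅) ∪ (bif b₁ then {1} else ∅) ∪ (bif b₂ then {2} else ∅) ∪
    (bif b₃ then {3} else ∅)

/-- Bit masks of optimal stable sets, one for each choice of terminals read as a binary number. -/
def stableWitness (b₀ b₁ b₂ b₃ : Bool) : ℕ :=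
  [3121152, 2445473, 2793554, 2138195, 2925316, 2380197, 2662998, 2138199, 1289224, 1135785,
    1222746, 2138203, 2138956, 2134381, 2138718, 2138207].getD
      (b₀.toNat + 2 * b₁.toNat + 4 * b₂.toNat + 8 * b₃.toNat) 0

/-- The bits and neighbourhood masks of the 18 nonterminal vertices as literals, so that the search
runs on numerals. -/
def innerTable : List (ℕ × ℕ) :=
  [(16, 69888), (32, 139776), (64, 279552), (128, 559104), (256, 1114130), (512, 1179681),
    (1024, 2359362), (2048, 2621569), (4096, 8208), (8192, 4128), (16384, 32832), (32768,
    16512), (65536, 278), (131072, 549), (262144, 1098), (524288, 2185), (1048576, 2097920),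
    (2097152, 1051648)]

/-- For each choice of terminals, the mask of their neighbours and the number of nonterminal
vertices that can still be added, which is the value in the table less the number of chosen
terminals. -/
def terminalTable : List (ℕ × ℕ) :=
  [(0, 7), (657920, 7), (328960, 7), (986880, 5), (196608, 7), (723456, 7), (460032, 7),
    (986880, 5), (786432, 7), (920064, 7), (853248, 7), (986880, 5), (983040, 6), (985600, 6),
    (984320, 6), (986880, 5)]

theorem innerTable_eq :
    innerVertices.map (fun v => (2 ^ v.val, nbMask gadgetAdj v)) = innerTable := by
  decide +kernel

def terminalEntry (b₀ b₁ b₂ b₃ : Bool) : ℕ × ℕ :=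
  terminalTable.getD (b₀.toNat + 2 * b₁.toNat + 4 * b₂.toNat + 8 * b₃.toNat) (0, 0)

theorem terminalEntry_spec : ∀ b₀ b₁ b₂ b₃ : Bool,
    stableLe innerTable (terminalEntry b₀ b₁ b₂ b₃).1 (terminalEntry b₀ b₁ b₂ b₃).2 = true ∧
    Nat.beq (terminalEntry b₀ b₁ b₂ b₃).1 (terminalMask b₀ b₁ b₂ b₃) = true ∧
    (terminalEntry b₀ b₁ b₂ b₃).2 + (b₀.toNat + b₁.toNat + b₂.toNat + b₃.toNat) =
      crossoverTable (Fin.ofNat 3 (b₀.toNat + b₁.toNat)) (Fin.ofNat 3 (b₂.toNat + b₃.toNat)) := by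
  decide +kernel

theorem card_terminalSet : ∀ b₀ b₁ b₂ b₃ : Bool,
    (terminalSet b₀ b₁ b₂ b₃).card = b₀.toNat + b₁.toNat + b₂.toNat + b₃.toNat ∧
    (terminalSet b₀ b₁ b₂ b₃ ∩ {0, 1}).card = b₀.toNat + b₁.toNat ∧
    (terminalSet b₀ b₁ b₂ b₃ ∩ {2, 3}).card = b₂.toNat + b₃.toNat := by
  decide +kernel

theorem eq_terminalSet {A : Finset (Fin 22)} (hA : A ⊆ {0, 1, 2, 3}) :
    A = terminalSet (decide (0 ∈ A)) (decide (1 ∈ A)) (decide (2 ∈ A)) (decide (3 ∈ A)) := by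
  have hsingle : ∀ a v : Fin 22, v ∈ (bif decide (a ∈ A) then {a} else ∅ : Finset (Fin 22)) ↔
      a ∈ A ∧ v = a := by
    intro a v
    by_cases h : a ∈ A <;> simp [h]
  ext v
  simp only [terminalSet, Finset.mem_union, hsingle]
  constructor
  · intro hv
    have := hA hv
    simp only [Finset.mem_insert, Finset.mem_singleton] at this
    rcases this with rfl | rfl | rfl | rfl <;> simp [hv]
  · rintro (((⟨h, rfl⟩ | ⟨h, rfl⟩) | ⟨h, rfl⟩) | ⟨h, rfl⟩) <;> exact h

theorem stableWitness_adj : ∀ b₀ b₁ b₂ b₃ : Bool, ∀ e ∈ gadgetEdges,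
    ((stableWitness b₀ b₁ b₂ b₃).testBit e.1 && (stableWitness b₀ b₁ b₂ b₃).testBit e.2) =
      false := by
  decide +kernel

theorem stableWitness_terminals : ∀ b₀ b₁ b₂ b₃ : Bool,
    (stableWitness b₀ b₁ b₂ b₃).testBit 0 = b₀ ∧ (stableWitness b₀ b₁ b₂ b₃).testBit 1 = b₁ ∧
    (stableWitness b₀ b₁ b₂ b₃).testBit 2 = b₂ ∧ (stableWitness b₀ b₁ b₂ b₃).testBit 3 = b₃ := by
  decide +kernel

theorem stableWitness_card : ∀ b₀ b₁ b₂ b₃ : Bool,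
    (Finset.univ.filter fun v : Fin 22 => (stableWitness b₀ b₁ b₂ b₃).testBit v).card =
      crossoverTable (Fin.ofNat 3 (b₀.toNat + b₁.toNat)) (Fin.ofNat 3 (b₂.toNat + b₃.toNat)) := by
  decide +kernel

theorem exists_stable (b₀ b₁ b₂ b₃ : Bool) : ∃ S : Finset (Fin 22),
    (∀ u ∈ S, ∀ v ∈ S, gadgetAdj u v = false) ∧ S ∩ {0, 1, 2, 3} = terminalSet b₀ b₁ b₂ b₃ ∧
      S.card = crossoverTable (Fin.ofNat 3 (b₀.toNat + b₁.toNat))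
        (Fin.ofNat 3 (b₂.toNat + b₃.toNat)) := by
  refine ⟨_, ?_, ?_, stableWitness_card b₀ b₁ b₂ b₃⟩
  · intro u hu v hv
    rw [Finset.mem_filter] at hu hv
    by_contra h
    simp only [gadgetAdj, Bool.not_eq_false, Bool.or_eq_true, List.contains_iff_mem] at h
    rcases h with h | h
    · have := stableWitness_adj b₀ b₁ b₂ b₃ _ h
      simp [hu.2, hv.2] at this
    · have := stableWitness_adj b₀ b₁ b₂ b₃ _ h
      simp [hu.2, hv.2] at this
  · obtain ⟨h0, h1, h2, h3⟩ := stableWitness_terminals b₀ b₁ b₂ b₃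
    have hsingle : ∀ (b : Bool) (a v : Fin 22), v ∈ (bif b then {a} else ∅ : Finset (Fin 22)) ↔
        b = true ∧ v = a := by
      intro b a v
      cases b <;> simp
    ext v
    simp only [terminalSet, Finset.mem_union, hsingle, Finset.mem_inter, Finset.mem_filter,
      Finset.mem_univ, true_and, Finset.mem_insert, Finset.mem_singleton]
    constructor
    · rintro ⟨h, rfl | rfl | rfl | rfl⟩ <;> simp_all
    · rintro (((⟨rfl, rfl⟩ | ⟨rfl, rfl⟩) | ⟨rfl, rfl⟩) | ⟨rfl, rfl⟩) <;> simp_all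

theorem crossoverGadget_table (A : Finset (Fin 22)) (i j : Fin 3) (hA : A ⊆ {0, 1, 2, 3})
    (hi : (A ∩ {0, 1}).card = i) (hj : (A ∩ {2, 3}).card = j) :
    IsGreatest {k : ℕ | ∃ S : Finset (Fin 22), crossoverGadget.IsIndepSet (S : Set (Fin 22)) ∧
      S ∩ {0, 1, 2, 3} = A ∧ S.card = k} (crossoverTable i j) := by
  have hi' : i = Fin.ofNat 3 (A ∩ {0, 1}).card := by rw [hi]; simp
  have hj' : j = Fin.ofNat 3 (A ∩ {2, 3}).card := by rw [hj]; simp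
  obtain ⟨hc, hc₁, hc₂⟩ := card_terminalSet (decide (0 ∈ A)) (decide (1 ∈ A))
    (decide (2 ∈ A)) (decide (3 ∈ A))
  rw [← eq_terminalSet hA] at hc hc₁ hc₂
  rw [hi', hj']
  constructor
  · obtain ⟨S, h1, h2, h3⟩ := exists_stable (decide (0 ∈ A)) (decide (1 ∈ A))
      (decide (2 ∈ A)) (decide (3 ∈ A))
    rw [← eq_terminalSet hA] at h2
    rw [← hc₁, ← hc₂] at h3
    refine ⟨S, ?_, h2, h3⟩
    intro u hu v hv _ huv
    rw [crossoverGadget_adj, h1 u hu v hv] at huv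
    exact Bool.false_ne_true huv
  · rintro _ ⟨S, hS, hSA, rfl⟩
    have hadj : ∀ u ∈ S, ∀ v ∈ S, gadgetAdj u v = false := by
      intro u hu v hv
      by_contra h
      rw [Bool.not_eq_false, ← crossoverGadget_adj] at h
      exact hS hu hv h.ne h
    have hAS : ∀ v ∈ A, v ∈ S := fun v hv => by
      rw [← hSA] at hv
      exact Finset.mem_of_mem_inter_left hv
    have hinner : ∀ v : Fin 22, v ∉ ({0, 1, 2, 3} : Finset (Fin 22)) → v ∈ innerVertices := by
      decide
    obtain ⟨hp, hpA, hpk⟩ := terminalEntry_spec (decide (0 ∈ A)) (decide (1 ∈ A))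
      (decide (2 ∈ A)) (decide (3 ∈ A))
    rw [← hc, ← hc₁, ← hc₂] at hpk
    set p := terminalEntry (decide (0 ∈ A)) (decide (1 ∈ A)) (decide (2 ∈ A)) (decide (3 ∈ A))
    -- The terminals in `S` are fixed by `A`; the search bounds the remaining vertices, which avoid
    -- all neighbours of `A`.
    have hcard : S.card = (S \ {0, 1, 2, 3}).card + A.card := by
      rw [← hSA, Finset.card_sdiff_add_card_inter]
    rw [hcard, ← hpk]
    refine Nat.add_le_add_right (card_le_of_stableLe gadgetAdj innerVertices _ ?_ ?_ p.1 p.2 ?_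
      (innerTable_eq ▸ hp)) _
    · exact fun u hu v hv => hadj u (Finset.mem_sdiff.1 hu).1 v (Finset.mem_sdiff.1 hv).1
    · exact fun v hv => hinner v (Finset.mem_sdiff.1 hv).2
    · intro u hu
      have hA0 : ∀ a : Fin 22,
          (bif decide (a ∈ A) then nbMask gadgetAdj a else 0).testBit u = false := by
        intro a
        by_cases ha : a ∈ A
        · simp [ha, testBit_nbMask, hadj a (hAS a ha) u (Finset.mem_sdiff.1 hu).1]
        · simp [ha]
      rw [Nat.eq_of_beq_eq_true hpA, terminalMask, Nat.testBit_or, Nat.testBit_or, Nat.testBit_or, hA0, hA0, hA0, hA0]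
      rfl

/-! ### Straight-line layouts -/

/-- Twice the signed area of a triangle. -/
def orient {R : Type*} [CommRing R] (a b c : R × R) : R :=
  (b.1 - a.1) * (c.2 - a.2) - (b.2 - a.2) * (c.1 - a.1)

/-- This keeps a segment between two vertices clear of all others, and makes two segments with one
common end meet only there. -/
def NoThreeCollinear {V : Type*} (pos : V → ℝ × ℝ) : Prop :=
  ∀ a b c, a ≠ b → a ≠ c → b ≠ c → orient (pos a) (pos b) (pos c) ≠ 0

/-- The straight path between two points of the plane. -/
def straightPath (a b : ℝ × ℝ) : Path a b where
  toFun t := ((1 - t) * a.1 + t * b.1, (1 - t) * a.2 + t * b.2)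
  continuous_toFun := by fun_prop
  source' := by simp
  target' := by simp

theorem straightPath_apply (a b : ℝ × ℝ) (t : unitInterval) :
    straightPath a b t = ((1 - t) * a.1 + t * b.1, (1 - t) * a.2 + t * b.2) := rfl

theorem orient_straightPath (a b : ℝ × ℝ) (t : unitInterval) :
    orient a b (straightPath a b t) = 0 := by
  simp only [orient, straightPath_apply]
  ring

theorem straightPath_injective {a b : ℝ × ℝ} (h : a ≠ b) :
    Function.Injective (straightPath a b) := by
  intro t u htu
  simp only [straightPath_apply, Prod.mk.injEq] at htu
  by_contra hne
  have hne' : (t : ℝ) - u ≠ 0 := sub_ne_zero.2 fun h => hne (Subtype.ext h)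
  apply h
  ext
  · have : ((t : ℝ) - u) * (a.1 - b.1) = 0 := by linarith [htu.1]
    linarith [(mul_eq_zero.1 this).resolve_left hne']
  · have : ((t : ℝ) - u) * (a.2 - b.2) = 0 := by linarith [htu.2]
    linarith [(mul_eq_zero.1 this).resolve_left hne']

/-- Cramer's rule: two lines through `a` in independent directions meet only in `a`. -/
theorem eq_of_orient_eq_zero {a b c p : ℝ × ℝ} (h : orient a b c ≠ 0) (h₁ : orient a b p = 0)
    (h₂ : orient a c p = 0) : p = a := by
  simp only [orient] at h h₁ h₂
  have hx : (p.1 - a.1) * ((b.1 - a.1) * (c.2 - a.2) - (b.2 - a.2) * (c.1 - a.1)) = 0 := by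
    linear_combination (c.1 - a.1) * h₁ - (b.1 - a.1) * h₂
  have hy : (p.2 - a.2) * ((b.1 - a.1) * (c.2 - a.2) - (b.2 - a.2) * (c.1 - a.1)) = 0 := by
    linear_combination (c.2 - a.2) * h₁ - (b.2 - a.2) * h₂
  ext
  · linarith [(mul_eq_zero.1 hx).resolve_right h]
  · linarith [(mul_eq_zero.1 hy).resolve_right h]

section Straight

variable {V : Type*} (G : SimpleGraph V) {pos : V → ℝ × ℝ} (hinj : Function.Injective pos)
  (hcol : NoThreeCollinear pos)

theorem out_fst_ne_snd (e : G.edgeSet) : (Quot.out (e : Sym2 V)).1 ≠ (Quot.out (e : Sym2 V)).2 := by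
  have h := e.2
  rw [← Quot.out_eq (e : Sym2 V)] at h
  exact G.ne_of_adj (G.mem_edgeSet.1 h)

/-- The layout of a graph by straight segments. -/
noncomputable def straightLayout : PlaneLayout G where
  pos := pos
  pos_injective := hinj
  tail e := (Quot.out (e : Sym2 V)).1
  head e := (Quot.out (e : Sym2 V)).2
  ends e := Quot.out_eq (e : Sym2 V)
  arc e := straightPath _ _
  arc_injective e := straightPath_injective (hinj.ne (out_fst_ne_snd G e))
  arc_vertex e t v h := by
    have hne := out_fst_ne_snd G e
    have hI := straightPath_injective (hinj.ne hne)
    by_cases h1 : v = (Quot.out (e : Sym2 V)).1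
    · left
      apply hI
      rw [h, h1, Path.source]
    · by_cases h2 : v = (Quot.out (e : Sym2 V)).2
      · right
        apply hI
        rw [h, h2, Path.target]
      · exfalso
        refine hcol _ _ v hne (Ne.symm h1) (Ne.symm h2) ?_
        rw [← h, orient_straightPath]

theorem straightLayout_orient (e : G.edgeSet) {v w : V} (hvw : (e : Sym2 V) = s(v, w)) {p : ℝ × ℝ}
    (hp : p ∈ Set.range ((straightLayout G hinj hcol).arc e)) :
    orient (pos v) (pos w) p = 0 := by
  obtain ⟨t, rfl⟩ := hp
  have h := orient_straightPath (pos (Quot.out (e : Sym2 V)).1) (pos (Quot.out (e : Sym2 V)).2) t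
  have h' : s((Quot.out (e : Sym2 V)).1, (Quot.out (e : Sym2 V)).2) = s(v, w) :=
    (Quot.out_eq (e : Sym2 V)).trans hvw
  change orient (pos v) (pos w) (straightPath _ _ t) = 0
  rcases Sym2.eq_iff.1 h' with ⟨h1, h2⟩ | ⟨h1, h2⟩
  · rw [← h1, ← h2, h]
  · rw [← h1, ← h2]
    simp only [orient, straightPath_apply] at h ⊢
    linear_combination -h

/-- Two edges of a straight-line layout meeting outside the vertices have no common end. -/
theorem straightLayout_not_mem {e f : G.edgeSet} (hef : e ≠ f) {p : ℝ × ℝ}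
    (hp : p ∉ Set.range pos) (he : p ∈ Set.range ((straightLayout G hinj hcol).arc e))
    (hf : p ∈ Set.range ((straightLayout G hinj hcol).arc f)) {v : V} (hve : v ∈ (e : Sym2 V)) :
    v ∉ (f : Sym2 V) := by
  intro hvf
  obtain ⟨w, hw⟩ := Sym2.mem_iff_exists.1 hve
  obtain ⟨x, hx⟩ := Sym2.mem_iff_exists.1 hvf
  have hvw : v ≠ w := G.ne_of_adj (G.mem_edgeSet.1 (hw ▸ e.2))
  have hvx : v ≠ x := G.ne_of_adj (G.mem_edgeSet.1 (hx ▸ f.2))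
  have hwx : w ≠ x := by
    rintro rfl
    exact hef (Subtype.ext (hw.trans hx.symm))
  exact hp ⟨v, (eq_of_orient_eq_zero (hcol v w x hvw hvx hwx)
    (straightLayout_orient G hinj hcol e hw he) (straightLayout_orient G hinj hcol f hx hf)).symm⟩

end Straight

/-! ### The layout of the gadget -/

/-- A straight-line planar embedding in the square of half-side 50. Integer coordinates make the
geometric conditions decidable. -/
def gadgetCoord (v : Fin 22) : ℤ × ℤ :=
  [(-50, 0), (50, 0), (0, 50), (0, -50), (14, 16), (-8, 19), (22, -13), (-17, -11), (22, 9),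
    (-10, 16), (29, -8), (-22, -7), (9, 17), (2, 18), (10, -12), (-4, -12), (23, 22), (-13, 23),
    (28, -16), (-25, -14), (6, 8), (2, -1)].getD v (0, 0)

noncomputable def gadgetPos (v : Fin 22) : ℝ × ℝ :=
  (((gadgetCoord v).1 : ℝ) / 50, ((gadgetCoord v).2 : ℝ) / 50)

theorem orient_gadgetPos (a b c : Fin 22) : orient (gadgetPos a) (gadgetPos b) (gadgetPos c) =
    (orient (gadgetCoord a) (gadgetCoord b) (gadgetCoord c) : ℤ) / 2500 := by
  simp only [orient, gadgetPos]
  push_cast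
  ring

theorem gadgetCoord_noThreeCollinear : ∀ a b c : Fin 22, a ≠ b → a ≠ c → b ≠ c →
    orient (gadgetCoord a) (gadgetCoord b) (gadgetCoord c) ≠ 0 := by
  decide +kernel

theorem gadgetPos_noThreeCollinear : NoThreeCollinear gadgetPos := by
  intro a b c hab hac hbc
  rw [orient_gadgetPos]
  have := gadgetCoord_noThreeCollinear a b c hab hac hbc
  positivity

theorem gadgetCoord_injective : ∀ a b : Fin 22, gadgetCoord a = gadgetCoord b → a = b := by
  decide +kernel

theorem gadgetPos_injective : Function.Injective gadgetPos := by
  intro a b h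
  simp only [gadgetPos, Prod.mk.injEq] at h
  apply gadgetCoord_injective
  ext
  · have := h.1
    field_simp at this
    exact_mod_cast this
  · have := h.2
    field_simp at this
    exact_mod_cast this

/-- A certificate of disjointness for edges without a common end: one of them lies strictly on one
side of the line through the other. -/
theorem gadgetCoord_sides : ∀ e ∈ gadgetEdges, ∀ f ∈ gadgetEdges,
    e.1 ≠ f.1 → e.1 ≠ f.2 → e.2 ≠ f.1 → e.2 ≠ f.2 →
    0 < orient (gadgetCoord e.1) (gadgetCoord e.2) (gadgetCoord f.1) *
      orient (gadgetCoord e.1) (gadgetCoord e.2) (gadgetCoord f.2) ∨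
    0 < orient (gadgetCoord f.1) (gadgetCoord f.2) (gadgetCoord e.1) *
      orient (gadgetCoord f.1) (gadgetCoord f.2) (gadgetCoord e.2) := by
  decide +kernel

/-- Since every edge has a nonterminal end, which lies in the open square, the interior of its
segment lies there too. -/
theorem gadgetEdges_inner : ∀ e ∈ gadgetEdges, 4 ≤ e.2 := by decide +kernel

theorem gadgetCoord_bound : ∀ v : Fin 22, |(gadgetCoord v).1| ≤ 50 ∧ |(gadgetCoord v).2| ≤ 50 ∧
    (4 ≤ v → |(gadgetCoord v).1| < 50 ∧ |(gadgetCoord v).2| < 50) := by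
  decide +kernel

theorem orient_swap {R : Type*} [CommRing R] (a b c : R × R) : orient b a c = -orient a b c := by
  simp only [orient]
  ring

theorem gadgetPos_sides {u v w x : Fin 22} (huv : gadgetAdj u v = true) (hwx : gadgetAdj w x = true)
    (huw : u ≠ w) (hux : u ≠ x) (hvw : v ≠ w) (hvx : v ≠ x) :
    0 < orient (gadgetPos u) (gadgetPos v) (gadgetPos w) *
      orient (gadgetPos u) (gadgetPos v) (gadgetPos x) ∨
    0 < orient (gadgetPos w) (gadgetPos x) (gadgetPos u) *
      orient (gadgetPos w) (gadgetPos x) (gadgetPos v) := by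
  have cast : ∀ a b c d : Fin 22, 0 < orient (gadgetCoord a) (gadgetCoord b) (gadgetCoord c) *
      orient (gadgetCoord a) (gadgetCoord b) (gadgetCoord d) →
      0 < orient (gadgetPos a) (gadgetPos b) (gadgetPos c) *
        orient (gadgetPos a) (gadgetPos b) (gadgetPos d) := by
    intro a b c d h
    rw [orient_gadgetPos, orient_gadgetPos, div_mul_div_comm]
    have : (0 : ℝ) < (orient (gadgetCoord a) (gadgetCoord b) (gadgetCoord c) : ℤ) *
        (orient (gadgetCoord a) (gadgetCoord b) (gadgetCoord d) : ℤ) := by exact_mod_cast h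
    positivity
  simp only [gadgetAdj, Bool.or_eq_true, List.contains_iff_mem] at huv hwx
  rcases huv with huv | huv <;> rcases hwx with hwx | hwx <;>
    rcases gadgetCoord_sides _ huv _ hwx (by assumption) (by assumption) (by assumption)
      (by assumption) with h | h <;>
    replace h := cast _ _ _ _ h <;> dsimp only at h
  · exact Or.inl h
  · exact Or.inr h
  · rw [mul_comm] at h
    exact Or.inl h
  · rw [orient_swap (gadgetPos w), orient_swap (gadgetPos w), neg_mul_neg] at h
    exact Or.inr h
  · rw [orient_swap (gadgetPos u), orient_swap (gadgetPos u), neg_mul_neg] at h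
    exact Or.inl h
  · rw [mul_comm] at h
    exact Or.inr h
  · rw [orient_swap (gadgetPos u), orient_swap (gadgetPos u), neg_mul_neg, mul_comm] at h
    exact Or.inl h
  · rw [orient_swap (gadgetPos w), orient_swap (gadgetPos w), neg_mul_neg, mul_comm] at h
    exact Or.inr h

/-- `orient a b` is affine along the segment and has the same strict sign at both ends. -/
theorem orient_straightPath_ne_zero {a b c d : ℝ × ℝ} (h : 0 < orient a b c * orient a b d)
    (t : unitInterval) : orient a b (straightPath c d t) ≠ 0 := by
  intro h0
  have h1 : orient a b (straightPath c d t) = (1 - t) * orient a b c + t * orient a b d := by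
    simp only [orient, straightPath_apply]
    ring
  rw [h1] at h0
  have h2 : 0 < orient a b c ^ 2 := by
    have : orient a b c ≠ 0 := left_ne_zero_of_mul h.ne'
    positivity
  have h3 : (1 - (t : ℝ)) * orient a b c ^ 2 + t * (orient a b c * orient a b d) = 0 := by
    linear_combination orient a b c * h0
  have ht0 : 0 ≤ (t : ℝ) := t.2.1
  have ht1 : 0 ≤ 1 - (t : ℝ) := sub_nonneg.2 t.2.2
  have h4 := mul_nonneg ht1 h2.le
  have h5 := mul_nonneg ht0 h.le
  have h6 : (t : ℝ) = 0 := by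
    by_contra hne
    have := mul_pos (lt_of_le_of_ne ht0 (Ne.symm hne)) h
    linarith
  rw [h6] at h3
  linarith

theorem gadgetLayout_crossings :
    (straightLayout crossoverGadget gadgetPos_injective gadgetPos_noThreeCollinear).crossings =
      ∅ := by
  rw [Set.eq_empty_iff_forall_notMem]
  rintro p ⟨hp, e, f, hef, he, hf⟩
  have hmem := fun v => straightLayout_not_mem crossoverGadget gadgetPos_injective
    gadgetPos_noThreeCollinear hef hp he hf (v := v)
  have hadj : ∀ e : crossoverGadget.edgeSet,
      gadgetAdj (Quot.out (e : Sym2 (Fin 22))).1 (Quot.out (e : Sym2 (Fin 22))).2 = true := by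
    intro e
    have h := e.2
    rw [← Quot.out_eq (e : Sym2 (Fin 22))] at h
    rw [← crossoverGadget_adj]
    exact crossoverGadget.mem_edgeSet.1 h
  have ho : ∀ e : crossoverGadget.edgeSet, (e : Sym2 (Fin 22)) =
      s((Quot.out (e : Sym2 (Fin 22))).1, (Quot.out (e : Sym2 (Fin 22))).2) := fun e =>
    (Quot.out_eq (e : Sym2 (Fin 22))).symm
  have hne : ∀ v w, v ∈ (e : Sym2 (Fin 22)) → w ∈ (f : Sym2 (Fin 22)) → v ≠ w := by
    rintro v w hv hw rfl
    exact hmem v hv hw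
  have h1 : ∀ e : crossoverGadget.edgeSet, (Quot.out (e : Sym2 (Fin 22))).1 ∈ (e : Sym2 (Fin 22)) :=
    fun e => Sym2.out_fst_mem _
  have h2 : ∀ e : crossoverGadget.edgeSet, (Quot.out (e : Sym2 (Fin 22))).2 ∈ (e : Sym2 (Fin 22)) :=
    fun e => Sym2.out_snd_mem _
  rcases gadgetPos_sides (hadj e) (hadj f) (hne _ _ (h1 e) (h1 f)) (hne _ _ (h1 e) (h2 f))
    (hne _ _ (h2 e) (h1 f)) (hne _ _ (h2 e) (h2 f)) with h | h
  · obtain ⟨t, rfl⟩ := hf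
    exact orient_straightPath_ne_zero h t (straightLayout_orient crossoverGadget _ _ e (ho e) he)
  · obtain ⟨t, rfl⟩ := he
    exact orient_straightPath_ne_zero h t (straightLayout_orient crossoverGadget _ _ f (ho f) hf)

theorem combination_mem_Ioo {x y t : ℝ} (hx : |x| ≤ 1) (hy : |y| ≤ 1) (hxy : |x| < 1 ∨ |y| < 1)
    (ht0 : 0 < t) (ht1 : t < 1) : (1 - t) * x + t * y ∈ Set.Ioo (-1 : ℝ) 1 := by
  rw [abs_le] at hx hy
  rw [abs_lt, abs_lt] at hxy
  rcases hxy with h | h <;> constructor <;> nlinarith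

theorem gadgetPos_abs (v : Fin 22) : |(gadgetPos v).1| ≤ 1 ∧ |(gadgetPos v).2| ≤ 1 ∧
    (4 ≤ v → |(gadgetPos v).1| < 1 ∧ |(gadgetPos v).2| < 1) := by
  obtain ⟨h1, h2, h3⟩ := gadgetCoord_bound v
  simp only [gadgetPos, abs_div, abs_of_pos (show (0 : ℝ) < 50 by norm_num)]
  refine ⟨?_, ?_, fun hv => ⟨?_, ?_⟩⟩
  · rw [div_le_one (by norm_num)]
    exact_mod_cast h1
  · rw [div_le_one (by norm_num)]
    exact_mod_cast h2
  · rw [div_lt_one (by norm_num)]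
    exact_mod_cast (h3 hv).1
  · rw [div_lt_one (by norm_num)]
    exact_mod_cast (h3 hv).2

theorem isCrossoverGadget_crossoverGadget : IsCrossoverGadget crossoverGadget where
  table := crossoverGadget_table
  layout := by
    refine ⟨straightLayout crossoverGadget gadgetPos_injective gadgetPos_noThreeCollinear,
      gadgetLayout_crossings, ?_, ?_, ?_, ?_, ?_, ?_⟩
    · change gadgetPos 0 = _
      norm_num [gadgetPos, gadgetCoord]
    · change gadgetPos 1 = _
      norm_num [gadgetPos, gadgetCoord]
    · change gadgetPos 2 = _
      norm_num [gadgetPos, gadgetCoord]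
    · change gadgetPos 3 = _
      norm_num [gadgetPos, gadgetCoord]
    · intro v hv
      obtain ⟨h1, h2⟩ := (gadgetPos_abs v).2.2 hv
      exact ⟨abs_lt.1 h1, abs_lt.1 h2⟩
    · intro e t ht0 ht1
      have hadj := e.2
      rw [← Quot.out_eq (e : Sym2 (Fin 22))] at hadj
      replace hadj := crossoverGadget.mem_edgeSet.1 hadj
      rw [crossoverGadget_adj] at hadj
      have h4 : 4 ≤ (Quot.out (e : Sym2 (Fin 22))).1 ∨ 4 ≤ (Quot.out (e : Sym2 (Fin 22))).2 := by
        simp only [gadgetAdj, Bool.or_eq_true, List.contains_iff_mem] at hadj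
        rcases hadj with h | h
        · exact Or.inr (gadgetEdges_inner _ h)
        · exact Or.inl (gadgetEdges_inner _ h)
      obtain ⟨a1, a2, a3⟩ := gadgetPos_abs (Quot.out (e : Sym2 (Fin 22))).1
      obtain ⟨b1, b2, b3⟩ := gadgetPos_abs (Quot.out (e : Sym2 (Fin 22))).2
      have ht0' : 0 < (t : ℝ) := lt_of_le_of_ne t.2.1 fun h => ht0 (Subtype.ext h.symm)
      have ht1' : (t : ℝ) < 1 := lt_of_le_of_ne t.2.2 fun h => ht1 (Subtype.ext h)
      exact ⟨combination_mem_Ioo a1 b1 (h4.imp (fun h => (a3 h).1) fun h => (b3 h).1) ht0' ht1',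
        combination_mem_Ioo a2 b2 (h4.imp (fun h => (a3 h).2) fun h => (b3 h).2) ht0' ht1'⟩

/-! ### Planarity after replacing the crossings -/

/-- `R x y γ` says that `γ` is an admissible arc from `x` to `y`. One arc is chosen for each edge,
in whichever direction is available, so no orientation of the edges has to be fixed beforehand. -/
theorem isPlanar_of_arcs {V : Type*} (G : SimpleGraph V) {pos : V → ℝ × ℝ}
    (hpos : Function.Injective pos) (R : V → V → (unitInterval → ℝ × ℝ) → Prop)
    (hR : ∀ x y γ, R x y γ → Continuous γ ∧ Function.Injective γ ∧ γ 0 = pos x ∧ γ 1 = pos y ∧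
      ∀ t v, γ t = pos v → t = 0 ∨ t = 1)
    (hcross : ∀ x y γ x' y' γ', R x y γ → R x' y' γ' → s(x, y) ≠ s(x', y') →
      ∀ t t', γ t = γ' t' → γ t ∈ Set.range pos)
    (hedge : ∀ x y, G.Adj x y → (∃ γ, R x y γ) ∨ ∃ γ, R y x γ) : IsPlanar G := by
  have h : ∀ e : G.edgeSet, ∃ x y γ, s(x, y) = (e : Sym2 V) ∧ R x y γ := by
    rintro ⟨e, he⟩
    induction e using Sym2.ind with
    | _ x y =>
      rcases hedge x y he with ⟨γ, h⟩ | ⟨γ, h⟩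
      · exact ⟨x, y, γ, rfl, h⟩
      · exact ⟨y, x, γ, Sym2.eq_swap, h⟩
  choose tail head γ hends hγ using h
  let L : PlaneLayout G :=
    { pos := pos
      pos_injective := hpos
      tail := tail
      head := head
      ends := hends
      arc := fun e => ⟨⟨γ e, (hR _ _ _ (hγ e)).1⟩, (hR _ _ _ (hγ e)).2.2.1,
        (hR _ _ _ (hγ e)).2.2.2.1⟩
      arc_injective := fun e => (hR _ _ _ (hγ e)).2.1
      arc_vertex := fun e => (hR _ _ _ (hγ e)).2.2.2.2 }
  refine ⟨L, Set.eq_empty_iff_forall_notMem.2 ?_⟩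
  rintro p ⟨hp, e, f, hef, ⟨t, rfl⟩, ⟨u, hu⟩⟩
  refine hp (hcross _ _ _ _ _ _ (hγ e) (hγ f) ?_ t u hu.symm)
  rw [hends, hends]
  exact fun h => hef (Subtype.ext h)

/-! #### Charts at the crossings -/

def squareChartDomain : Set (ℝ × ℝ) := Set.Icc (-1 : ℝ) 1 ×ˢ Set.Icc (-1 : ℝ) 1

theorem exists_subarc_of_strictMonoOn {γ : unitInterval → ℝ × ℝ} (hγ : Function.Injective γ)
    {h : ℝ → ℝ × ℝ} {g : ℝ → unitInterval} (hg : ContinuousOn g (Set.Icc (-1) 1))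
    (hmono : StrictMonoOn g (Set.Icc (-1) 1)) (hgh : ∀ x ∈ Set.Icc (-1 : ℝ) 1, γ (g x) = h x) :
    ∃ a τ b : unitInterval, a < τ ∧ τ < b ∧ γ τ = h 0 ∧ γ a = h (-1) ∧ γ b = h 1 ∧
      ∀ t, γ t ∈ h '' Set.Icc (-1) 1 ↔ a ≤ t ∧ t ≤ b := by
  have hl : (-1 : ℝ) ∈ Set.Icc (-1 : ℝ) 1 := by simp
  have h0 : (0 : ℝ) ∈ Set.Icc (-1 : ℝ) 1 := by simp
  have hr : (1 : ℝ) ∈ Set.Icc (-1 : ℝ) 1 := by simp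
  refine ⟨g (-1), g 0, g 1, hmono hl h0 (by norm_num), hmono h0 hr (by norm_num), hgh _ h0,
    hgh _ hl, hgh _ hr, fun t => ⟨?_, ?_⟩⟩
  · rintro ⟨x, hx, hxt⟩
    have : t = g x := hγ (by rw [hgh x hx, hxt])
    rw [this]
    exact ⟨hmono.monotoneOn hl hx hx.1, hmono.monotoneOn hx hr hx.2⟩
  · rintro ⟨h1, h2⟩
    obtain ⟨x, hx, rfl⟩ := intermediate_value_Icc (by norm_num : (-1 : ℝ) ≤ 1) hg ⟨h1, h2⟩
    exact ⟨x, hx, (hgh x hx).symm⟩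

/-- An injective path on a compact interval is an embedding, so `γ⁻¹ ∘ h` is continuous and
injective, hence strictly monotone or antitone. The sign `ε` records which, that is, in which
direction `γ` runs through the image of `h`. -/
theorem exists_subarc {γ : unitInterval → ℝ × ℝ} (hγc : Continuous γ) (hγ : Function.Injective γ)
    {h : ℝ → ℝ × ℝ} (hc : ContinuousOn h (Set.Icc (-1) 1)) (hi : Set.InjOn h (Set.Icc (-1) 1))
    (hr : ∀ x ∈ Set.Icc (-1 : ℝ) 1, h x ∈ Set.range γ) :
    ∃ ε : ℝ, (ε = 1 ∨ ε = -1) ∧ ∃ a τ b : unitInterval, a < τ ∧ τ < b ∧ γ τ = h 0 ∧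
      γ a = h (-ε) ∧ γ b = h ε ∧ ∀ t, γ t ∈ h '' Set.Icc (-1) 1 ↔ a ≤ t ∧ t ≤ b := by
  have hemb : Topology.IsEmbedding γ := (hγc.isClosedEmbedding hγ).isEmbedding
  set g : ℝ → unitInterval := fun x => Function.invFun γ (h x)
  have hgh : ∀ x ∈ Set.Icc (-1 : ℝ) 1, γ (g x) = h x := fun x hx => Function.invFun_eq (hr x hx)
  have hg : ContinuousOn g (Set.Icc (-1) 1) := by
    rw [hemb.continuousOn_iff]
    exact hc.congr hgh
  have hgi : Set.InjOn g (Set.Icc (-1) 1) := fun x hx y hy hxy =>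
    hi hx hy (by rw [← hgh x hx, ← hgh y hy, hxy])
  rcases hg.strictMonoOn_of_injOn_Icc' (by norm_num) hgi with hm | hm
  · exact ⟨1, Or.inl rfl, exists_subarc_of_strictMonoOn hγ hg hm hgh⟩
  · refine ⟨-1, Or.inr rfl, ?_⟩
    have hneg : Set.MapsTo (fun x : ℝ => -x) (Set.Icc (-1) 1) (Set.Icc (-1) 1) := by
      intro x hx
      exact ⟨by linarith [hx.2], by linarith [hx.1]⟩
    have himg : (fun x => h (-x)) '' Set.Icc (-1) 1 = h '' Set.Icc (-1) 1 := by
      rw [← Set.image_image h fun x => -x]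
      simp
    have := exists_subarc_of_strictMonoOn hγ (h := fun x => h (-x)) (g := fun x => g (-x))
      (hg.comp continuousOn_neg hneg) (fun x hx y hy hxy => hm (hneg hy) (hneg hx) (by linarith))
      (fun x hx => hgh _ (hneg hx))
    rw [himg] at this
    simpa using this

section Chart

variable {V : Type*} {G : SimpleGraph V} (D : Drawing G) (first : D.crossings → G.edgeSet)

theorem Drawing.exists_other_edge (c : D.crossings) :
    ∃ e, first c ≠ e ∧ (c : ℝ × ℝ) ∈ Set.range (D.arc e) := by
  obtain ⟨-, e, f, hef, he, hf⟩ := c.2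
  by_cases h : first c = e
  · exact ⟨f, h ▸ hef, hf⟩
  · exact ⟨e, h, he⟩

theorem Drawing.eq_of_ne_first (hfirst : ∀ c, (c : ℝ × ℝ) ∈ Set.range (D.arc (first c)))
    {c : D.crossings} {e f : G.edgeSet} (he : (c : ℝ × ℝ) ∈ Set.range (D.arc e))
    (hf : (c : ℝ × ℝ) ∈ Set.range (D.arc f)) (hne : first c ≠ e) (hnf : first c ≠ f) : e = f :=
  ((D.no_triple c c.2 _ _ _ (hfirst c) he hf).resolve_left hne).resolve_left hnf

-- The chart comes from `proper`, shrunk to a small closed square and reflected so that the edges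
-- run in the prescribed directions. Since no three edges cross at `c`, only one edge besides `first
-- c` has to be treated.
open Classical in
theorem Drawing.exists_chart (hfirst : ∀ c, (c : ℝ × ℝ) ∈ Set.range (D.arc (first c)))
    (c : D.crossings) {W : Set (ℝ × ℝ)} (hW : IsOpen W) (hcW : (c : ℝ × ℝ) ∈ W) :
    ∃ ψ : ℝ × ℝ → ℝ × ℝ, ContinuousOn ψ squareChartDomain ∧ Set.InjOn ψ squareChartDomain ∧
      Set.MapsTo ψ squareChartDomain W ∧ ∀ e, (c : ℝ × ℝ) ∈ Set.range (D.arc e) →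
        ∃ a τ b : unitInterval, a < τ ∧ τ < b ∧ D.arc e τ = c ∧
          D.arc e a = ψ (if first c = e then (-1, 0) else (0, 1)) ∧
          D.arc e b = ψ (if first c = e then (1, 0) else (0, -1)) ∧
          ∀ t, D.arc e t ∈ ψ '' squareChartDomain ↔ a ≤ t ∧ t ≤ b := by
  obtain ⟨f, hef, hf⟩ := D.exists_other_edge first c
  set e := first c with he_def
  have he : (c : ℝ × ℝ) ∈ Set.range (D.arc e) := hfirst c
  obtain ⟨φ, hcs, hφc, hφ⟩ := D.proper c c.2 e f hef he hf
  have h0t : ((0, 0) : ℝ × ℝ) ∈ φ.target := hφc ▸ φ.map_source hcs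
  have hs0 : φ.symm (0, 0) = c := by rw [← hφc, φ.left_inv hcs]
  obtain ⟨r, hr, hball⟩ : ∃ r > 0, Metric.closedBall ((0, 0) : ℝ × ℝ) r ⊆
      φ.target ∩ φ.symm ⁻¹' W := by
    refine Metric.nhds_basis_closedBall.mem_iff.1 (Filter.inter_mem (φ.open_target.mem_nhds h0t) ?_)
    refine (φ.symm.continuousAt (by simpa using h0t)).preimage_mem_nhds ?_
    rw [hs0]
    exact hW.mem_nhds hcW
  have hsq : ∀ x y : ℝ, |x| ≤ 1 → |y| ≤ 1 → ((r * x, r * y) : ℝ × ℝ) ∈ φ.target ∧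
      φ.symm (r * x, r * y) ∈ W := by
    intro x y hx hy
    refine hball ?_
    rw [Metric.mem_closedBall, Prod.dist_eq, max_le_iff]
    simp only [Real.dist_eq, sub_zero, abs_mul, abs_of_pos hr]
    exact ⟨by nlinarith, by nlinarith⟩
  have htarget : Set.MapsTo (fun x : ℝ × ℝ => ((r * x.1, r * x.2) : ℝ × ℝ)) squareChartDomain
      φ.target := fun x hx => (hsq _ _ (abs_le.2 hx.1) (abs_le.2 hx.2)).1
  set ψ₀ : ℝ × ℝ → ℝ × ℝ := fun x => φ.symm (r * x.1, r * x.2) with hψ₀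
  have hψ₀c : ContinuousOn ψ₀ squareChartDomain :=
    φ.symm.continuousOn.comp (by fun_prop) htarget
  have hψ₀i : Set.InjOn ψ₀ squareChartDomain := by
    intro x hx y hy hxy
    have := φ.symm.injOn (htarget hx) (htarget hy) hxy
    simp only [Prod.mk.injEq, mul_eq_mul_left_iff, hr.ne', or_false] at this
    exact Prod.ext this.1 this.2
  have hψ₀φ : ∀ x ∈ squareChartDomain, ψ₀ x ∈ φ.source ∧ φ (ψ₀ x) = (r * x.1, r * x.2) :=
    fun x hx => ⟨φ.map_target (htarget hx), φ.right_inv (htarget hx)⟩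
  have hψ₀e : ∀ x ∈ squareChartDomain, ψ₀ x ∈ Set.range (D.arc e) ↔ x.2 = 0 := by
    intro x hx
    rw [(hφ _ (hψ₀φ x hx).1).1, (hψ₀φ x hx).2]
    simp [hr.ne']
  have hψ₀f : ∀ x ∈ squareChartDomain, ψ₀ x ∈ Set.range (D.arc f) ↔ x.1 = 0 := by
    intro x hx
    rw [(hφ _ (hψ₀φ x hx).1).2, (hψ₀φ x hx).2]
    simp [hr.ne']
  have hm1 : Set.MapsTo (fun x : ℝ => ((x, 0) : ℝ × ℝ)) (Set.Icc (-1) 1) squareChartDomain :=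
    fun x hx => ⟨hx, by simp⟩
  have hm2 : Set.MapsTo (fun x : ℝ => ((0, x) : ℝ × ℝ)) (Set.Icc (-1) 1) squareChartDomain :=
    fun x hx => ⟨by simp, hx⟩
  obtain ⟨ε₁, hε₁, a₁, τ₁, b₁, ha₁, hb₁, hτ₁, hγa₁, hγb₁, hiff₁⟩ := exists_subarc
    (D.arc e).continuous (D.arc_injective e) (h := fun x => ψ₀ (x, 0))
    (hψ₀c.comp (by fun_prop) hm1) (fun x hx y hy h => by
      simpa using hψ₀i (hm1 hx) (hm1 hy) h) (fun x hx => (hψ₀e _ (hm1 hx)).2 rfl)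
  obtain ⟨ε₂, hε₂, a₂, τ₂, b₂, ha₂, hb₂, hτ₂, hγa₂, hγb₂, hiff₂⟩ := exists_subarc
    (D.arc f).continuous (D.arc_injective f) (h := fun x => ψ₀ (0, x))
    (hψ₀c.comp (by fun_prop) hm2) (fun x hx y hy h => by
      simpa using hψ₀i (hm2 hx) (hm2 hy) h) (fun x hx => (hψ₀f _ (hm2 hx)).2 rfl)
  -- The minus sign makes the second edge run downwards, from `v₂` at the top to `v₂'` at the
  -- bottom.
  set flip : ℝ × ℝ → ℝ × ℝ := fun x => (ε₁ * x.1, -ε₂ * x.2) with hflip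
  have hsgn : ∀ ε : ℝ, (ε = 1 ∨ ε = -1) → ∀ x ∈ Set.Icc (-1 : ℝ) 1, ε * x ∈ Set.Icc (-1 : ℝ) 1 := by
    rintro ε (rfl | rfl) x ⟨h1, h2⟩ <;> constructor <;> linarith
  have hε₂' : -ε₂ = 1 ∨ -ε₂ = -1 := by
    rcases hε₂ with rfl | rfl
    · exact Or.inr rfl
    · exact Or.inl (neg_neg 1)
  have hflipK : Set.MapsTo flip squareChartDomain squareChartDomain := fun x hx =>
    ⟨hsgn _ hε₁ _ hx.1, hsgn _ hε₂' _ hx.2⟩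
  have hflip2 : ∀ x, flip (flip x) = x := by
    intro x
    have h1 : ε₁ * ε₁ = 1 := by rcases hε₁ with rfl | rfl <;> norm_num
    have h2 : ε₂ * ε₂ = 1 := by rcases hε₂ with rfl | rfl <;> norm_num
    ext
    · simp only [hflip, ← mul_assoc, h1, one_mul]
    · simp only [hflip, ← mul_assoc, neg_mul_neg, h2, one_mul]
  have himage : (fun x => ψ₀ (flip x)) '' squareChartDomain = ψ₀ '' squareChartDomain := by
    ext p
    constructor
    · rintro ⟨x, hx, rfl⟩
      exact ⟨flip x, hflipK hx, rfl⟩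
    · rintro ⟨x, hx, rfl⟩
      exact ⟨flip x, hflipK hx, by simp only [hflip2]⟩
  refine ⟨fun x => ψ₀ (flip x), hψ₀c.comp (by fun_prop) hflipK, fun x hx y hy h => ?_,
    fun x hx => ?_, fun k hk => ?_⟩
  · rw [← hflip2 x, ← hflip2 y, hψ₀i (hflipK hx) (hflipK hy) h]
  · exact (hsq _ _ (abs_le.2 (hflipK hx).1) (abs_le.2 (hflipK hx).2)).2
  · rw [himage]
    by_cases hke : e = k
    · subst hke
      simp only [if_true, hflip, mul_zero, mul_neg, mul_one]
      refine ⟨a₁, τ₁, b₁, ha₁, hb₁, ?_, hγa₁, hγb₁, fun t => ?_⟩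
      · rw [hτ₁, ← hs0]
        simp [hψ₀]
      · rw [← hiff₁ t]
        constructor
        · rintro ⟨x, hx, hxt⟩
          have h2 : x.2 = 0 := (hψ₀e x hx).1 ⟨t, hxt.symm⟩
          refine ⟨x.1, hx.1, ?_⟩
          rw [← hxt, ← h2]
        · rintro ⟨x, hx, hxt⟩
          exact ⟨_, hm1 hx, hxt⟩
    · have hfk := D.eq_of_ne_first first hfirst hf hk hef hke
      subst hfk
      simp only [hke, if_false, hflip, mul_zero, mul_neg, mul_one, neg_neg]
      refine ⟨a₂, τ₂, b₂, ha₂, hb₂, ?_, hγa₂, hγb₂, fun t => ?_⟩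
      · rw [hτ₂, ← hs0]
        simp [hψ₀]
      · rw [← hiff₂ t]
        constructor
        · rintro ⟨x, hx, hxt⟩
          have h2 : x.1 = 0 := (hψ₀f x hx).1 ⟨t, hxt.symm⟩
          refine ⟨x.2, hx.2, ?_⟩
          rw [← hxt, ← h2]
        · rintro ⟨x, hx, hxt⟩
          exact ⟨_, hm2 hx, hxt⟩

end Chart

/-! ### Links between consecutive crossings, and the layout of the new graph. -/

section Links

variable {V : Type*} {G : SimpleGraph V}

theorem PlaneLayout.arc_zero_notMem_crossings (L : PlaneLayout G) (e : G.edgeSet) :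
    L.arc e 0 ∉ L.crossings := fun h => h.1 ⟨_, (L.arc e).source.symm⟩

theorem PlaneLayout.arc_one_notMem_crossings (L : PlaneLayout G) (e : G.edgeSet) :
    L.arc e 1 ∉ L.crossings := fun h => h.1 ⟨_, (L.arc e).target.symm⟩

/-- The points with parameters `s < t` are consecutive among the ends and the crossings of `e`, and
`x`, `y` are the vertices joined by the corresponding link. -/
def PlaneLayout.IsLink (L : PlaneLayout G) (first : L.crossings → G.edgeSet) (e : G.edgeSet)
    (s t : unitInterval) (x y : V ⊕ L.crossings × Fin 22) : Prop :=
  s < t ∧ (∀ r, s < r → r < t → L.arc e r ∉ L.crossings) ∧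
    L.Leaves first e s x ∧ L.Arrives first e t y

theorem PlaneLayout.Leaves.unique {L : PlaneLayout G} {first : L.crossings → G.edgeSet}
    {e : G.edgeSet} {s : unitInterval} {x x' : V ⊕ L.crossings × Fin 22}
    (h : L.Leaves first e s x) (h' : L.Leaves first e s x') : x = x' := by
  rcases h with ⟨rfl, rfl⟩ | ⟨c, hc, rfl⟩ <;> rcases h' with ⟨h0, rfl⟩ | ⟨c', hc', rfl⟩
  · rfl
  · exact absurd (hc' ▸ c'.2) (L.arc_zero_notMem_crossings e)
  · subst h0
    exact absurd (hc ▸ c.2) (L.arc_zero_notMem_crossings e)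
  · rw [Subtype.ext (hc.symm.trans hc')]

theorem PlaneLayout.Arrives.unique {L : PlaneLayout G} {first : L.crossings → G.edgeSet}
    {e : G.edgeSet} {s : unitInterval} {x x' : V ⊕ L.crossings × Fin 22}
    (h : L.Arrives first e s x) (h' : L.Arrives first e s x') : x = x' := by
  rcases h with ⟨rfl, rfl⟩ | ⟨c, hc, rfl⟩ <;> rcases h' with ⟨h0, rfl⟩ | ⟨c', hc', rfl⟩
  · rfl
  · exact absurd (hc' ▸ c'.2) (L.arc_one_notMem_crossings e)
  · subst h0
    exact absurd (hc ▸ c.2) (L.arc_one_notMem_crossings e)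
  · rw [Subtype.ext (hc.symm.trans hc')]

theorem PlaneLayout.Leaves.mem_crossings {L : PlaneLayout G} {first : L.crossings → G.edgeSet}
    {e : G.edgeSet} {s : unitInterval} {x : V ⊕ L.crossings × Fin 22}
    (h : L.Leaves first e s x) (hs : s ≠ 0) : L.arc e s ∈ L.crossings := by
  rcases h with ⟨h0, -⟩ | ⟨c, hc, -⟩
  · exact absurd h0 hs
  · exact hc ▸ c.2

theorem PlaneLayout.Arrives.mem_crossings {L : PlaneLayout G} {first : L.crossings → G.edgeSet}
    {e : G.edgeSet} {s : unitInterval} {x : V ⊕ L.crossings × Fin 22}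
    (h : L.Arrives first e s x) (hs : s ≠ 1) : L.arc e s ∈ L.crossings := by
  rcases h with ⟨h0, -⟩ | ⟨c, hc, -⟩
  · exact absurd h0 hs
  · exact hc ▸ c.2

/-- If two links of one edge overlapped without coinciding, an end of one would be a crossing
strictly inside the other. -/
theorem PlaneLayout.IsLink.eq_or_separated {L : PlaneLayout G}
    {first : L.crossings → G.edgeSet} {e : G.edgeSet} {s t s' t' : unitInterval}
    {x y x' y' : V ⊕ L.crossings × Fin 22} (h : L.IsLink first e s t x y)
    (h' : L.IsLink first e s' t' x' y') : (s = s' ∧ t = t') ∨ t ≤ s' ∨ t' ≤ s := by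
  have one : ∀ {s t s' t' : unitInterval} {x y x' y' : V ⊕ L.crossings × Fin 22},
      L.IsLink first e s t x y → L.IsLink first e s' t' x' y' → s < s' → t ≤ s' := by
    intro s t s' t' x y x' y' h h' hlt
    by_contra hlt'
    exact h.2.1 s' hlt (not_le.1 hlt')
      (h'.2.2.1.mem_crossings ((unitInterval.nonneg'.trans_lt hlt).ne'))
  have two : ∀ {s t t' : unitInterval} {x y x' y' : V ⊕ L.crossings × Fin 22},
      L.IsLink first e s t x y → L.IsLink first e s t' x' y' → ¬ t < t' := by
    intro s t t' x y x' y' h h' hlt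
    exact h'.2.1 t h.1 hlt
      (h.2.2.2.mem_crossings ((hlt.trans_le unitInterval.le_one').ne))
  rcases lt_trichotomy s s' with hs | rfl | hs
  · exact Or.inr (Or.inl (one h h' hs))
  · exact Or.inl ⟨rfl, le_antisymm (not_lt.1 (two h' h)) (not_lt.1 (two h h'))⟩
  · exact Or.inr (Or.inr (one h' h hs))

open Classical in
/-- Disjoint charts around the crossings of a drawing, in which the two edges are the axes, traversed
from left to right and from top to bottom. The gadget vertices have the positions `P`. -/
structure CrossingCharts (D : Drawing G) (first : D.crossings → G.edgeSet)
    (P : Fin 22 → ℝ × ℝ) where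
  W : D.crossings → Set (ℝ × ℝ)
  disjoint : ∀ c c', c ≠ c' → Disjoint (W c) (W c')
  pos_notMem : ∀ c v, D.pos v ∉ W c
  mem_range : ∀ c e t, D.arc e t ∈ W c → (c : ℝ × ℝ) ∈ Set.range (D.arc e)
  ψ : D.crossings → ℝ × ℝ → ℝ × ℝ
  continuousOn : ∀ c, ContinuousOn (ψ c) squareChartDomain
  injOn : ∀ c, Set.InjOn (ψ c) squareChartDomain
  mapsTo : ∀ c, Set.MapsTo (ψ c) squareChartDomain (W c)
  a : D.crossings → G.edgeSet → unitInterval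
  τ : D.crossings → G.edgeSet → unitInterval
  b : D.crossings → G.edgeSet → unitInterval
  a_lt : ∀ (c : D.crossings) e, (c : ℝ × ℝ) ∈ Set.range (D.arc e) → a c e < τ c e
  lt_b : ∀ (c : D.crossings) e, (c : ℝ × ℝ) ∈ Set.range (D.arc e) → τ c e < b c e
  arc_τ : ∀ (c : D.crossings) e, (c : ℝ × ℝ) ∈ Set.range (D.arc e) → D.arc e (τ c e) = c
  arc_a : ∀ (c : D.crossings) e, (c : ℝ × ℝ) ∈ Set.range (D.arc e) →
    D.arc e (a c e) = ψ c (P (if first c = e then 0 else 2))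
  arc_b : ∀ (c : D.crossings) e, (c : ℝ × ℝ) ∈ Set.range (D.arc e) →
    D.arc e (b c e) = ψ c (P (if first c = e then 1 else 3))
  arc_mem : ∀ (c : D.crossings) e, (c : ℝ × ℝ) ∈ Set.range (D.arc e) → ∀ t,
    D.arc e t ∈ ψ c '' squareChartDomain ↔ a c e ≤ t ∧ t ≤ b c e

theorem Drawing.nonempty_crossingCharts [Finite V] (D : Drawing G)
    (first : D.crossings → G.edgeSet) (hfirst : ∀ c, (c : ℝ × ℝ) ∈ Set.range (D.arc (first c)))
    {P : Fin 22 → ℝ × ℝ} (h0 : P 0 = (-1, 0)) (h1 : P 1 = (1, 0)) (h2 : P 2 = (0, 1))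
    (h3 : P 3 = (0, -1)) : Nonempty (CrossingCharts D first P) := by
  classical
  obtain ⟨U, hU, hUd⟩ := D.finite_crossings.t2_separation
  -- What the neighbourhood of `c` must avoid: all vertices and all edges not through `c`. It is
  -- closed because the graph is finite.
  let Z : D.crossings → Set (ℝ × ℝ) := fun c =>
    Set.range D.pos ∪ ⋃ e ∈ {e : G.edgeSet | (c : ℝ × ℝ) ∉ Set.range (D.arc e)}, Set.range (D.arc e)
  have hZ : ∀ c, IsClosed (Z c) := fun c =>
    (Set.finite_range D.pos).isClosed.union ((Set.toFinite _).isClosed_biUnion fun e _ =>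
      (isCompact_range (D.arc e).continuous).isClosed)
  have hcZ : ∀ c, (c : ℝ × ℝ) ∉ Z c := by
    rintro c (h | h)
    · exact c.2.1 h
    · simp only [Set.mem_iUnion] at h
      obtain ⟨e, he, h⟩ := h
      exact he h
  have hex := fun c : D.crossings => D.exists_chart first hfirst c
    ((hU c).2.sdiff (hZ c)) ⟨(hU c).1, hcZ c⟩
  choose ψ hψc hψi hψm hψ using hex
  choose! a τ b ha hb hτ hγa hγb hiff using hψ
  refine ⟨⟨fun c => U c \ Z c, ?_, ?_, ?_, ψ, hψc, hψi, hψm, a, τ, b, ha, hb, hτ, ?_, ?_, hiff⟩⟩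
  · intro c c' hcc'
    exact (hUd c.2 c'.2 fun h => hcc' (Subtype.ext h)).mono Set.sdiff_subset Set.sdiff_subset
  · rintro c v ⟨-, h⟩
    exact h (Or.inl ⟨v, rfl⟩)
  · rintro c e t ⟨-, h⟩
    by_contra hc
    refine h (Or.inr ?_)
    simp only [Set.mem_iUnion]
    exact ⟨e, hc, t, rfl⟩
  · intro c e he
    rw [hγa c e he]
    split_ifs
    · rw [h0]
    · rw [h2]
  · intro c e he
    rw [hγb c e he]
    split_ifs
    · rw [h1]
    · rw [h3]

namespace CrossingCharts

variable {D : Drawing G} {first : D.crossings → G.edgeSet} {P : Fin 22 → ℝ × ℝ}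
  (Φ : CrossingCharts D first P)

/-- The positions of the vertices after replacing the crossings. -/
def vertexPos : V ⊕ D.crossings × Fin 22 → ℝ × ℝ :=
  Sum.elim D.pos fun p => Φ.ψ p.1 (P p.2)

theorem mem_W_of_mem_image {c : D.crossings} {p : ℝ × ℝ} (h : p ∈ Φ.ψ c '' squareChartDomain) :
    p ∈ Φ.W c := by
  obtain ⟨x, hx, rfl⟩ := h
  exact Φ.mapsTo c hx

theorem eq_of_mem_W {c c' : D.crossings} {p : ℝ × ℝ} (h : p ∈ Φ.W c) (h' : p ∈ Φ.W c') :
    c = c' := by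
  by_contra hne
  exact Set.disjoint_left.1 (Φ.disjoint c c' hne) h h'

theorem vertexPos_injective (hP : Function.Injective P) (hPK : ∀ i, P i ∈ squareChartDomain) :
    Function.Injective Φ.vertexPos := by
  rintro (v | ⟨c, i⟩) (w | ⟨c', j⟩) h
  · rw [D.pos_injective h]
  · have h' : D.pos v = Φ.ψ c' (P j) := h
    exact absurd (h' ▸ Φ.mapsTo c' (hPK j)) (Φ.pos_notMem c' v)
  · have h' : Φ.ψ c (P i) = D.pos w := h
    exact absurd (h' ▸ Φ.mapsTo c (hPK i)) (Φ.pos_notMem c w)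
  · have h' : Φ.ψ c (P i) = Φ.ψ c' (P j) := h
    obtain rfl : c = c' := Φ.eq_of_mem_W (Φ.mapsTo c (hPK i)) (h' ▸ Φ.mapsTo c' (hPK j))
    rw [hP (Φ.injOn c (hPK i) (hPK j) h')]

/-- If the two parameter intervals met, the larger of their left ends would be mapped into both of
the disjoint neighbourhoods. -/
theorem separated {c c' : D.crossings} {e : G.edgeSet} (hne : c ≠ c')
    (hc : (c : ℝ × ℝ) ∈ Set.range (D.arc e)) (hc' : (c' : ℝ × ℝ) ∈ Set.range (D.arc e)) :
    Φ.b c e < Φ.a c' e ∨ Φ.b c' e < Φ.a c e := by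
  by_contra h
  push Not at h
  have hab := (Φ.a_lt c e hc).trans (Φ.lt_b c e hc)
  have hab' := (Φ.a_lt c' e hc').trans (Φ.lt_b c' e hc')
  have h1 := (Φ.arc_mem c e hc (max (Φ.a c e) (Φ.a c' e))).2
    ⟨le_max_left _ _, max_le hab.le h.1⟩
  have h2 := (Φ.arc_mem c' e hc' (max (Φ.a c e) (Φ.a c' e))).2
    ⟨le_max_right _ _, max_le h.2 hab'.le⟩
  exact hne (Φ.eq_of_mem_W (Φ.mem_W_of_mem_image h1) (Φ.mem_W_of_mem_image h2))

theorem a_pos {c : D.crossings} {e : G.edgeSet} (hc : (c : ℝ × ℝ) ∈ Set.range (D.arc e)) :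
    0 < Φ.a c e := by
  refine lt_of_le_of_ne unitInterval.nonneg' fun h => ?_
  have h1 := Φ.mem_W_of_mem_image ((Φ.arc_mem c e hc _).2
    ⟨le_rfl, ((Φ.a_lt c e hc).trans (Φ.lt_b c e hc)).le⟩)
  rw [← h, Path.source] at h1
  exact Φ.pos_notMem _ _ h1

theorem b_lt_one {c : D.crossings} {e : G.edgeSet} (hc : (c : ℝ × ℝ) ∈ Set.range (D.arc e)) :
    Φ.b c e < 1 := by
  refine lt_of_le_of_ne unitInterval.le_one' fun h => ?_
  have h1 := Φ.mem_W_of_mem_image ((Φ.arc_mem c e hc _).2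
    ⟨((Φ.a_lt c e hc).trans (Φ.lt_b c e hc)).le, le_rfl⟩)
  rw [h, Path.target] at h1
  exact Φ.pos_notMem _ _ h1

/-- The start of a link is moved to the exit from the square around its crossing. By then all
squares of crossings up to `s` have been left, and none of the later ones has been entered. -/
theorem exists_leave {e : G.edgeSet} {s : unitInterval} {x : V ⊕ D.crossings × Fin 22}
    (h : D.Leaves first e s x) : ∃ s', s ≤ s' ∧ s' < 1 ∧ D.arc e s' = Φ.vertexPos x ∧
      ∀ d : D.crossings, (d : ℝ × ℝ) ∈ Set.range (D.arc e) →
        (Φ.τ d e ≤ s → Φ.b d e ≤ s') ∧ (s < Φ.τ d e → s' < Φ.a d e) := by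
  rcases h with ⟨rfl, rfl⟩ | ⟨c, hc, rfl⟩
  · refine ⟨0, le_rfl, zero_lt_one, (D.arc e).source, fun d hd => ⟨fun h => ?_, fun _ => Φ.a_pos hd⟩⟩
    exact absurd h (not_le.2 ((Φ.a_pos hd).trans (Φ.a_lt d e hd)))
  · have hce : (c : ℝ × ℝ) ∈ Set.range (D.arc e) := ⟨s, hc⟩
    obtain rfl : s = Φ.τ c e := D.arc_injective e (hc.trans (Φ.arc_τ c e hce).symm)
    refine ⟨Φ.b c e, (Φ.lt_b c e hce).le, Φ.b_lt_one hce, Φ.arc_b c e hce, fun d hd => ?_⟩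
    by_cases hcd : c = d
    · subst hcd
      exact ⟨fun _ => le_rfl, fun h => absurd h (lt_irrefl _)⟩
    · have := Φ.a_lt c e hce
      have := Φ.lt_b c e hce
      have := Φ.a_lt d e hd
      have := Φ.lt_b d e hd
      rcases Φ.separated hcd hce hd with h | h
      · exact ⟨fun h' => by order, fun _ => h⟩
      · exact ⟨fun _ => by order, fun h' => by order⟩

theorem exists_arrive {e : G.edgeSet} {t : unitInterval} {y : V ⊕ D.crossings × Fin 22}
    (h : D.Arrives first e t y) : ∃ t', t' ≤ t ∧ D.arc e t' = Φ.vertexPos y ∧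
      (t' = 1 ∨ ∃ c : D.crossings, (c : ℝ × ℝ) ∈ Set.range (D.arc e) ∧ t = Φ.τ c e ∧
        t' = Φ.a c e) ∧
      ∀ d : D.crossings, (d : ℝ × ℝ) ∈ Set.range (D.arc e) → t ≤ Φ.τ d e → t' ≤ Φ.a d e := by
  rcases h with ⟨rfl, rfl⟩ | ⟨c, hc, rfl⟩
  · refine ⟨1, le_rfl, (D.arc e).target, Or.inl rfl, fun d hd h => ?_⟩
    exact absurd h (not_le.2 ((Φ.lt_b d e hd).trans (Φ.b_lt_one hd)))
  · have hce : (c : ℝ × ℝ) ∈ Set.range (D.arc e) := ⟨t, hc⟩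
    obtain rfl : t = Φ.τ c e := D.arc_injective e (hc.trans (Φ.arc_τ c e hce).symm)
    refine ⟨Φ.a c e, (Φ.a_lt c e hce).le, Φ.arc_a c e hce, Or.inr ⟨c, hce, rfl, rfl⟩,
      fun d hd h' => ?_⟩
    by_cases hcd : c = d
    · rw [hcd]
    · have := Φ.a_lt c e hce
      have := Φ.lt_b c e hce
      have := Φ.a_lt d e hd
      have := Φ.lt_b d e hd
      rcases Φ.separated hcd hce hd with h | h <;> order

/-- A trimmed link touches the squares only at its ends: a square met in between would belong to a
crossing strictly between `s` and `t`. -/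
theorem exists_subarc_of_isLink {e : G.edgeSet} {s t : unitInterval}
    {x y : V ⊕ D.crossings × Fin 22} (h : D.IsLink first e s t x y) :
    ∃ s' t', s ≤ s' ∧ s' < t' ∧ t' ≤ t ∧ D.arc e s' = Φ.vertexPos x ∧
      D.arc e t' = Φ.vertexPos y ∧
      ∀ r, s' ≤ r → r ≤ t' → ∀ c, D.arc e r ∈ Φ.ψ c '' squareChartDomain → r = s' ∨ r = t' := by
  obtain ⟨hst, hno, hx, hy⟩ := h
  obtain ⟨s', hs', hs1, hs'x, hsd⟩ := Φ.exists_leave hx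
  obtain ⟨t', ht', ht'y, htc, htd⟩ := Φ.exists_arrive hy
  refine ⟨s', t', hs', ?_, ht', hs'x, ht'y, fun r hsr hrt c hc => ?_⟩
  · rcases htc with rfl | ⟨c, hc, rfl, rfl⟩
    · exact hs1
    · exact (hsd c hc).2 hst
  · have hce := Φ.mem_range c e r (Φ.mem_W_of_mem_image hc)
    obtain ⟨h1, h2⟩ := (Φ.arc_mem c e hce r).1 hc
    rcases le_or_gt (Φ.τ c e) s with h | h
    · exact Or.inl (le_antisymm (h2.trans ((hsd c hce).1 h)) hsr)
    · rcases le_or_gt t (Φ.τ c e) with h' | h'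
      · exact Or.inr (le_antisymm hrt ((htd c hce h').trans h1))
      · exact absurd (Φ.arc_τ c e hce ▸ c.2) (hno _ h h')

end CrossingCharts

/-- The point dividing the segment between two points of the unit interval in a given ratio. -/
def unitLerp (s t u : unitInterval) : unitInterval :=
  ⟨(1 - u) * s + u * t, by
    have hu0 := u.2.1
    have hu1 := u.2.2
    constructor
    · have := s.2.1
      have := t.2.1
      nlinarith
    · have := s.2.2
      have := t.2.2
      nlinarith⟩

theorem unitLerp_zero (s t : unitInterval) : unitLerp s t 0 = s := by
  ext; simp [unitLerp]

theorem unitLerp_one (s t : unitInterval) : unitLerp s t 1 = t := by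
  ext; simp [unitLerp]

theorem continuous_unitLerp (s t : unitInterval) : Continuous (unitLerp s t) := by
  unfold unitLerp
  fun_prop

theorem unitLerp_strictMono {s t : unitInterval} (h : s < t) : StrictMono (unitLerp s t) := by
  intro u v huv
  have h1 : (s : ℝ) < t := h
  have h2 : (u : ℝ) < v := huv
  change (1 - (u : ℝ)) * s + u * t < (1 - (v : ℝ)) * s + v * t
  nlinarith

theorem unitLerp_mem {s t : unitInterval} (h : s < t) (u : unitInterval) :
    s ≤ unitLerp s t u ∧ unitLerp s t u ≤ t := by
  have hm := (unitLerp_strictMono h).monotone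
  exact ⟨(unitLerp_zero s t).ge.trans (hm unitInterval.nonneg'),
    (hm unitInterval.le_one').trans (unitLerp_one s t).le⟩

/-- The graph obtained from a drawing by replacing every crossing with a gadget is planar. -/
theorem isPlanar_replaceCrossings [Finite V] (D : Drawing G) (first : D.crossings → G.edgeSet)
    (hfirst : ∀ c, (c : ℝ × ℝ) ∈ Set.range (D.arc (first c))) {H : SimpleGraph (Fin 22)}
    (hH : IsCrossoverGadget H) : IsPlanar (D.replaceCrossings first H) := by
  obtain ⟨L, hL, h0, h1, h2, h3, hin, harc⟩ := hH.layout
  obtain ⟨Φ⟩ := D.nonempty_crossingCharts first hfirst h0 h1 h2 h3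
  have hPK : ∀ i, L.pos i ∈ squareChartDomain := by
    intro i
    rcases lt_or_ge i 4 with hi | hi
    · have : i = 0 ∨ i = 1 ∨ i = 2 ∨ i = 3 := by omega
      rcases this with rfl | rfl | rfl | rfl
      · rw [h0]; norm_num [squareChartDomain]
      · rw [h1]; norm_num [squareChartDomain]
      · rw [h2]; norm_num [squareChartDomain]
      · rw [h3]; norm_num [squareChartDomain]
    · exact ⟨Set.Ioo_subset_Icc_self (hin i hi).1, Set.Ioo_subset_Icc_self (hin i hi).2⟩
  have harcK : ∀ k u, L.arc k u ∈ squareChartDomain := by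
    intro k u
    by_cases hu0 : u = 0
    · rw [hu0, Path.source]
      exact hPK _
    · by_cases hu1 : u = 1
      · rw [hu1, Path.target]
        exact hPK _
      · exact ⟨Set.Ioo_subset_Icc_self (harc k u hu0 hu1).1,
          Set.Ioo_subset_Icc_self (harc k u hu0 hu1).2⟩
  have hgadget : ∀ c k u, Φ.ψ c (L.arc k u) ∈ Φ.ψ c '' squareChartDomain := fun c k u =>
    Set.mem_image_of_mem _ (harcK k u)
  set pos := Φ.vertexPos
  have hinj : Function.Injective pos := Φ.vertexPos_injective L.pos_injective hPK
  -- There are two kinds of arcs: the arcs of the gadget carried over by a chart, and the trimmed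
  -- links.
  let R₁ : V ⊕ D.crossings × Fin 22 → V ⊕ D.crossings × Fin 22 → (unitInterval → ℝ × ℝ) → Prop :=
    fun x y γ => ∃ c k, x = Sum.inr (c, L.tail k) ∧ y = Sum.inr (c, L.head k) ∧
      γ = fun u => Φ.ψ c (L.arc k u)
  let R₂ : V ⊕ D.crossings × Fin 22 → V ⊕ D.crossings × Fin 22 → (unitInterval → ℝ × ℝ) → Prop :=
    fun x y γ => ∃ e s t s' t', D.IsLink first e s t x y ∧ s ≤ s' ∧ s' < t' ∧ t' ≤ t ∧
      D.arc e s' = pos x ∧ D.arc e t' = pos y ∧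
      (∀ r, s' ≤ r → r ≤ t' → ∀ c, D.arc e r ∈ Φ.ψ c '' squareChartDomain → r = s' ∨ r = t') ∧
      γ = fun u => D.arc e (unitLerp s' t' u)
  -- a link meets the charts only at its ends
  have hlink : ∀ x y γ, R₂ x y γ → ∀ u c, γ u ∈ Φ.ψ c '' squareChartDomain →
      γ u ∈ Set.range pos := by
    rintro x y γ ⟨e, s, t, s', t', -, -, hst, -, hx, hy, hr, rfl⟩ u c hc
    rcases hr _ (unitLerp_mem hst u).1 (unitLerp_mem hst u).2 c hc with h | h
    · exact ⟨x, by simp only [h, hx]⟩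
    · exact ⟨y, by simp only [h, hy]⟩
  refine isPlanar_of_arcs _ hinj (fun x y γ => R₁ x y γ ∨ R₂ x y γ) ?_ ?_ ?_
  · rintro x y γ (⟨c, k, rfl, rfl, rfl⟩ | ⟨e, s, t, s', t', -, -, hst, -, hx, hy, hr, rfl⟩)
    · refine ⟨(Φ.continuousOn c).comp_continuous (L.arc k).continuous (harcK k), fun u v huv =>
        L.arc_injective k (Φ.injOn c (harcK k u) (harcK k v) huv), ?_, ?_, ?_⟩
      · simp only [Path.source]
        rfl
      · simp only [Path.target]
        rfl
      · rintro u (v | ⟨c', i⟩) h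
        · have h' : Φ.ψ c (L.arc k u) = D.pos v := h
          exact absurd (h' ▸ Φ.mapsTo c (harcK k u)) (Φ.pos_notMem c v)
        · have h' : Φ.ψ c (L.arc k u) = Φ.ψ c' (L.pos i) := h
          obtain rfl : c = c' := Φ.eq_of_mem_W (Φ.mapsTo c (harcK k u))
            (h' ▸ Φ.mapsTo c' (hPK i))
          exact L.arc_vertex k u i (Φ.injOn c (harcK k u) (hPK i) h')
    · have hi := (unitLerp_strictMono hst).injective
      refine ⟨(D.arc e).continuous.comp (continuous_unitLerp _ _), (D.arc_injective e).comp hi,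
        by simp only [unitLerp_zero, hx], by simp only [unitLerp_one, hy], ?_⟩
      have hends : ∀ u, unitLerp s' t' u = s' ∨ unitLerp s' t' u = t' → u = 0 ∨ u = 1 := by
        rintro u (h | h)
        · exact Or.inl (hi (h.trans (unitLerp_zero _ _).symm))
        · exact Or.inr (hi (h.trans (unitLerp_one _ _).symm))
      rintro u (v | ⟨c, i⟩) h
      · apply hends
        obtain ⟨h1, h2⟩ := unitLerp_mem hst u
        rcases D.arc_vertex e _ v h with h' | h'
        · left
          refine le_antisymm ?_ h1
          rw [h']
          exact unitInterval.nonneg'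
        · right
          refine le_antisymm h2 ?_
          rw [h']
          exact unitInterval.le_one'
      · exact hends u (hr _ (unitLerp_mem hst u).1 (unitLerp_mem hst u).2 c
          ⟨L.pos i, hPK i, h.symm⟩)
  · rintro x y γ x' y' γ' (h | h) (h' | h') hne u u' huu'
    · obtain ⟨c, k, rfl, rfl, rfl⟩ := h
      obtain ⟨c', k', rfl, rfl, rfl⟩ := h'
      simp only at huu'
      obtain rfl : c = c' := Φ.eq_of_mem_W (Φ.mapsTo c (harcK k u))
        (huu' ▸ Φ.mapsTo c' (harcK k' u'))
      have hkk' : k ≠ k' := by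
        rintro rfl
        exact hne rfl
      have hp := Φ.injOn c (harcK k u) (harcK k' u') huu'
      have : L.arc k u ∈ Set.range L.pos := by
        by_contra hnot
        have : L.arc k u ∈ L.crossings := ⟨hnot, k, k', hkk', ⟨u, rfl⟩, ⟨u', hp.symm⟩⟩
        rw [hL] at this
        exact this
      obtain ⟨i, hi⟩ := this
      exact ⟨Sum.inr (c, i), by simp only [← hi]; rfl⟩
    · rw [huu']
      obtain ⟨c, k, rfl, rfl, rfl⟩ := h
      exact hlink _ _ _ h' u' c (huu' ▸ hgadget c k u)
    · obtain ⟨c, k, rfl, rfl, rfl⟩ := h'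
      exact hlink _ _ _ h u c (huu' ▸ hgadget c k u')
    · have hh := hlink _ _ _ h u
      obtain ⟨e, s, t, s', t', hl, hss', hst, htt', hx, hy, hr, rfl⟩ := h
      obtain ⟨e₂, s₂, t₂, s₂', t₂', hl₂, hss₂', hst₂, htt₂', hx₂, hy₂, hr₂, rfl⟩ := h'
      simp only at huu' hh ⊢
      by_cases hee : e = e₂
      · subst hee
        have hu := D.arc_injective e huu'
        obtain ⟨m1, m2⟩ := unitLerp_mem hst u
        obtain ⟨m1', m2'⟩ := unitLerp_mem hst₂ u'
        rw [← hu] at m1' m2'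
        rcases hl.eq_or_separated hl₂ with ⟨rfl, rfl⟩ | hsep | hsep
        · exfalso
          apply hne
          rw [hl.2.2.1.unique hl₂.2.2.1, hl.2.2.2.unique hl₂.2.2.2]
        · refine ⟨y, ?_⟩
          rw [← hy]
          congr 1
          order
        · refine ⟨x, ?_⟩
          rw [← hx]
          congr 1
          order
      · by_cases hv : D.arc e (unitLerp s' t' u) ∈ Set.range D.pos
        · obtain ⟨v, hv⟩ := hv
          exact ⟨Sum.inl v, hv⟩
        -- A common point of two different edges that is no vertex of `G` is a crossing. It lies in
        -- its own square, which links touch only at vertices.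
        · set c : D.crossings := ⟨D.arc e (unitLerp s' t' u), hv, e, e₂, hee, ⟨_, rfl⟩, ⟨_, huu'.symm⟩⟩
            with hc
          refine hh c ?_
          have hce : (c : ℝ × ℝ) ∈ Set.range (D.arc e) := ⟨_, rfl⟩
          have hτ : unitLerp s' t' u = Φ.τ c e := D.arc_injective e (Φ.arc_τ c e hce).symm
          rw [Φ.arc_mem c e hce, hτ]
          exact ⟨(Φ.a_lt c e hce).le, (Φ.lt_b c e hce).le⟩
  · have key : ∀ x y, ((∃ c i j, H.Adj i j ∧ x = Sum.inr (c, i) ∧ y = Sum.inr (c, j)) ∨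
        ∃ e s t, D.IsLink first e s t x y) →
        (∃ γ, R₁ x y γ ∨ R₂ x y γ) ∨ ∃ γ, R₁ y x γ ∨ R₂ y x γ := by
      rintro x y (⟨c, i, j, hij, rfl, rfl⟩ | ⟨e, s, t, hl⟩)
      · have hends := L.ends ⟨s(i, j), hij⟩
        rcases Sym2.eq_iff.1 hends with ⟨h1, h2⟩ | ⟨h1, h2⟩
        · exact Or.inl ⟨_, Or.inl ⟨c, ⟨s(i, j), hij⟩, by rw [h1], by rw [h2], rfl⟩⟩
        · exact Or.inr ⟨_, Or.inl ⟨c, ⟨s(i, j), hij⟩, by rw [h1], by rw [h2], rfl⟩⟩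
      · obtain ⟨s', t', h⟩ := Φ.exists_subarc_of_isLink hl
        exact Or.inl ⟨_, Or.inr ⟨e, s, t, s', t', hl, h.1, h.2.1, h.2.2.1, h.2.2.2.1, h.2.2.2.2.1,
          h.2.2.2.2.2, rfl⟩⟩
    intro x y hxy
    rw [PlaneLayout.replaceCrossings, SimpleGraph.fromRel_adj] at hxy
    rcases hxy.2 with h | h
    · exact key x y h
    · exact (key y x h).symm

end Links

/-! ### The face that projects to the stable set polytope -/

/-- All that is used of the table for projecting the face: nine is the maximum, and it requires a
terminal of each pair. -/
theorem crossoverTable_le (i j : Fin 3) :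
    crossoverTable i j ≤ 9 ∧ (crossoverTable i j = 9 → i ≠ 0 ∧ j ≠ 0) := by
  revert i j
  decide

namespace IsCrossoverGadget

variable {H : SimpleGraph (Fin 22)} (hH : IsCrossoverGadget H)

include hH

theorem card_le {S : Finset (Fin 22)} (hS : H.IsIndepSet (S : Set (Fin 22))) :
    S.card ≤ 9 ∧ (S.card = 9 → (0 ∈ S ∨ 1 ∈ S) ∧ (2 ∈ S ∨ 3 ∈ S)) := by
  have hlt : ∀ a b : Fin 22, (S ∩ {0, 1, 2, 3} ∩ {a, b}).card < 3 := fun a b =>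
    ((Finset.card_le_card Finset.inter_subset_right).trans Finset.card_le_two).trans_lt
      (by norm_num)
  have h := (hH.table (S ∩ {0, 1, 2, 3}) ⟨_, hlt 0 1⟩ ⟨_, hlt 2 3⟩ Finset.inter_subset_right
    rfl rfl).2 ⟨S, hS, rfl, rfl⟩
  obtain ⟨h1, h2⟩ := crossoverTable_le ⟨_, hlt 0 1⟩ ⟨_, hlt 2 3⟩
  refine ⟨h.trans h1, fun h9 => ?_⟩
  obtain ⟨h3, h4⟩ := h2 (le_antisymm h1 (h9 ▸ h))
  have hne : ∀ a b : Fin 22, (S ∩ {0, 1, 2, 3} ∩ {a, b}).card ≠ 0 → a ∈ S ∨ b ∈ S := by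
    intro a b hab
    obtain ⟨x, hx⟩ := Finset.card_ne_zero.1 hab
    simp only [Finset.mem_inter, Finset.mem_insert, Finset.mem_singleton] at hx
    rcases hx with ⟨⟨hx, -⟩, rfl | rfl⟩
    · exact Or.inl hx
    · exact Or.inr hx
  exact ⟨hne 0 1 fun h => h3 (Fin.ext h), hne 2 3 fun h => h4 (Fin.ext h)⟩

/-- The value `s₁₁ = 9` holds for each choice of one terminal per pair, so a gadget can transmit one
bit along each of its two edges independently. -/
theorem exists_card_eq (p q : Prop) [Decidable p] [Decidable q] : ∃ S : Finset (Fin 22),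
    H.IsIndepSet (S : Set (Fin 22)) ∧ S.card = 9 ∧
      (0 ∈ S ↔ ¬ p) ∧ (1 ∈ S ↔ p) ∧ (2 ∈ S ↔ ¬ q) ∧ (3 ∈ S ↔ q) := by
  set A : Finset (Fin 22) := {if p then 1 else 0, if q then 3 else 2} with hA
  have hAs : A ⊆ {0, 1, 2, 3} := by
    rw [hA]
    split_ifs <;> decide
  have h1 : (A ∩ {0, 1}).card = ((1 : Fin 3) : ℕ) := by
    rw [hA]
    split_ifs <;> decide
  have h2 : (A ∩ {2, 3}).card = ((1 : Fin 3) : ℕ) := by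
    rw [hA]
    split_ifs <;> decide
  obtain ⟨S, hS, hSA, hcard⟩ := (hH.table A 1 1 hAs h1 h2).1
  have hmem : ∀ a ∈ ({0, 1, 2, 3} : Finset (Fin 22)), a ∈ S ↔ a ∈ A := by
    intro a ha
    rw [← hSA, Finset.mem_inter]
    exact ⟨fun h => ⟨h, ha⟩, fun h => h.1⟩
  refine ⟨S, hS, hcard, ?_, ?_, ?_, ?_⟩
  · rw [hmem 0 (by decide), hA]
    by_cases p <;> by_cases q <;> simp [*]
  · rw [hmem 1 (by decide), hA]
    by_cases p <;> by_cases q <;> simp [*]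
  · rw [hmem 2 (by decide), hA]
    by_cases p <;> by_cases q <;> simp [*]
  · rw [hmem 3 (by decide), hA]
    by_cases p <;> by_cases q <;> simp [*]

end IsCrossoverGadget

section Face

variable {V : Type*} {G : SimpleGraph V}

theorem PlaneLayout.tail_adj_head (L : PlaneLayout G) (e : G.edgeSet) :
    G.Adj (L.tail e) (L.head e) := by
  rw [← SimpleGraph.mem_edgeSet, L.ends]
  exact e.2

theorem PlaneLayout.IsLink.adj {L : PlaneLayout G} {first : L.crossings → G.edgeSet}
    {H : SimpleGraph (Fin 22)} {e : G.edgeSet} {s t : unitInterval}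
    {x y : V ⊕ L.crossings × Fin 22} (h : L.IsLink first e s t x y) :
    (L.replaceCrossings first H).Adj x y := by
  rw [PlaneLayout.replaceCrossings, SimpleGraph.fromRel_adj]
  refine ⟨?_, Or.inl (Or.inr ⟨e, s, t, h⟩)⟩
  rintro rfl
  rcases h.2.2.1 with ⟨-, rfl⟩ | ⟨c, -, rfl⟩ <;> rcases h.2.2.2 with ⟨-, h'⟩ | ⟨c', -, h'⟩
  · exact (L.tail_adj_head e).ne (Sum.inl_injective h')
  · exact absurd h' Sum.inl_ne_inr
  · exact absurd h' Sum.inr_ne_inl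
  · have := (Prod.mk.inj (Sum.inr_injective h')).2
    split_ifs at this <;> exact absurd this (by decide)

theorem PlaneLayout.replaceCrossings_adj_gadget {L : PlaneLayout G}
    {first : L.crossings → G.edgeSet} {H : SimpleGraph (Fin 22)} {c : L.crossings} {i j : Fin 22}
    (h : H.Adj i j) : (L.replaceCrossings first H).Adj (Sum.inr (c, i)) (Sum.inr (c, j)) := by
  rw [PlaneLayout.replaceCrossings, SimpleGraph.fromRel_adj]
  exact ⟨by simpa using h.ne, Or.inl (Or.inl ⟨c, i, j, h, rfl, rfl⟩)⟩

open Classical in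
/-- If in every gadget a stable set contains a terminal of each of the two pairs, then it does not
contain both ends of an edge. -/
theorem Drawing.isIndepSet_of_terminals (D : Drawing G) (first : D.crossings → G.edgeSet)
    (H : SimpleGraph (Fin 22)) {S : Set (V ⊕ D.crossings × Fin 22)}
    (hS : (D.replaceCrossings first H).IsIndepSet S)
    (hT : ∀ c, (Sum.inr (c, 0) ∈ S ∨ Sum.inr (c, 1) ∈ S) ∧
      (Sum.inr (c, 2) ∈ S ∨ Sum.inr (c, 3) ∈ S)) :
    G.IsIndepSet {v | Sum.inl v ∈ S} := by
  have main : ∀ e, ¬ (Sum.inl (D.tail e) ∈ S ∧ Sum.inl (D.head e) ∈ S) := by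
    rintro e ⟨htail, hhead⟩
    set T : Set unitInterval := {t | D.arc e t ∈ D.crossings} with hTdef
    have hTfin : T.Finite := D.finite_crossings.preimage (D.arc_injective e).injOn
    -- At the first place `t` where the arrival vertex is in `S`, consider the preceding point `s`.
    -- If it is a crossing, its arrival terminal is not in `S`, so its leaving terminal is;
    -- otherwise it is the tail. The link from `s` to `t` then has both ends in `S`.
    set B : Set unitInterval := {t | ∃ y, D.Arrives first e t y ∧ y ∈ S} with hB
    have hBfin : B.Finite := by
      refine (hTfin.union (Set.finite_singleton 1)).subset ?_
      rintro t ⟨y, hy, -⟩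
      by_cases ht : t = 1
      · exact Or.inr ht
      · exact Or.inl (hy.mem_crossings ht)
    have hB1 : B.Nonempty := ⟨1, _, Or.inl ⟨rfl, rfl⟩, hhead⟩
    obtain ⟨t, ⟨y, hy, hyS⟩, htmin⟩ := hBfin.exists_minimal hB1
    have ht0 : 0 < t := by
      refine lt_of_le_of_ne unitInterval.nonneg' ?_
      rintro rfl
      exact D.arc_zero_notMem_crossings e (hy.mem_crossings zero_ne_one)
    obtain ⟨s, ⟨hsT, hst⟩, hsmax⟩ := (((hTfin.insert 0).subset
      (Set.inter_subset_left (t := Set.Iio t)))).exists_maximal ⟨0, Set.mem_insert _ _, ht0⟩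
    obtain ⟨x, hx, hxS⟩ : ∃ x, D.Leaves first e s x ∧ x ∈ S := by
      rcases hsT with rfl | hsT
      · exact ⟨_, Or.inl ⟨rfl, rfl⟩, htail⟩
      · refine ⟨_, Or.inr ⟨⟨_, hsT⟩, rfl, rfl⟩, ?_⟩
        by_contra hnot
        refine absurd (htmin (y := s) ⟨_, Or.inr ⟨⟨_, hsT⟩, rfl, rfl⟩, ?_⟩ (le_of_lt hst))
          (not_le.2 hst)
        split_ifs at hnot ⊢ with hf
        · exact (hT _).1.resolve_right hnot
        · exact (hT _).2.resolve_right hnot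
    have hl : D.IsLink first e s t x y := by
      refine ⟨hst, fun r hsr hrt hr => ?_, hx, hy⟩
      exact absurd (hsmax (y := r) ⟨Set.mem_insert_of_mem _ hr, hrt⟩ hsr.le) (not_le.2 hsr)
    exact hS hxS hyS (hl.adj (H := H)).ne hl.adj
  intro u hu w hw _ huw
  have hends := D.ends ⟨s(u, w), huw⟩
  rcases Sym2.eq_iff.1 hends with ⟨h1, h2⟩ | ⟨h1, h2⟩
  · exact main ⟨s(u, w), huw⟩ ⟨by rw [h1]; exact hu, by rw [h2]; exact hw⟩
  · exact main ⟨s(u, w), huw⟩ ⟨by rw [h1]; exact hw, by rw [h2]; exact hu⟩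

open Classical in
/-- Every stable set extends to a stable set that has nine vertices in every gadget. -/
theorem Drawing.exists_extension (D : Drawing G) (first : D.crossings → G.edgeSet)
    (hfirst : ∀ c, (c : ℝ × ℝ) ∈ Set.range (D.arc (first c))) {H : SimpleGraph (Fin 22)}
    (hH : IsCrossoverGadget H) {S : Set V} (hS : G.IsIndepSet S) :
    ∃ (S' : Set (V ⊕ D.crossings × Fin 22)) (A : D.crossings → Finset (Fin 22)),
      (D.replaceCrossings first H).IsIndepSet S' ∧ (∀ v, Sum.inl v ∈ S' ↔ v ∈ S) ∧
      (∀ c i, Sum.inr (c, i) ∈ S' ↔ i ∈ A c) ∧ ∀ c, (A c).card = 9 := by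
  -- For each edge through a crossing, the leaving terminal is chosen if the tail of that edge is in
  -- `S`, and the arrival terminal otherwise. Both ends of a link cannot be chosen, since this would
  -- put the tail both in and outside `S`.
  choose other hother hmem using D.exists_other_edge first
  choose A hA hA9 h0 h1 h2 h3 using fun c : D.crossings =>
    hH.exists_card_eq (D.tail (first c) ∈ S) (D.tail (other c) ∈ S)
  set S' : Set (V ⊕ D.crossings × Fin 22) := {x | Sum.elim (· ∈ S) (fun p => p.2 ∈ A p.1) x}
  have hleave : ∀ e s x, D.Leaves first e s x → x ∈ S' → D.tail e ∈ S := by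
    rintro e s x (⟨-, rfl⟩ | ⟨c, hc, rfl⟩) hx
    · exact hx
    · change (if first c = e then 1 else 3) ∈ A c at hx
      split_ifs at hx with he
      · rw [← he]
        exact (h1 c).1 hx
      · rw [← D.eq_of_ne_first first hfirst (hmem c) ⟨s, hc⟩ (hother c) he]
        exact (h3 c).1 hx
  have harrive : ∀ e t y, D.Arrives first e t y → y ∈ S' → D.tail e ∉ S := by
    rintro e t y (⟨-, rfl⟩ | ⟨c, hc, rfl⟩) hy
    · intro ht
      exact hS ht hy (D.tail_adj_head e).ne (D.tail_adj_head e)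
    · change (if first c = e then 0 else 2) ∈ A c at hy
      split_ifs at hy with he
      · rw [← he]
        exact (h0 c).1 hy
      · rw [← D.eq_of_ne_first first hfirst (hmem c) ⟨t, hc⟩ (hother c) he]
        exact (h2 c).1 hy
  refine ⟨S', A, ?_, fun v => Iff.rfl, fun c i => Iff.rfl, hA9⟩
  have key : ∀ x ∈ S', ∀ y ∈ S', ((∃ c i j, H.Adj i j ∧ x = Sum.inr (c, i) ∧ y = Sum.inr (c, j)) ∨
      ∃ e s t, D.IsLink first e s t x y) → False := by
    rintro x hx y hy (⟨c, i, j, hij, rfl, rfl⟩ | ⟨e, s, t, hl⟩)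
    · exact hA c hx hy hij.ne hij
    · exact harrive e t y hl.2.2.2 hy (hleave e s x hl.2.2.1 hx)
  intro x hx y hy _ hxy
  rw [PlaneLayout.replaceCrossings, SimpleGraph.fromRel_adj] at hxy
  rcases hxy.2 with h | h
  · exact key x hx y hy h
  · exact key y hy x hx h

theorem Drawing.exists_face_replaceCrossings [Finite V] (D : Drawing G)
    (first : D.crossings → G.edgeSet)
    (hfirst : ∀ c, (c : ℝ × ℝ) ∈ Set.range (D.arc (first c))) {H : SimpleGraph (Fin 22)}
    (hH : IsCrossoverGadget H) : ∃ F : Set (V ⊕ D.crossings × Fin 22 → ℝ),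
      IsExposed ℝ (stab (D.replaceCrossings first H)) F ∧
      (fun x v => x (Sum.inl v)) '' F = stab G := by
  classical
  have := Fintype.ofFinite V
  have := D.finite_crossings.fintype
  -- The number of chosen gadget vertices. Its bound, nine per crossing, is attained only if it is
  -- attained in every gadget.
  let l : (V ⊕ D.crossings × Fin 22 → ℝ) →ₗ[ℝ] ℝ :=
    ∑ c, ∑ i, LinearMap.proj (Sum.inr (c, i))
  have hl : ∀ x, l x = ∑ c : D.crossings, ∑ i : Fin 22, x (Sum.inr (c, i)) := by
    intro x
    simp [l]
  let part : Set (V ⊕ D.crossings × Fin 22) → D.crossings → Finset (Fin 22) := fun S c =>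
    Finset.univ.filter fun i => Sum.inr (c, i) ∈ S
  have hpart : ∀ S, l (S.indicator 1) = ∑ c, ((part S c).card : ℝ) := by
    intro S
    rw [hl]
    refine Finset.sum_congr rfl fun c _ => ?_
    simp [part, Set.indicator_apply]
  have hindep : ∀ S, (D.replaceCrossings first H).IsIndepSet S → ∀ c,
      H.IsIndepSet (part S c : Set (Fin 22)) := by
    intro S hS c i hi j hj _ hij
    have hi' : i ∈ part S c := hi
    have hj' : j ∈ part S c := hj
    simp only [part, Finset.mem_filter] at hi' hj'
    have hadj := D.replaceCrossings_adj_gadget (first := first) (c := c) hij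
    exact hS hi'.2 hj'.2 hadj.ne hadj
  have hle : ∀ x ∈ {x | ∃ S, (D.replaceCrossings first H).IsIndepSet S ∧ x = S.indicator 1},
      l x ≤ ∑ _c : D.crossings, (9 : ℝ) := by
    rintro _ ⟨S, hS, rfl⟩
    rw [hpart]
    refine Finset.sum_le_sum fun c _ => ?_
    exact_mod_cast (hH.card_le (hindep S hS c)).1
  refine ⟨{x ∈ stab (D.replaceCrossings first H) | l x = ∑ _c : D.crossings, (9 : ℝ)},
    isExposed_sep_eq l _ fun x hx => le_of_mem_convexHull l hle hx, ?_⟩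
  rw [stab, sep_convexHull_eq l hle]
  let π : (V ⊕ D.crossings × Fin 22 → ℝ) →ₗ[ℝ] (V → ℝ) := LinearMap.funLeft ℝ ℝ Sum.inl
  change π '' _ = _
  rw [LinearMap.image_convexHull, stab]
  congr 1
  ext z
  constructor
  · rintro ⟨_, ⟨⟨S, hS, rfl⟩, hSl⟩, rfl⟩
    refine ⟨{v | Sum.inl v ∈ S}, D.isIndepSet_of_terminals first H hS fun c => ?_, ?_⟩
    · rw [hpart] at hSl
      have hc := (Finset.sum_eq_sum_iff_of_le fun c _ => by
        exact_mod_cast (hH.card_le (hindep S hS c)).1).1 hSl c (Finset.mem_univ c)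
      have hterm := (hH.card_le (hindep S hS c)).2 (by exact_mod_cast hc)
      simpa [part] using hterm
    · ext v
      simp only [π, LinearMap.funLeft_apply, Set.indicator_apply]
      rfl
  · rintro ⟨S, hS, rfl⟩
    obtain ⟨S', A, hS', hV, hA, h9⟩ := D.exists_extension first hfirst hH hS
    refine ⟨S'.indicator 1, ⟨⟨S', hS', rfl⟩, ?_⟩, ?_⟩
    · rw [hpart]
      refine Finset.sum_congr rfl fun c _ => ?_
      have : part S' c = A c := by
        ext i
        simp [part, hA]
      rw [this, h9]
      norm_num
    · ext v
      simp only [π, LinearMap.funLeft_apply, Set.indicator_apply, hV]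
      rfl

end Face

/-! ### Straight-line drawings with points in general position -/

/-- The determinant of the three lines through pairs of points. It vanishes if they are
concurrent. -/
def lineDet {R : Type*} [CommRing R] (v : Fin 6 → R × R) : R :=
  Matrix.det !![(v 0).2 - (v 1).2, (v 1).1 - (v 0).1, (v 0).1 * (v 1).2 - (v 0).2 * (v 1).1;
    (v 2).2 - (v 3).2, (v 3).1 - (v 2).1, (v 2).1 * (v 3).2 - (v 2).2 * (v 3).1;
    (v 4).2 - (v 5).2, (v 5).1 - (v 4).1, (v 4).1 * (v 5).2 - (v 4).2 * (v 5).1]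

/-- The rows are the homogeneous equations of the lines, all of which annihilate the vector `(p.1,
p.2, 1)`. -/
theorem lineDet_eq_zero (v : Fin 6 → ℝ × ℝ) (p : ℝ × ℝ) (h₁ : orient (v 0) (v 1) p = 0)
    (h₂ : orient (v 2) (v 3) p = 0) (h₃ : orient (v 4) (v 5) p = 0) : lineDet v = 0 := by
  simp only [orient] at h₁ h₂ h₃
  have e₁ : (v 0).1 * (v 1).2 - (v 0).2 * (v 1).1 =
      -((v 0).2 - (v 1).2) * p.1 - ((v 1).1 - (v 0).1) * p.2 := by linear_combination h₁
  have e₂ : (v 2).1 * (v 3).2 - (v 2).2 * (v 3).1 =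
      -((v 2).2 - (v 3).2) * p.1 - ((v 3).1 - (v 2).1) * p.2 := by linear_combination h₂
  have e₃ : (v 4).1 * (v 5).2 - (v 4).2 * (v 5).1 =
      -((v 4).2 - (v 5).2) * p.1 - ((v 5).1 - (v 4).1) * p.2 := by linear_combination h₃
  rw [lineDet, e₁, e₂, e₃, Matrix.det_fin_three]
  simp
  ring

theorem exists_lineDet_ne_zero : ∃ w : Fin 6 → ℝ × ℝ, lineDet w ≠ 0 := by
  refine ⟨![(0, 0), (1, 0), (0, 0), (0, 1), (0, 1), (1, 0)], ?_⟩
  rw [lineDet, Matrix.det_fin_three]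
  simp

/-- Six distinct vertices suffice here, because edges that cross have no common end. -/
def NoThreeConcurrent {V : Type*} (pos : V → ℝ × ℝ) : Prop :=
  ∀ v : Fin 6 → V, Function.Injective v → lineDet (fun i => pos (v i)) ≠ 0

/-- Every degeneracy is the vanishing of a polynomial in the coordinates that is nonzero, as a
suitable placement shows. The product of these finitely many polynomials is nonzero, hence nonzero
at some real point. -/
theorem exists_generalPosition (V : Type*) [Finite V] : ∃ pos : V → ℝ × ℝ,
    Function.Injective pos ∧ NoThreeCollinear pos ∧ NoThreeConcurrent pos := by
  classical
  have := Fintype.ofFinite V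
  let X : V → MvPolynomial (V × Bool) ℝ × MvPolynomial (V × Bool) ℝ := fun v =>
    (MvPolynomial.X (v, false), MvPolynomial.X (v, true))
  let ev : (V → ℝ × ℝ) → MvPolynomial (V × Bool) ℝ →+* ℝ := fun p =>
    MvPolynomial.eval fun x => if x.2 then (p x.1).2 else (p x.1).1
  have hX1 : ∀ p v, ev p (X v).1 = (p v).1 := fun p v => by simp [ev, X]
  have hX2 : ∀ p v, ev p (X v).2 = (p v).2 := fun p v => by simp [ev, X]
  have ho : ∀ p a b c, ev p (orient (X a) (X b) (X c)) = orient (p a) (p b) (p c) := by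
    intro p a b c
    simp [orient, hX1, hX2]
  have hd : ∀ p (v : Fin 6 → V), ev p (lineDet fun i => X (v i)) = lineDet fun i => p (v i) := by
    intro p v
    simp [lineDet, Matrix.det_fin_three, hX1, hX2]
  have hne : ∀ (q : MvPolynomial (V × Bool) ℝ) p, ev p q ≠ 0 → q ≠ 0 := by
    rintro q p h rfl
    exact h (map_zero _)
  let q₂ : MvPolynomial (V × Bool) ℝ := ∏ v : {v : V × V // v.1 ≠ v.2}, ((X v.1.1).1 - (X v.1.2).1)
  let q₃ : MvPolynomial (V × Bool) ℝ := ∏ v : {v : V × V × V // v.1 ≠ v.2.1 ∧ v.1 ≠ v.2.2 ∧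
    v.2.1 ≠ v.2.2}, orient (X v.1.1) (X v.1.2.1) (X v.1.2.2)
  let q₆ : MvPolynomial (V × Bool) ℝ := ∏ v : {v : Fin 6 → V // Function.Injective v},
    lineDet fun i => X (v.1 i)
  have h₂ : q₂ ≠ 0 := by
    refine Finset.prod_ne_zero_iff.2 fun v _ => ?_
    obtain ⟨p, hp⟩ : ∃ p : V → ℝ × ℝ, (p v.1.1).1 - (p v.1.2).1 ≠ 0 :=
      ⟨fun w => if w = v.1.1 then (1, 0) else 0, by
        beta_reduce
        rw [if_pos rfl, if_neg v.2.symm]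
        norm_num⟩
    rw [← hX1, ← hX1, ← map_sub] at hp
    exact hne _ p hp
  have h₃ : q₃ ≠ 0 := by
    refine Finset.prod_ne_zero_iff.2 fun v _ => ?_
    obtain ⟨h1, h2, h3⟩ := v.2
    obtain ⟨p, hp⟩ : ∃ p : V → ℝ × ℝ, orient (p v.1.1) (p v.1.2.1) (p v.1.2.2) ≠ 0 :=
      ⟨fun w => if w = v.1.2.1 then (1, 0) else if w = v.1.2.2 then (0, 1) else 0, by
        beta_reduce
        rw [if_neg h1, if_neg h2, if_pos rfl, if_neg h3.symm, if_pos rfl]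
        norm_num [orient]⟩
    rw [← ho] at hp
    exact hne _ p hp
  have h₆ : q₆ ≠ 0 := by
    refine Finset.prod_ne_zero_iff.2 fun v _ => ?_
    obtain ⟨w, hw⟩ := exists_lineDet_ne_zero
    have hp : lineDet (fun i => Function.extend v.1 w 0 (v.1 i)) ≠ 0 := by
      simpa only [v.2.extend_apply] using hw
    rw [← hd] at hp
    exact hne _ _ hp
  obtain ⟨x, hx⟩ : ∃ x, MvPolynomial.eval x (q₂ * q₃ * q₆) ≠ 0 := by
    by_contra! h
    exact mul_ne_zero (mul_ne_zero h₂ h₃) h₆ (MvPolynomial.funext fun x => by rw [h x, map_zero])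
  set p : V → ℝ × ℝ := fun v => (x (v, false), x (v, true))
  have hev : MvPolynomial.eval x = ev p := by
    simp only [ev]
    congr 1
    ext ⟨v, b⟩
    cases b <;> rfl
  rw [hev, map_mul, map_mul] at hx
  have hx₂ := left_ne_zero_of_mul (left_ne_zero_of_mul hx)
  have hx₃ := right_ne_zero_of_mul (left_ne_zero_of_mul hx)
  have hx₆ := right_ne_zero_of_mul hx
  rw [map_prod, Finset.prod_ne_zero_iff] at hx₂ hx₃ hx₆
  refine ⟨p, ?_, ?_, ?_⟩
  · intro v w hvw
    by_contra hne
    refine hx₂ ⟨(v, w), hne⟩ (Finset.mem_univ _) ?_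
    rw [map_sub, hX1, hX1, hvw, sub_self]
  · intro a b c hab hac hbc
    have := hx₃ ⟨(a, b, c), hab, hac, hbc⟩ (Finset.mem_univ _)
    rwa [ho] at this
  · intro v hv
    have := hx₆ ⟨v, hv⟩ (Finset.mem_univ _)
    rwa [hd] at this

/-- Local coordinates at a crossing of two segments. -/
theorem exists_chart_straightPath {a b c d p : ℝ × ℝ} {t u : unitInterval}
    (ht : straightPath a b t = p) (hu : straightPath c d u = p) (ht0 : t ≠ 0) (ht1 : t ≠ 1)
    (hu0 : u ≠ 0) (hu1 : u ≠ 1)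
    (hΔ : (b.1 - a.1) * (d.2 - c.2) - (b.2 - a.2) * (d.1 - c.1) ≠ 0) :
    ∃ φ : OpenPartialHomeomorph (ℝ × ℝ) (ℝ × ℝ), p ∈ φ.source ∧ φ p = (0, 0) ∧
      ∀ q ∈ φ.source, (q ∈ Set.range (straightPath a b) ↔ (φ q).2 = 0) ∧
        (q ∈ Set.range (straightPath c d) ↔ (φ q).1 = 0) := by
  have ht0' : 0 < (t : ℝ) := lt_of_le_of_ne t.2.1 fun h => ht0 (Subtype.ext h.symm)
  have ht1' : (t : ℝ) < 1 := lt_of_le_of_ne t.2.2 fun h => ht1 (Subtype.ext h)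
  have hu0' : 0 < (u : ℝ) := lt_of_le_of_ne u.2.1 fun h => hu0 (Subtype.ext h.symm)
  have hu1' : (u : ℝ) < 1 := lt_of_le_of_ne u.2.2 fun h => hu1 (Subtype.ext h)
  rw [straightPath_apply] at ht hu
  obtain ⟨p1, p2⟩ := p
  simp only [Prod.mk.injEq] at ht hu
  set Δ := (b.1 - a.1) * (d.2 - c.2) - (b.2 - a.2) * (d.1 - c.1) with hΔdef
  -- Affine coordinates with origin `p` and the directions of the two segments as axes; `I` is the
  -- inverse map.
  let F : ℝ × ℝ → ℝ × ℝ := fun q =>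
    (((q.1 - p1) * (d.2 - c.2) - (q.2 - p2) * (d.1 - c.1)) / Δ,
      ((b.1 - a.1) * (q.2 - p2) - (b.2 - a.2) * (q.1 - p1)) / Δ)
  let I : ℝ × ℝ → ℝ × ℝ := fun x =>
    (p1 + x.1 * (b.1 - a.1) + x.2 * (d.1 - c.1), p2 + x.1 * (b.2 - a.2) + x.2 * (d.2 - c.2))
  have hFc : Continuous F := by fun_prop
  have hIc : Continuous I := by fun_prop
  have hIF : ∀ q, I (F q) = q := by
    intro q
    ext
    · simp only [F, I]
      field_simp
      rw [hΔdef]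
      ring
    · simp only [F, I]
      field_simp
      rw [hΔdef]
      ring
  have hFI : ∀ x, F (I x) = x := by
    intro x
    ext
    · simp only [F, I]
      rw [div_eq_iff hΔ, hΔdef]
      ring
    · simp only [F, I]
      rw [div_eq_iff hΔ, hΔdef]
      ring
  -- In this box the parameters `t + x.1` and `u + x.2` stay in the unit interval, so the axes are
  -- covered by the segments and not only by their lines.
  set T : Set (ℝ × ℝ) := Set.Ioo (-(t : ℝ)) (1 - t) ×ˢ Set.Ioo (-(u : ℝ)) (1 - u)
  have hT : IsOpen T := isOpen_Ioo.prod isOpen_Ioo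
  let φ : OpenPartialHomeomorph (ℝ × ℝ) (ℝ × ℝ) :=
    { toFun := F
      invFun := I
      source := F ⁻¹' T
      target := T
      map_source' := fun q hq => hq
      map_target' := fun x hx => by rwa [Set.mem_preimage, hFI]
      left_inv' := fun q _ => hIF q
      right_inv' := fun x _ => hFI x
      open_source := hT.preimage hFc
      open_target := hT
      continuousOn_toFun := hFc.continuousOn
      continuousOn_invFun := hIc.continuousOn }
  have hFp : F (p1, p2) = (0, 0) := by simp [F]
  refine ⟨φ, ?_, hFp, ?_⟩
  · change F (p1, p2) ∈ T
    rw [hFp]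
    refine ⟨⟨?_, ?_⟩, ?_, ?_⟩ <;> simp [*]
  · intro q hq
    have hq' : F q ∈ T := hq
    change (q ∈ _ ↔ (F q).2 = 0) ∧ (q ∈ _ ↔ (F q).1 = 0)
    obtain ⟨x, rfl⟩ : ∃ x, q = I x := ⟨F q, (hIF q).symm⟩
    rw [hFI] at hq' ⊢
    obtain ⟨⟨hx1, hx2⟩, hx3, hx4⟩ := hq'
    constructor
    · constructor
      · rintro ⟨r, hr⟩
        simp only [straightPath_apply, I, Prod.mk.injEq] at hr
        have : x.2 * Δ = 0 := by
          rw [hΔdef]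
          linear_combination (b.2 - a.2) * hr.1 - (b.1 - a.1) * hr.2 - (b.2 - a.2) * ht.1 +
            (b.1 - a.1) * ht.2
        exact (mul_eq_zero.1 this).resolve_right hΔ
      · intro h0
        refine ⟨⟨t + x.1, by linarith, by linarith⟩, ?_⟩
        simp only [straightPath_apply, I, Prod.mk.injEq, h0]
        constructor
        · linear_combination ht.1
        · linear_combination ht.2
    · constructor
      · rintro ⟨r, hr⟩
        simp only [straightPath_apply, I, Prod.mk.injEq] at hr
        have : x.1 * Δ = 0 := by
          rw [hΔdef]
          linear_combination -(d.2 - c.2) * hr.1 + (d.1 - c.1) * hr.2 + (d.2 - c.2) * hu.1 -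
            (d.1 - c.1) * hu.2
        exact (mul_eq_zero.1 this).resolve_right hΔ
      · intro h0
        refine ⟨⟨u + x.2, by linarith, by linarith⟩, ?_⟩
        simp only [straightPath_apply, I, Prod.mk.injEq, h0]
        constructor
        · linear_combination hu.1
        · linear_combination hu.2

section Straight

variable {V : Type*} (G : SimpleGraph V) {pos : V → ℝ × ℝ} (hinj : Function.Injective pos)
  (hcol : NoThreeCollinear pos)

/-- Parallel segments with a common point lie on one line, which would contain three distinct
vertices. -/
theorem straightLayout_det_ne_zero {e f : G.edgeSet} (hef : e ≠ f) {p : ℝ × ℝ}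
    (hp : p ∉ Set.range pos) (he : p ∈ Set.range ((straightLayout G hinj hcol).arc e))
    (hf : p ∈ Set.range ((straightLayout G hinj hcol).arc f)) :
    ((pos (Quot.out (e : Sym2 V)).2).1 - (pos (Quot.out (e : Sym2 V)).1).1) *
      ((pos (Quot.out (f : Sym2 V)).2).2 - (pos (Quot.out (f : Sym2 V)).1).2) -
    ((pos (Quot.out (e : Sym2 V)).2).2 - (pos (Quot.out (e : Sym2 V)).1).2) *
      ((pos (Quot.out (f : Sym2 V)).2).1 - (pos (Quot.out (f : Sym2 V)).1).1) ≠ 0 := by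
  have hmem := fun v => straightLayout_not_mem G hinj hcol hef hp he hf (v := v)
  obtain ⟨t, ht⟩ := he
  obtain ⟨u, hu⟩ := hf
  change straightPath _ _ t = p at ht
  change straightPath _ _ u = p at hu
  have h1 := hcol (Quot.out (e : Sym2 V)).1 (Quot.out (e : Sym2 V)).2 (Quot.out (f : Sym2 V)).1
    (out_fst_ne_snd G e) (fun h => hmem _ (Sym2.out_fst_mem _) (h ▸ Sym2.out_fst_mem _))
    (fun h => hmem _ (Sym2.out_snd_mem _) (h ▸ Sym2.out_fst_mem _))
  intro h0
  apply h1
  rw [← hu] at ht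
  simp only [straightPath_apply, Prod.mk.injEq] at ht
  simp only [orient]
  linear_combination -(u : ℝ) * h0 +
    ((pos (Quot.out (e : Sym2 V)).2).2 - (pos (Quot.out (e : Sym2 V)).1).2) * ht.1 -
    ((pos (Quot.out (e : Sym2 V)).2).1 - (pos (Quot.out (e : Sym2 V)).1).1) * ht.2

theorem straightLayout_crossing_unique {e f : G.edgeSet} (hef : e ≠ f) {p p' : ℝ × ℝ}
    (hp : p ∉ Set.range pos) (he : p ∈ Set.range ((straightLayout G hinj hcol).arc e))
    (hf : p ∈ Set.range ((straightLayout G hinj hcol).arc f))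
    (he' : p' ∈ Set.range ((straightLayout G hinj hcol).arc e))
    (hf' : p' ∈ Set.range ((straightLayout G hinj hcol).arc f)) : p = p' := by
  have hΔ := straightLayout_det_ne_zero G hinj hcol hef hp he hf
  have ho : ∀ e : G.edgeSet, (e : Sym2 V) =
      s((Quot.out (e : Sym2 V)).1, (Quot.out (e : Sym2 V)).2) := fun e =>
    (Quot.out_eq (e : Sym2 V)).symm
  have h1 := straightLayout_orient G hinj hcol e (ho e) he
  have h2 := straightLayout_orient G hinj hcol f (ho f) hf
  have h3 := straightLayout_orient G hinj hcol e (ho e) he'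
  have h4 := straightLayout_orient G hinj hcol f (ho f) hf'
  generalize pos (Quot.out (e : Sym2 V)).1 = a at *
  generalize pos (Quot.out (e : Sym2 V)).2 = b at *
  generalize pos (Quot.out (f : Sym2 V)).1 = c at *
  generalize pos (Quot.out (f : Sym2 V)).2 = d at *
  simp only [orient] at h1 h2 h3 h4
  have hx : (p.1 - p'.1) * ((b.1 - a.1) * (d.2 - c.2) - (b.2 - a.2) * (d.1 - c.1)) = 0 := by
    linear_combination (d.1 - c.1) * h1 - (b.1 - a.1) * h2 - (d.1 - c.1) * h3 + (b.1 - a.1) * h4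
  have hy : (p.2 - p'.2) * ((b.1 - a.1) * (d.2 - c.2) - (b.2 - a.2) * (d.1 - c.1)) = 0 := by
    linear_combination (d.2 - c.2) * h1 - (b.2 - a.2) * h2 - (d.2 - c.2) * h3 + (b.2 - a.2) * h4
  ext
  · linarith [(mul_eq_zero.1 hx).resolve_right hΔ]
  · linarith [(mul_eq_zero.1 hy).resolve_right hΔ]

/-- A crossing of a straight-line layout is determined by two edges through it. -/
theorem exists_crossing_code : ∃ code : (straightLayout G hinj hcol).crossings →
    G.edgeSet × G.edgeSet, Function.Injective code := by
  have h : ∀ c : (straightLayout G hinj hcol).crossings, ∃ k : G.edgeSet × G.edgeSet, k.1 ≠ k.2 ∧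
      (c : ℝ × ℝ) ∈ Set.range ((straightLayout G hinj hcol).arc k.1) ∧
      (c : ℝ × ℝ) ∈ Set.range ((straightLayout G hinj hcol).arc k.2) := by
    rintro ⟨p, hp, e, f, h⟩
    exact ⟨(e, f), h⟩
  choose code hne h1 h2 using h
  refine ⟨code, fun c c' hcc' => Subtype.ext ?_⟩
  exact straightLayout_crossing_unique G hinj hcol (hne c) c.2.1 (h1 c) (h2 c)
    (hcc' ▸ h1 c') (hcc' ▸ h2 c')

/-- The straight-line drawing of a finite graph with vertices in general position. -/
noncomputable def straightDrawing [Finite V] (hcon : NoThreeConcurrent pos) : Drawing G where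
  toPlaneLayout := straightLayout G hinj hcol
  finite_crossings := by
    obtain ⟨code, hcode⟩ := exists_crossing_code G hinj hcol
    exact Set.finite_coe_iff.1 (Finite.of_injective code hcode)
  no_triple := by
    intro p hp e f g he hf hg
    by_contra! h
    obtain ⟨hef, heg, hfg⟩ := h
    have ho : ∀ e : G.edgeSet, (e : Sym2 V) =
        s((Quot.out (e : Sym2 V)).1, (Quot.out (e : Sym2 V)).2) := fun e =>
      (Quot.out_eq (e : Sym2 V)).symm
    have hne : ∀ {e f : G.edgeSet}, e ≠ f → p ∈ Set.range ((straightLayout G hinj hcol).arc e) →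
        p ∈ Set.range ((straightLayout G hinj hcol).arc f) → ∀ {v w}, v ∈ (e : Sym2 V) →
        w ∈ (f : Sym2 V) → v ≠ w := by
      rintro e f hef he hf v _ hv hw rfl
      exact straightLayout_not_mem G hinj hcol hef hp.1 he hf hv hw
    have h1 : ∀ e : G.edgeSet, (Quot.out (e : Sym2 V)).1 ∈ (e : Sym2 V) :=
      fun e => Sym2.out_fst_mem _
    have h2 : ∀ e : G.edgeSet, (Quot.out (e : Sym2 V)).2 ∈ (e : Sym2 V) :=
      fun e => Sym2.out_snd_mem _
    refine hcon ![(Quot.out (e : Sym2 V)).1, (Quot.out (e : Sym2 V)).2, (Quot.out (f : Sym2 V)).1,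
      (Quot.out (f : Sym2 V)).2, (Quot.out (g : Sym2 V)).1, (Quot.out (g : Sym2 V)).2] ?_
      (lineDet_eq_zero _ p (straightLayout_orient G hinj hcol e (ho e) he)
        (straightLayout_orient G hinj hcol f (ho f) hf)
        (straightLayout_orient G hinj hcol g (ho g) hg))
    rw [← List.nodup_ofFn]
    have a1 := out_fst_ne_snd G e
    have a2 := out_fst_ne_snd G f
    have a3 := out_fst_ne_snd G g
    simp [a1, a2, a3, hne hef he hf (h1 e) (h1 f), hne hef he hf (h1 e) (h2 f),
      hne hef he hf (h2 e) (h1 f), hne hef he hf (h2 e) (h2 f), hne heg he hg (h1 e) (h1 g),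
      hne heg he hg (h1 e) (h2 g), hne heg he hg (h2 e) (h1 g), hne heg he hg (h2 e) (h2 g),
      hne hfg hf hg (h1 f) (h1 g), hne hfg hf hg (h1 f) (h2 g), hne hfg hf hg (h2 f) (h1 g),
      hne hfg hf hg (h2 f) (h2 g)]
  proper := by
    intro p hp e f hef he hf
    have hΔ := straightLayout_det_ne_zero G hinj hcol hef hp.1 he hf
    have hends : ∀ e : G.edgeSet, ∀ t, (straightLayout G hinj hcol).arc e t = p →
        t ≠ 0 ∧ t ≠ 1 := by
      rintro e t ht
      constructor
      · rintro rfl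
        rw [Path.source] at ht
        exact hp.1 ⟨_, ht⟩
      · rintro rfl
        rw [Path.target] at ht
        exact hp.1 ⟨_, ht⟩
    obtain ⟨t, ht⟩ := he
    obtain ⟨u, hu⟩ := hf
    exact exists_chart_straightPath ht hu (hends e t ht).1 (hends e t ht).2 (hends f u hu).1
      (hends f u hu).2 hΔ

theorem exists_drawing [Finite V] : ∃ D : Drawing G,
    Nat.card D.crossings ≤ G.edgeSet.ncard ^ 2 := by
  obtain ⟨pos, hinj, hcol, hcon⟩ := exists_generalPosition V
  refine ⟨straightDrawing G hinj hcol hcon, ?_⟩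
  obtain ⟨code, hcode⟩ := exists_crossing_code G hinj hcol
  have := Nat.card_le_card_of_injective code hcode
  rwa [Nat.card_prod, Nat.card_coe_set_eq G.edgeSet, ← sq] at this

end Straight

/-! ### Counting the edges after replacing the crossings -/

theorem PlaneLayout.IsLink.unique {V : Type*} {G : SimpleGraph V} {L : PlaneLayout G}
    {first : L.crossings → G.edgeSet} {e : G.edgeSet} {s s' t : unitInterval}
    {x y x' y' : V ⊕ L.crossings × Fin 22} (h : L.IsLink first e s t x y)
    (h' : L.IsLink first e s' t x' y') : x = x' ∧ y = y' := by
  rcases h.eq_or_separated h' with ⟨rfl, -⟩ | hle | hle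
  · exact ⟨h.2.2.1.unique h'.2.2.1, h.2.2.2.unique h'.2.2.2⟩
  · exact absurd h'.1 (not_lt.2 hle)
  · exact absurd h.1 (not_lt.2 hle)

theorem Drawing.ncard_edgeSet_replaceCrossings_le {V : Type*} [Finite V] {G : SimpleGraph V}
    (D : Drawing G) (first : D.crossings → G.edgeSet)
    (hfirst : ∀ c, (c : ℝ × ℝ) ∈ Set.range (D.arc (first c))) (H : SimpleGraph (Fin 22)) :
    (D.replaceCrossings first H).edgeSet.ncard ≤
      G.edgeSet.ncard + 486 * Nat.card D.crossings := by
  classical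
  have : Finite D.crossings := D.finite_crossings
  -- A link is determined by where it arrives: the head of an edge, or one of two terminals at a
  -- crossing. Gadget edges are coded by a crossing and a pair of vertices, so each crossing
  -- accounts for at most `2 + 22 ^ 2 = 486` edges.
  let R : G.edgeSet ⊕ D.crossings × Bool ⊕ D.crossings × Fin 22 × Fin 22 →
      Sym2 (V ⊕ D.crossings × Fin 22) → Prop := fun k z =>
    match k with
    | Sum.inl e => ∃ s x y, D.IsLink first e s 1 x y ∧ z = s(x, y)
    | Sum.inr (Sum.inl (c, b)) => ∃ e s t x y, D.IsLink first e s t x y ∧ D.arc e t = c ∧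
        b = decide (first c = e) ∧ z = s(x, y)
    | Sum.inr (Sum.inr (c, i, j)) => z = s(Sum.inr (c, i), Sum.inr (c, j))
  have hex : ∀ z : (D.replaceCrossings first H).edgeSet, ∃ k, R k z := by
    have key : ∀ x y, ((∃ c i j, H.Adj i j ∧ x = Sum.inr (c, i) ∧ y = Sum.inr (c, j)) ∨
        ∃ e s t, D.IsLink first e s t x y) → ∃ k, R k s(x, y) := by
      rintro x y (⟨c, i, j, -, rfl, rfl⟩ | ⟨e, s, t, hl⟩)
      · exact ⟨Sum.inr (Sum.inr (c, i, j)), rfl⟩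
      · by_cases ht : t = 1
        · subst ht
          exact ⟨Sum.inl e, s, x, y, hl, rfl⟩
        · exact ⟨Sum.inr (Sum.inl (⟨_, hl.2.2.2.mem_crossings ht⟩, _)), e, s, t, x, y, hl, rfl,
            rfl, rfl⟩
    rintro ⟨z, hz⟩
    induction z using Sym2.ind with
    | _ x y =>
      rw [SimpleGraph.mem_edgeSet, PlaneLayout.replaceCrossings, SimpleGraph.fromRel_adj] at hz
      rcases hz.2 with h | h
      · exact key x y h
      · obtain ⟨k, hk⟩ := key y x h
        rw [Sym2.eq_swap] at hk
        exact ⟨k, hk⟩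
  have huniq : ∀ k z z', R k z → R k z' → z = z' := by
    rintro (e | ⟨c, b⟩ | ⟨c, i, j⟩) z z' h h'
    · obtain ⟨s, x, y, hl, rfl⟩ := h
      obtain ⟨s', x', y', hl', rfl⟩ := h'
      obtain ⟨rfl, rfl⟩ := hl.unique hl'
      rfl
    · obtain ⟨e, s, t, x, y, hl, hc, rfl, rfl⟩ := h
      obtain ⟨e', s', t', x', y', hl', hc', hb, rfl⟩ := h'
      have hee : e = e' := by
        by_cases he : first c = e
        · rw [← he]
          simpa [he] using hb
        · refine D.eq_of_ne_first first hfirst (c := c) ⟨t, hc⟩ ⟨t', hc'⟩ he ?_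
          simpa [he] using hb
      subst hee
      obtain rfl : t = t' := D.arc_injective e (hc.trans hc'.symm)
      obtain ⟨rfl, rfl⟩ := hl.unique hl'
      rfl
    · exact h.trans h'.symm
  choose code hcode using hex
  have hinj : Function.Injective code := fun z z' h =>
    Subtype.ext (huniq _ _ _ (hcode z) (h ▸ hcode z'))
  have := Nat.card_le_card_of_injective code hinj
  rw [Nat.card_coe_set_eq, Nat.card_sum, Nat.card_sum, Nat.card_prod, Nat.card_prod, Nat.card_prod,
    Nat.card_coe_set_eq] at this
  simp only [Nat.card_eq_fintype_card, Fintype.card_bool, Fintype.card_fin] at this ⊢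
  omega

/-! ### The complete graph with every edge subdivided twice -/

/-- The complete graph on the vertices `(i, i)` with the edge between `(i, i)` and `(j, j)` replaced
by the path `(i, i)`, `(i, j)`, `(j, i)`, `(j, j)`. -/
def subdividedComplete (m : ℕ) : SimpleGraph (Fin m × Fin m) :=
  SimpleGraph.fromRel fun x y => (x.1 = x.2 ∧ y.1 = x.1) ∨ y = x.swap

theorem ncard_edgeSet_subdividedComplete_le (m : ℕ) :
    (subdividedComplete m).edgeSet.ncard ≤ 2 * m ^ 2 := by
  let f : (Fin m × Fin m) × Bool → Sym2 (Fin m × Fin m) := fun p =>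
    if p.2 then s((p.1.1, p.1.1), p.1) else s(p.1, p.1.swap)
  have hsub : (subdividedComplete m).edgeSet ⊆ f '' Set.univ := by
    have key : ∀ x y : Fin m × Fin m, (x.1 = x.2 ∧ y.1 = x.1) ∨ y = x.swap →
        s(x, y) ∈ f '' Set.univ := by
      rintro ⟨i, j⟩ ⟨k, l⟩ (⟨h1, h2⟩ | h)
      · simp only at h1 h2
        subst h1 h2
        exact ⟨((k, l), true), trivial, rfl⟩
      · rw [h]
        exact ⟨((i, j), false), trivial, rfl⟩
    intro z hz
    induction z using Sym2.ind with
    | _ x y =>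
      rw [SimpleGraph.mem_edgeSet, subdividedComplete, SimpleGraph.fromRel_adj] at hz
      rcases hz.2 with h | h
      · exact key x y h
      · rw [Sym2.eq_swap]
        exact key y x h
  refine (Set.ncard_le_ncard hsub (Set.toFinite _)).trans ((Set.ncard_image_le Set.finite_univ).trans ?_)
  rw [Set.ncard_univ, Nat.card_eq_fintype_card]
  simp only [Fintype.card_prod, Fintype.card_fin, Fintype.card_bool]
  exact le_of_eq (by ring)

/-- The functional of the inequality for a set of vertices. -/
def pairFunctional {m : ℕ} (a : Finset (Fin m)) : (Fin m × Fin m → ℝ) →ₗ[ℝ] ℝ :=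
  let coord : Fin m × Fin m → (Fin m × Fin m → ℝ) →ₗ[ℝ] ℝ := LinearMap.proj
  ∑ i ∈ a, coord (i, i) + ∑ p ∈ a.offDiag, (coord p + coord p.swap)

theorem pairFunctional_apply {m : ℕ} (a : Finset (Fin m)) (x : Fin m × Fin m → ℝ) :
    pairFunctional a x = ∑ i ∈ a, x (i, i) + ∑ p ∈ a.offDiag, (x p + x p.swap) := by
  simp [pairFunctional]

/-- The sum over the square factors, and on the diagonal idempotence makes the correction linear in
`u`. -/
theorem sum_offDiag_one_sub_mul {ι : Type*} [DecidableEq ι] (a : Finset ι) (u : ι → ℝ)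
    (hu : ∀ i ∈ a, u i * u i = u i) : ∑ p ∈ a.offDiag, (1 - u p.1 * u p.2) =
      (a.card : ℝ) ^ 2 - a.card - ((∑ i ∈ a, u i) ^ 2 - ∑ i ∈ a, u i) := by
  have h : ∑ p ∈ a.diag, (1 - u p.1 * u p.2) + ∑ p ∈ a.offDiag, (1 - u p.1 * u p.2) =
      ∑ p ∈ a ×ˢ a, (1 - u p.1 * u p.2) := by
    rw [← Finset.sum_union (Finset.disjoint_diag_offDiag a), Finset.diag_union_offDiag]
  have h1 : ∑ p ∈ a.diag, (1 - u p.1 * u p.2) = a.card - ∑ i ∈ a, u i := by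
    rw [Finset.sum_diag, Finset.sum_sub_distrib, Finset.sum_congr rfl hu]
    simp
  have h2 : ∑ p ∈ a ×ˢ a, (1 - u p.1 * u p.2) = (a.card : ℝ) ^ 2 - (∑ i ∈ a, u i) ^ 2 := by
    rw [Finset.sum_sub_distrib, Finset.sum_product, Finset.sum_product, sq (∑ i ∈ a, u i),
      Finset.sum_mul_sum]
    simp [sq]
  rw [h1, h2] at h
  linarith

/-- On the path between two branch vertices, a stable set contains at most one inner vertex, and
none if it contains both ends. Summing over ordered pairs bounds the functional by the right side
minus `(s - 1) ^ 2`, where `s` is the number of branch vertices of `a` in the stable set. -/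
theorem pairFunctional_le {m : ℕ} (a : Finset (Fin m)) {x : Fin m × Fin m → ℝ}
    (hx : x ∈ stab (subdividedComplete m)) :
    pairFunctional a x ≤ 1 + ((a.card : ℝ) ^ 2 - a.card) := by
  classical
  refine le_of_mem_convexHull _ ?_ hx
  rintro _ ⟨S, hS, rfl⟩
  rw [pairFunctional_apply]
  have hpair : ∀ p ∈ a.offDiag, S.indicator (1 : Fin m × Fin m → ℝ) p + S.indicator 1 p.swap ≤
      1 - S.indicator (1 : Fin m × Fin m → ℝ) (p.1, p.1) * S.indicator 1 (p.2, p.2) := by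
    rintro ⟨i, j⟩ hp
    have hij : i ≠ j := (Finset.mem_offDiag.1 hp).2.2
    have h1 : (i, j) ∈ S → (j, i) ∉ S := fun h h' => by
      refine hS h h' (by simp [hij]) ?_
      rw [subdividedComplete, SimpleGraph.fromRel_adj]
      exact ⟨by simp [hij], Or.inl (Or.inr rfl)⟩
    have h2 : (i, j) ∈ S → (i, i) ∉ S := fun h h' => by
      refine hS h' h (by simp [hij]) ?_
      rw [subdividedComplete, SimpleGraph.fromRel_adj]
      exact ⟨by simp [hij], Or.inl (Or.inl ⟨rfl, rfl⟩)⟩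
    have h3 : (j, i) ∈ S → (j, j) ∉ S := fun h h' => by
      refine hS h' h (by simp [hij.symm]) ?_
      rw [subdividedComplete, SimpleGraph.fromRel_adj]
      exact ⟨by simp [hij.symm], Or.inl (Or.inl ⟨rfl, rfl⟩)⟩
    simp only [Set.indicator_apply, Prod.swap_prod_mk, Pi.one_apply]
    by_cases q1 : (i, j) ∈ S <;> by_cases q2 : (j, i) ∈ S <;> by_cases q3 : (i, i) ∈ S <;>
      by_cases q4 : (j, j) ∈ S <;> simp_all
  have hsum := Finset.sum_le_sum hpair
  rw [sum_offDiag_one_sub_mul a (fun i => S.indicator (1 : Fin m × Fin m → ℝ) (i, i)) (fun i _ => by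
    simp only [Set.indicator_apply]
    split_ifs <;> simp)] at hsum
  nlinarith [sq_nonneg (∑ i ∈ a, S.indicator (1 : Fin m × Fin m → ℝ) (i, i) - 1)]

/-- The stable set encoding a set of vertices. -/
def pairStableSet {m : ℕ} (b : Finset (Fin m)) : Set (Fin m × Fin m) :=
  {p | (p.1 = p.2 ∧ p.1 ∈ b) ∨ (p.1 ≠ p.2 ∧ p.1 ∉ b ∧ (p.2 ∈ b ∨ p.1 < p.2))}

theorem pairStableSet_isIndepSet {m : ℕ} (b : Finset (Fin m)) :
    (subdividedComplete m).IsIndepSet (pairStableSet b) := by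
  have key : ∀ x ∈ pairStableSet b, ∀ y ∈ pairStableSet b, x ≠ y →
      ¬ ((x.1 = x.2 ∧ y.1 = x.1) ∨ y = x.swap) := by
    rintro ⟨i, j⟩ hx ⟨k, l⟩ hy hne h
    simp only [pairStableSet, Set.mem_ofPred_eq, Prod.swap_prod_mk, Prod.mk.injEq, ne_eq] at *
    have := @lt_asymm (Fin m) _ i j
    rcases h with ⟨rfl, rfl⟩ | ⟨rfl, rfl⟩ <;> tauto
  intro x hx y hy hne hxy
  rw [subdividedComplete, SimpleGraph.fromRel_adj] at hxy
  rcases hxy.2 with h | h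
  · exact key x hx y hy hne h
  · exact key y hy x hx hne.symm h

/-- The stable set of `b` has an inner vertex on every path except those with both ends in `b`, so
each pair inequality is tight and the slack is exactly `((a ∩ b).card - 1) ^ 2`. -/
theorem pairFunctional_pairStableSet {m : ℕ} (a b : Finset (Fin m)) :
    pairFunctional a ((pairStableSet b).indicator 1) = 1 + ((a.card : ℝ) ^ 2 - a.card) ↔
      (a ∩ b).card = 1 := by
  classical
  have hdiag : ∀ i, (pairStableSet b).indicator (1 : Fin m × Fin m → ℝ) (i, i) = if i ∈ b then 1 else 0 := by
    intro i
    simp [Set.indicator_apply, pairStableSet]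
  have hpair : ∀ p ∈ a.offDiag, (pairStableSet b).indicator (1 : Fin m × Fin m → ℝ) p +
      (pairStableSet b).indicator 1 p.swap =
      1 - (pairStableSet b).indicator (1 : Fin m × Fin m → ℝ) (p.1, p.1) *
        (pairStableSet b).indicator 1 (p.2, p.2) := by
    rintro ⟨i, j⟩ hp
    have hij : i ≠ j := (Finset.mem_offDiag.1 hp).2.2
    rw [hdiag, hdiag]
    simp only [Set.indicator_apply, pairStableSet, Set.mem_ofPred_eq, Prod.swap_prod_mk,
      Pi.one_apply]
    by_cases hi : i ∈ b <;> by_cases hj : j ∈ b <;> rcases lt_or_gt_of_ne hij with h | h <;>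
      simp [hi, hj, hij, hij.symm, h, h.le]
  have hcard : ∑ i ∈ a, (pairStableSet b).indicator (1 : Fin m × Fin m → ℝ) (i, i) = (a ∩ b).card := by
    simp only [hdiag]
    rw [Finset.sum_ite_mem]
    simp
  rw [pairFunctional_apply, Finset.sum_congr rfl hpair,
    sum_offDiag_one_sub_mul a (fun i => (pairStableSet b).indicator (1 : Fin m × Fin m → ℝ) (i, i))
      (fun i _ => by rw [hdiag]; split_ifs <;> simp), hcard]
  constructor
  · intro h
    have h1 : ((a ∩ b).card - 1 : ℝ) ^ 2 = 0 := by linarith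
    have h2 : ((a ∩ b).card : ℝ) = 1 := by linarith [pow_eq_zero_iff (two_ne_zero) |>.1 h1]
    exact_mod_cast h2
  · intro h
    rw [h]
    norm_num

/-! ### Relabelling the vertices -/

theorem IsPlanar.comap {V W : Type*} {G : SimpleGraph V} (h : IsPlanar G) (e : W ≃ V) :
    IsPlanar (G.comap e) := by
  obtain ⟨L, hL⟩ := h
  refine isPlanar_of_arcs _ (L.pos_injective.comp e.injective)
    (fun x y γ => ∃ k, L.tail k = e x ∧ L.head k = e y ∧ γ = L.arc k) ?_ ?_ ?_
  · rintro x y _ ⟨k, hx, hy, rfl⟩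
    refine ⟨(L.arc k).continuous, L.arc_injective k, ?_, ?_, fun t v h => L.arc_vertex k t _ h⟩
    · rw [Path.source, hx]
      rfl
    · rw [Path.target, hy]
      rfl
  · rintro x y _ x' y' _ ⟨k, hx, hy, rfl⟩ ⟨k', hx', hy', rfl⟩ hne t t' htt'
    have hkk' : k ≠ k' := by
      rintro rfl
      exact hne (by rw [e.injective (hx.symm.trans hx'), e.injective (hy.symm.trans hy')])
    by_contra hnot
    have : L.arc k t ∈ L.crossings := by
      refine ⟨fun h => hnot ?_, k, k', hkk', ⟨t, rfl⟩, ⟨t', htt'.symm⟩⟩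
      obtain ⟨v, hv⟩ := h
      exact ⟨e.symm v, by simp [hv]⟩
    rw [hL] at this
    exact this
  · intro x y hxy
    have hends := L.ends ⟨s(e x, e y), hxy⟩
    rcases Sym2.eq_iff.1 hends with ⟨h1, h2⟩ | ⟨h1, h2⟩
    · exact Or.inl ⟨_, _, h1, h2, rfl⟩
    · exact Or.inr ⟨_, _, h1, h2, rfl⟩

theorem isPolytope_stab {N : ℕ} (G : SimpleGraph (Fin N)) : IsPolytope (stab G) := by
  refine ⟨_, (Set.finite_range fun S : Set (Fin N) => S.indicator (1 : Fin N → ℝ)).subset ?_, rfl⟩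
  rintro _ ⟨S, -, rfl⟩
  exact ⟨S, rfl⟩

theorem stab_comap {V W : Type*} (G : SimpleGraph V) (e : W ≃ V) :
    stab (G.comap e) = LinearMap.funLeft ℝ ℝ e '' stab G := by
  classical
  rw [stab, stab, LinearMap.image_convexHull]
  congr 1
  ext x
  constructor
  · rintro ⟨S, hS, rfl⟩
    refine ⟨_, ⟨e.symm ⁻¹' S, ?_, rfl⟩, ?_⟩
    · intro u hu v hv huv hadj
      exact hS hu hv (e.symm.injective.ne huv) (by simpa using hadj)
    · ext w
      rw [LinearMap.funLeft_apply, Set.indicator_apply, Set.indicator_apply]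
      simp
  · rintro ⟨_, ⟨S, hS, rfl⟩, rfl⟩
    refine ⟨e ⁻¹' S, ?_, ?_⟩
    · intro u hu v hv huv hadj
      exact hS hu hv (e.injective.ne huv) hadj
    · ext w
      rw [LinearMap.funLeft_apply, Set.indicator_apply, Set.indicator_apply]
      simp

/-- The lower bound on the extension complexity for a graph with a face of its stable set polytope
that projects to the stable set polytope of the subdivided complete graph. -/
theorem three_pow_le_xc_stab {m N : ℕ} {V : Type*} [Finite V] {G : SimpleGraph V} (e : Fin N ≃ V)
    {F : Set (V → ℝ)} (hF : IsExposed ℝ (stab G) F) (π : (V → ℝ) →ₗ[ℝ] (Fin m × Fin m → ℝ))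
    (hπ : π '' F = stab (subdividedComplete m)) :
    3 ^ m ≤ (xc (stab (G.comap e)) + 1) * 2 ^ m := by
  have hpt : ∀ b : Finset (Fin m), ∃ x ∈ F, π x = (pairStableSet b).indicator 1 := fun b => by
    have : (pairStableSet b).indicator (1 : Fin m × Fin m → ℝ) ∈ stab (subdividedComplete m) :=
      subset_convexHull ℝ _ ⟨_, pairStableSet_isIndepSet b, rfl⟩
    rwa [← hπ] at this
  choose pt hptF hptπ using hpt
  obtain ⟨l, β, hle, hFeq⟩ := hF.exists_eq_sep ⟨_, hptF ∅⟩
  let T : (Fin N → ℝ) →ₗ[ℝ] (V → ℝ) := LinearMap.funLeft ℝ ℝ e.symm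
  let T' : (V → ℝ) →ₗ[ℝ] (Fin N → ℝ) := LinearMap.funLeft ℝ ℝ e
  have hTT' : ∀ x, T (T' x) = x := fun x => by
    ext v
    simp [T, T', LinearMap.funLeft_apply]
  have hstab : ∀ y ∈ stab (G.comap e), T y ∈ stab G := by
    intro y hy
    rw [stab_comap] at hy
    obtain ⟨x, hx, rfl⟩ := hy
    change T (T' x) ∈ _
    rwa [hTT']
  have hF' : ∀ y ∈ {y ∈ stab (G.comap e) | (l ∘ₗ T) y = β}, T y ∈ F := fun y hy => by
    rw [hFeq]
    exact ⟨hstab y hy.1, hy.2⟩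
  refine three_pow_le_xc (isPolytope_stab _)
    (isExposed_sep_eq (l ∘ₗ T) β fun y hy => hle _ (hstab y hy))
    (fun a => pairFunctional a ∘ₗ π ∘ₗ T) (fun a => 1 + ((a.card : ℝ) ^ 2 - a.card))
    (fun a y hy => pairFunctional_le a (hπ ▸ Set.mem_image_of_mem π (hF' y hy)))
    (fun b => T' (pt b)) (fun b => ⟨?_, ?_⟩) fun a b => ?_
  · rw [stab_comap]
    have := hptF b
    rw [hFeq] at this
    exact Set.mem_image_of_mem _ this.1
  · have := hptF b
    rw [hFeq] at this
    rw [LinearMap.comp_apply, hTT']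
    exact this.2
  · rw [LinearMap.comp_apply, LinearMap.comp_apply, hTT', hptπ]
    exact pairFunctional_pairStableSet a b

/-- At most `2 * m ^ 2` edges give at most `4 * m ^ 4` crossings, each contributing 22 vertices and
at most 486 edges. -/
theorem exists_planar_three_pow_le_xc (m : ℕ) : ∃ (N : ℕ) (G : SimpleGraph (Fin N)), IsPlanar G ∧
    N ≤ m ^ 2 + 88 * m ^ 4 ∧ G.edgeSet.ncard ≤ 2 * m ^ 2 + 1944 * m ^ 4 ∧
    3 ^ m ≤ (xc (stab G) + 1) * 2 ^ m := by
  obtain ⟨D, hD⟩ := exists_drawing (subdividedComplete m)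
  have hE := ncard_edgeSet_subdividedComplete_le m
  have hfin : Finite D.crossings := D.finite_crossings
  have hX : Nat.card D.crossings ≤ 4 * m ^ 4 := by
    refine hD.trans ((Nat.pow_le_pow_left hE 2).trans (le_of_eq (by ring)))
  have hfirst : ∀ c : D.crossings, ∃ e, (c : ℝ × ℝ) ∈ Set.range (D.arc e) := by
    rintro ⟨p, -, e, -, -, he, -⟩
    exact ⟨e, he⟩
  choose first hfirst using hfirst
  set G' := D.replaceCrossings first crossoverGadget
  obtain ⟨F, hF, hπ⟩ := D.exists_face_replaceCrossings first hfirst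
    isCrossoverGadget_crossoverGadget
  have e : Fin (Nat.card ((Fin m × Fin m) ⊕ D.crossings × Fin 22)) ≃
      (Fin m × Fin m) ⊕ D.crossings × Fin 22 := (Finite.equivFin _).symm
  refine ⟨_, G'.comap e,
    (isPlanar_replaceCrossings D first hfirst isCrossoverGadget_crossoverGadget).comap e, ?_, ?_,
    three_pow_le_xc_stab e hF (LinearMap.funLeft ℝ ℝ Sum.inl) hπ⟩
  · rw [Nat.card_sum, Nat.card_prod, Nat.card_prod]
    simp only [Nat.card_eq_fintype_card (α := Fin _), Fintype.card_fin]
    rw [← sq]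
    omega
  · have h1 : (G'.comap e).edgeSet.ncard ≤ G'.edgeSet.ncard := by
      rw [← Nat.card_coe_set_eq, ← Nat.card_coe_set_eq]
      exact (Nat.card_congr (SimpleGraph.Iso.mapEdgeSet (SimpleGraph.Iso.comap e G'))).le
    have h2 := D.ncard_edgeSet_replaceCrossings_le first hfirst crossoverGadget
    change G'.edgeSet.ncard ≤ _ at h2
    omega

/-- The surplus `2` in the exponent yields a factor `9 / 4`, which absorbs the `+ 1` next to `k`.
The remaining `(3 / 2) ^ r` is large enough because `√2 ≤ 3 / 2` and `√n ≤ 2 * r`. -/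
theorem two_rpow_le_of_three_pow_le {n k : ℕ} (hn : 1 ≤ n)
    (h : 3 ^ (n.sqrt + 2) ≤ (k + 1) * 2 ^ (n.sqrt + 2)) :
    (2 : ℝ) ^ ((1 / 4 : ℝ) * √(n : ℝ)) ≤ k := by
  set r := n.sqrt
  have hr1 : 1 ≤ r := Nat.le_sqrt'.2 (by simpa using hn)
  have hsqrt : √(n : ℝ) ≤ 2 * r := by
    have h1 : √(n : ℝ) ≤ r + 1 := Real.sqrt_le_iff.2 ⟨by positivity, by
      have : n ≤ (r + 1) ^ 2 := (Nat.sqrt_lt'.1 (Nat.lt_succ_self _)).le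
      exact_mod_cast this⟩
    have h2 : (1 : ℝ) ≤ r := by exact_mod_cast hr1
    linarith
  have h1 : (2 : ℝ) ^ ((1 / 4 : ℝ) * √(n : ℝ)) ≤ (3 / 2 : ℝ) ^ r := by
    calc (2 : ℝ) ^ ((1 / 4 : ℝ) * √(n : ℝ)) ≤ (2 : ℝ) ^ ((1 / 2 : ℝ) * r) :=
          Real.rpow_le_rpow_of_exponent_le (by norm_num) (by linarith)
      _ = ((2 : ℝ) ^ (1 / 2 : ℝ)) ^ r := by
          rw [Real.rpow_mul (by norm_num), Real.rpow_natCast]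
      _ ≤ (3 / 2 : ℝ) ^ r := by
          refine pow_le_pow_left₀ (by positivity) ?_ r
          rw [← Real.sqrt_eq_rpow]
          exact Real.sqrt_le_iff.2 ⟨by norm_num, by norm_num⟩
  have h2 : (3 : ℝ) ^ (r + 2) ≤ (k + 1) * 2 ^ (r + 2) := by exact_mod_cast h
  have h3 : (3 / 2 : ℝ) ^ (r + 2) ≤ k + 1 := by
    rw [div_pow, div_le_iff₀ (by positivity)]
    exact h2
  have h4 : (1 : ℝ) ≤ (3 / 2 : ℝ) ^ r := one_le_pow₀ (by norm_num)
  rw [pow_add] at h3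
  linarith

theorem mainTheorem10 :
    -- the explicit graph on 22 vertices is a crossover gadget
    IsCrossoverGadget crossoverGadget ∧
    -- replacing the crossings of a drawing of `G` by a crossover gadget gives a planar graph `G'`
    -- such that `STAB(G)` is the coordinate projection of a face of `STAB(G')`
    (∀ H : SimpleGraph (Fin 22), IsCrossoverGadget H →
      ∀ (V : Type*) [Fintype V] (G : SimpleGraph V) (D : Drawing G)
        (first : D.crossings → G.edgeSet), (∀ c, (c : ℝ × ℝ) ∈ Set.range (D.arc (first c))) →
          IsPlanar (D.replaceCrossings first H) ∧
          ∃ F : Set (V ⊕ D.crossings × Fin 22 → ℝ),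
            IsExposed ℝ (stab (D.replaceCrossings first H)) F ∧
            (fun x v => x (Sum.inl v)) '' F = stab G) ∧
    -- planar graphs with `O(n²)` vertices and edges and extension complexity `2^Ω(√n)`
    (∃ (C : ℕ) (c : ℝ), 0 < c ∧ ∀ n : ℕ, 1 ≤ n →
      ∃ (m : ℕ) (G : SimpleGraph (Fin m)), IsPlanar G ∧
        m ≤ C * n ^ 2 ∧ G.edgeSet.ncard ≤ C * n ^ 2 ∧
        (2 : ℝ) ^ (c * √(n : ℝ)) ≤ (xc (stab G) : ℝ)) := by
  -- With `m = n.sqrt + 2` one has `m ^ 2 ≤ 9 * n` and `m ^ 4 ≤ 81 * n ^ 2`, so there are at most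
  -- `(18 + 1944 * 81) * n ^ 2 = 157482 * n ^ 2` edges, and fewer vertices are allowed by the other
  -- bound.
  refine ⟨isCrossoverGadget_crossoverGadget, ?_, 160000, 1 / 4, by norm_num, ?_⟩
  · intro H hH V _ G D first hfirst
    exact ⟨isPlanar_replaceCrossings D first hfirst hH,
      D.exists_face_replaceCrossings first hfirst hH⟩
  · intro n hn
    obtain ⟨N, G, hG, hN, hE, hxc⟩ := exists_planar_three_pow_le_xc (n.sqrt + 2)
    have hm : (n.sqrt + 2) ^ 2 ≤ 9 * n := by
      have h1 : n.sqrt ^ 2 ≤ n := Nat.sqrt_le' n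
      have h2 : 1 ≤ n.sqrt := Nat.le_sqrt'.2 (by simpa using hn)
      nlinarith
    have hm4 : (n.sqrt + 2) ^ 4 ≤ 81 * n ^ 2 := by
      calc (n.sqrt + 2) ^ 4 = ((n.sqrt + 2) ^ 2) ^ 2 := by ring
        _ ≤ (9 * n) ^ 2 := Nat.pow_le_pow_left hm 2
        _ = 81 * n ^ 2 := by ring
    have hnn : n ≤ n ^ 2 := Nat.le_self_pow two_ne_zero n
    exact ⟨N, G, hG, by omega, by omega, two_rpow_le_of_three_pow_le hn hxc⟩
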